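/- A fan $\Delta$ in $\mathbb{R}^d$ is a finite collection of pointed polyhedral cones that is closed under taking faces and in which any two cones meet in a common face; $\langle\sigma\rangle$ denotes the fan of all faces of a cone $\sigma$, $|\Delta|$ the union of the cones of $\Delta$, $\dim\Delta$ the maximal dimension of a cone of $\Delta$, and $o$ the zero cone. For $\sigma\in\Delta$, $\mathrm{link}_\Delta\sigma$ is the fan in $\mathbb{R}^d/\mathrm{Span}(\sigma)$ formed by the images $\overline\tau$ of the cones $\tau\in\Delta$ having $\sigma$ as a face. A fan $\Delta$ in $\mathbb{R}^d$ is quasi-convex if all its maximal cones have dimension $d$ and the support of its boundary fan (generated by the non-maximal cones contained in exactly one maximal cone) is a real homology manifold, possibly empty. It is Gorenstein if every $\sigma\in\Delta$ is generated by rational vectors and there is a linear function $G_\sigma$ on $\sigma$ that takes values in $\mathbb{Z}_{\ge0}$ on $\sigma\cap\mathbb{Z}^d$ and the value $1$ at the first nonzero lattice point of each ray of $\sigma$; these functions paste to the degree map $G:|\Delta|\to\mathbb{R}$. For a finite graded poset $P$ with least element $\hat0$, greatest element $\hat 1$ and rank function $\rho$, which is the face poset of a pointed cone (ranked by dimension)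 or the dual of such a poset, the toric polynomial $g(P;t)$ is $1$ if $\rho(\hat1)=0$, and otherwise is the unique polynomial of degree $<\rho(\hat1)/2$ with $t^{\rho(\hat1)}g(P;t^{-1})=\sum_{x\in P}g([\hat0,x];t)(t-1)^{\rho(\hat1)-\rho(x)}$. Write $g(\langle\sigma\rangle;t)$ for $g$ of the face poset of $\sigma$, and $g((\mathrm{link}_{\langle\sigma\rangle}\tau)^*;t)$ for $g$ of the dual of the face poset of $\mathrm{link}_{\langle\sigma\rangle}\tau$. The toric $h$-polynomial of a fan is given by $t^{\dim\Delta}h(\Delta;t^{-1})=\sum_{\sigma\in\Delta}g(\langle\sigma\rangle;t)(t-1)^{\dim\Delta-\dim\sigma}$. **Proposition.** Let $\Delta$ be a quasi-convex Gorenstein fan in $\mathbb{R}^d$ with degree map $G$. Then there are unique polynomials $h^*(\Delta;t)$ and $h^*(\langle\sigma\rangle;t)$, $\sigma\in\Delta$, with integer coefficients such that $$\sum_{\lambda\in\mathbb{Z}^d\cap|\Delta|}t^{G(\lambda)}=\frac{h^*(\Delta;t)}{(1-t)^{\dim\Delta}},\qquad \sum_{\lambda\in\mathbb{Z}^d\cap\sigma}t^{G(\lambda)}=\frac{h^*(\langle\sigma\rangle;t)}{(1-t)^{\dim\sigma}},$$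 and, with the local $h^*$-polynomials $$\ell^*(\langle\sigma\rangle;t)=\sum_{\tau\in\langle\sigma\rangle}h^*(\langle\tau\rangle;t)\,(-1)^{\dim\sigma-\dim\tau}\,g((\mathrm{link}_{\langle\sigma\rangle}\tau)^*;t),$$ one has $$h^*(\Delta;t)=\sum_{\sigma\in\Delta}\ell^*(\langle\sigma\rangle;t)\cdot h(\mathrm{link}_\Delta\sigma;t).$$ -/

import Mathlib

open Polynomial

namespace FanEhrhart

noncomputable section

/-! ### Cones, faces and fans -/

section Cones

variable {V : Type*} [AddCommGroup V] [Module ℝ V]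

/-- The dimension of a cone is the dimension of its linear span. -/
def coneDim (σ : PointedCone ℝ V) : ℕ :=
  Module.finrank ℝ (Submodule.span ℝ (σ : Set V))

/-- `F` is a face of `σ`: it is cut out of `σ` by a linear form that is nonnegative on `σ`. -/
def IsFace (F σ : PointedCone ℝ V) : Prop :=
  ∃ w : V →ₗ[ℝ] ℝ, (∀ u ∈ σ, 0 ≤ w u) ∧ (F : Set V) = {u | u ∈ σ ∧ w u = 0}

/-- The collection `⟨σ⟩` of all the faces of `σ`. -/
def faces (σ : PointedCone ℝ V) : Set (PointedCone ℝ V) := {F | IsFace F σ}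

/-- A finite collection of polyhedral cones that contain no line, closed under taking faces, and
in which any two cones meet in a common face. -/
structure IsFan (Δ : Set (PointedCone ℝ V)) : Prop where
  finite : Δ.Finite
  fg : ∀ σ ∈ Δ, σ.FG
  pointed : ∀ σ ∈ Δ, ∀ x ∈ σ, -x ∈ σ → x = 0
  face_mem : ∀ σ ∈ Δ, ∀ F, IsFace F σ → F ∈ Δ
  inter_face : ∀ σ ∈ Δ, ∀ τ ∈ Δ, IsFace (σ ⊓ τ) σ ∧ IsFace (σ ⊓ τ) τ

/-- The support `|Δ|`. -/
def support (Δ : Set (PointedCone ℝ V)) : Set V := {x | ∃ σ ∈ Δ, x ∈ σ}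

/-- The maximum of the dimensions of the cones. -/
def fanDim (Δ : Set (PointedCone ℝ V)) : ℕ := sSup (coneDim '' Δ)

/-- The maximal cones of `Δ`. -/
def IsMaximalCone (Δ : Set (PointedCone ℝ V)) (σ : PointedCone ℝ V) : Prop :=
  Maximal (· ∈ Δ) σ

/-- Every maximal cone is of dimension `n`. -/
def IsPure (n : ℕ) (Δ : Set (PointedCone ℝ V)) : Prop :=
  ∀ σ, IsMaximalCone Δ σ → coneDim σ = n

/-- The boundary fan `∂Δ`, generated by the non-maximal cones that are contained in exactly one
maximal cone. -/
def boundary (Δ : Set (PointedCone ℝ V)) : Set (PointedCone ℝ V) :=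
  {F | ∃ τ ∈ Δ, ¬ IsMaximalCone Δ τ ∧ (∃! σ, IsMaximalCone Δ σ ∧ τ ≤ σ) ∧ F ∈ faces τ}

/-- The link of `σ` in `Δ`: the images in `V ⧸ span σ` of the cones of `Δ` that have `σ` as a
face. -/
def link (Δ : Set (PointedCone ℝ V)) (σ : PointedCone ℝ V) :
    Set (PointedCone ℝ (V ⧸ Submodule.span ℝ (σ : Set V))) :=
  {γ | ∃ τ ∈ Δ, IsFace σ τ ∧ γ = PointedCone.map (Submodule.span ℝ (σ : Set V)).mkQ τ}

end Cones

/-! ### Real homology manifolds and quasi-convex fans -/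

section Homology

open CategoryTheory CategoryTheory.Limits AlgebraicTopology

/-- The local singular homology `H_k(X, X ∖ {x}; ℝ)`: the homology of the quotient of the singular
chain complex of `X` by that of `X ∖ {x}`. -/
def localHomology (X : Type) [TopologicalSpace X] (x : X) (k : ℕ) : ModuleCat.{0} ℝ :=
  (cokernel (((singularChainComplexFunctor (ModuleCat.{0} ℝ)).obj (ModuleCat.of ℝ ℝ)).map
    (TopCat.ofHom (⟨Subtype.val, continuous_subtype_val⟩ : C({y : X // y ≠ x}, X))))).homology k

/-- `X` is a real homology `n`-manifold: at every point the local homology with real coefficients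
is that of `ℝⁿ`. (The definition is applied to supports of fans only, which are closed polyhedral
subsets of `ℝᵈ`, so that local compactness and the like hold automatically.) -/
def IsRealHomologyManifold (n : ℕ) (X : Type) [TopologicalSpace X] : Prop :=
  ∀ x : X, Nonempty (localHomology X x n ≃ₗ[ℝ] ℝ) ∧
    ∀ k : ℕ, k ≠ n → Subsingleton (localHomology X x k)

/-- A purely `d`-dimensional fan in `ℝᵈ` is quasi-convex if the support of its boundary fan is a
real homology manifold (possibly empty). -/
structure IsQuasiConvex {d : ℕ} (Δ : Set (PointedCone ℝ (Fin d → ℝ))) : Prop where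
  isFan : IsFan Δ
  isPure : IsPure d Δ
  isManifold : ∃ n : ℕ, IsRealHomologyManifold n (support (boundary Δ))

end Homology

/-! ### Toric polynomials -/

open Classical in
/-- The polynomial with property `Q` (it is used for properties that determine a polynomial). -/
def thePoly (Q : ℤ[X] → Prop) : ℤ[X] := if h : ∃ p, Q p then h.choose else 0

/-- `t ^ n * p(t⁻¹) = q(t)`, as Laurent polynomials. -/
def IsReversal (n : ℕ) (p q : ℤ[X]) : Prop :=
  LaurentPolynomial.T (n : ℤ) * LaurentPolynomial.invert p.toLaurent = q.toLaurent

open Classical in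
/-- The toric `g`-polynomial of the lower interval `[0, x]` of a finite poset with rank function
`ρ`. It is `1` if `x` has rank `0`, and otherwise the unique polynomial `p` of degree strictly less
than `ρ x / 2` with
`t ^ ρ x * p(t⁻¹) = p(t) + ∑_{y < x} g([0, y]; t) * (t - 1) ^ (ρ x - ρ y)`.
(In a graded poset `y < x` implies `ρ y < ρ x`; the second condition is there for the recursion.) -/
def toricGPoset {P : Type*} [Preorder P] (ρ : P → ℕ) (x : P) : ℤ[X] :=
  if ρ x = 0 then 1 else
    thePoly fun p => 2 * p.natDegree < ρ x ∧
      IsReversal (ρ x) p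
        (p + ∑ᶠ y : {y : P // y < x ∧ ρ y < ρ x},
          toricGPoset ρ y.1 * (X - 1) ^ (ρ x - ρ y.1))
termination_by ρ x
decreasing_by exact y.2.2

section Toric

variable {V : Type*} [AddCommGroup V] [Module ℝ V]

/-- A cone is a face of itself. -/
theorem self_mem_faces (σ : PointedCone ℝ V) : σ ∈ faces σ :=
  ⟨0, by simp, by ext; simp⟩

/-- The toric `g`-polynomial `g(⟨σ⟩; t)`: the poset is the face poset of `σ`, ordered by inclusion
and ranked by dimension. -/
def toricG (σ : PointedCone ℝ V) : ℤ[X] :=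
  toricGPoset (fun τ : faces σ => coneDim τ.1) ⟨σ, self_mem_faces σ⟩

/-- The toric `h`-polynomial: the unique polynomial with
`t ^ dim Δ * h(Δ; t⁻¹) = ∑_{σ ∈ Δ} g(⟨σ⟩; t) * (t - 1) ^ (dim Δ - dim σ)`. -/
def toricH (Δ : Set (PointedCone ℝ V)) : ℤ[X] :=
  thePoly fun p =>
    IsReversal (fanDim Δ) p (∑ᶠ σ ∈ Δ, toricG σ * (X - 1) ^ (fanDim Δ - coneDim σ))

open Classical in
/-- `g(Δ*; t)` for the dual `Δ*` of the face poset of a fan `Δ` with a largest cone. The greatest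
element of `Δ*` is the zero cone, and the rank in `Δ*` of a cone of `Δ` is its codimension. -/
def toricGDual (Δ : Set (PointedCone ℝ V)) : ℤ[X] :=
  if h : (⊥ : PointedCone ℝ V) ∈ Δ then
    toricGPoset (fun γ : (Δ : Type _)ᵒᵈ => fanDim Δ - coneDim (OrderDual.ofDual γ).1)
      (OrderDual.toDual ⟨⊥, h⟩)
  else 0

end Toric

/-! ### Ehrhart theory of Gorenstein fans -/

section Ehrhart

variable {d : ℕ}

/-- The points of the lattice `ℤᵈ` in `ℝᵈ`. -/
def latticePoint (m : Fin d → ℤ) : Fin d → ℝ := fun i => (m i : ℝ)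

/-- A cone generated by finitely many rational vectors. -/
def IsRational (σ : PointedCone ℝ (Fin d → ℝ)) : Prop :=
  ∃ s : Finset (Fin d → ℚ), σ = PointedCone.hull ℝ ((fun q i => (q i : ℝ)) '' (s : Set (Fin d → ℚ)))

/-- `m` is the first nonzero lattice point on some ray (one-dimensional face) of `σ`. -/
def IsPrimitiveGenerator (σ : PointedCone ℝ (Fin d → ℝ)) (m : Fin d → ℤ) : Prop :=
  m ≠ 0 ∧ ∃ r ∈ faces σ, coneDim r = 1 ∧ latticePoint m ∈ r ∧
    ∀ m' : Fin d → ℤ, m' ≠ 0 → latticePoint m' ∈ r →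
      ∃ c : ℝ, 1 ≤ c ∧ latticePoint m' = c • latticePoint m

/-- The restriction of `G` to `σ` is the linear function that makes `σ` Gorenstein. -/
def IsGorensteinForm (σ : PointedCone ℝ (Fin d → ℝ)) (G : (Fin d → ℝ) →ₗ[ℝ] ℝ) : Prop :=
  (∀ m : Fin d → ℤ, latticePoint m ∈ σ → ∃ n : ℕ, G (latticePoint m) = n) ∧
    ∀ m : Fin d → ℤ, IsPrimitiveGenerator σ m → G (latticePoint m) = 1

/-- A fan is Gorenstein if each of its cones is a rational Gorenstein cone. -/
def IsGorenstein (Δ : Set (PointedCone ℝ (Fin d → ℝ))) : Prop :=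
  ∀ σ ∈ Δ, IsRational σ ∧ ∃ G, IsGorensteinForm σ G

open Classical in
/-- The degree map of a Gorenstein fan, pasted together from the linear functions of its cones
(its value off the support is irrelevant). -/
def degreeMap (Δ : Set (PointedCone ℝ (Fin d → ℝ))) (x : Fin d → ℝ) : ℝ :=
  if h : ∃ r : ℝ, ∃ σ ∈ Δ, x ∈ σ ∧ ∃ G, IsGorensteinForm σ G ∧ G x = r then h.choose else 0

/-- The Ehrhart series: the coefficient of `t ^ n` counts the lattice points of degree `n` in the
support. -/
def ehrhartSeries (Δ : Set (PointedCone ℝ (Fin d → ℝ))) : PowerSeries ℤ :=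
  PowerSeries.mk fun n =>
    (({m : Fin d → ℤ | latticePoint m ∈ support Δ ∧
      degreeMap Δ (latticePoint m) = n}.ncard : ℕ) : ℤ)

/-- `Ehr_Δ(t) = p(t) / (1 - t) ^ dim Δ`. -/
def IsHStar (Δ : Set (PointedCone ℝ (Fin d → ℝ))) (p : ℤ[X]) : Prop :=
  ehrhartSeries Δ * (1 - PowerSeries.X) ^ fanDim Δ = (p : PowerSeries ℤ)

/-- The `h*`-polynomial of a Gorenstein fan. -/
def hStar (Δ : Set (PointedCone ℝ (Fin d → ℝ))) : ℤ[X] := thePoly (IsHStar Δ)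

/-- The local `h*`-polynomial of a Gorenstein cone. -/
def localHStar (σ : PointedCone ℝ (Fin d → ℝ)) : ℤ[X] :=
  ∑ᶠ τ ∈ faces σ,
    hStar (faces τ) * (-1) ^ (coneDim σ - coneDim τ) * toricGDual (link (faces σ) τ)

end Ehrhart

end

end FanEhrhart

/-!
The proof compares two sums over the pairs `τ ≤ σ` of cones of `Δ`; both sides of the formula for
`hStar Δ` are equal to the sum of
`hStar ⟨τ⟩ * (-1) ^ (dim σ - dim τ) * (1 - t) ^ (d - dim τ)`.

For the left-hand side, each lattice point of the support lies in a smallest cone of the fan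
(`IsFan.exists_carrier`). Let `e σ` be the generating function of the points with smallest cone `σ`.
The Ehrhart series of `Δ` is the sum of all `e σ`, and that of `⟨σ⟩` is the sum of `e τ` over
`τ ≤ σ`. The poset of cones is Eulerian (`IsFan.isEulerian`), so that its Möbius function is
`(-1) ^ (dim σ - dim τ)`, and Möbius inversion (`IsEulerian.mobius_inversion`) expresses `e σ` by
the Ehrhart series of the cones `τ ≤ σ`, which are `hStar ⟨τ⟩ / (1 - t) ^ dim τ`.

For the right-hand side, the polynomials `g` of the intervals of an Eulerian poset and of their
duals are the two Kazhdan–Lusztig–Stanley functions of the kernel `(t - 1) ^ (ρ y - ρ x)`. Taken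
with signs, the dual ones are inverse to the others in the incidence algebra
(`IsEulerian.signedGDual_mul_intervalG`). Since `h (link σ)` is the reversal of
`∑ g([σ, ρ]) * (t - 1) ^ (d - dim ρ)`, which is where purity of the fan is used, the inversion
formula evaluates `∑ (-1) ^ (dim σ - dim τ) * g([τ, σ]*) * h (link σ)`, the sum over `σ ≥ τ`
(`IsEulerian.exists_reversal_of_sum`).

The Eulerian property is the Euler relation `∑ (-1) ^ dim F = 0` for the faces of a nonzero pointed
cone (`finsum_faces_neg_one_pow_coneDim`), applied to images of cones modulo the span of a face. It
comes from an elementary Euler characteristic: a relatively open convex cone contributes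
`(-1) ^ dim`, this is additive under cutting by hyperplanes, and the relative interior of the cone
is partitioned into the shadows of the proper faces `F`, of dimension `dim F + 1`, in the direction
of an interior point. The Euler relation also makes the toric polynomials exist
(`IsEulerian.toricGPoset_spec`).

The polynomial `hStar` of a cone exists because a pointed rational cone is generated by its
primitive generators (`IsRational.exists_generators`), all of degree one, so that its lattice points
form a finitely generated module over the monoid spanned by these. Least expressions
(`countSeries_lattice_mul_mem`) reduce the generating function to those of lower sets of `ℕ ^ k`
that contain no coordinate cone of dimension more than `dim σ`, and these have denominator
`(1 - t) ^ dim σ` (`countSeries_lowerSet_mul_mem`). Uniqueness is the injectivity of the map from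
polynomials to power series.
-/

namespace FanEhrhart

noncomputable section

/-! ### Half-space descriptions of finitely generated cones -/

section HalfSpaces

variable {V : Type*} [AddCommGroup V] [Module ℝ V]

/-- The cone `σ` is the set of solutions of the inequalities `0 ≤ l x`, `l ∈ A`. -/
def IsCutOut (A : Finset (V →ₗ[ℝ] ℝ)) (σ : PointedCone ℝ V) : Prop :=
  ∀ x, x ∈ σ ↔ ∀ l ∈ A, 0 ≤ l x

theorem exists_isCutOut_bot [FiniteDimensional ℝ V] :
    ∃ A : Finset (V →ₗ[ℝ] ℝ), IsCutOut A (⊥ : PointedCone ℝ V) := by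
  classical
  let b := Module.finBasis ℝ V
  refine ⟨Finset.univ.image b.coord ∪ Finset.univ.image (fun i => -b.coord i), fun x => ?_⟩
  rw [Submodule.mem_bot]
  constructor
  · rintro rfl l -
    simp
  · intro h
    refine b.ext_elem fun i => ?_
    have h1 := h (b.coord i) (by simp)
    have h2 := h (-b.coord i) (by simp)
    simp only [LinearMap.neg_apply, Module.Basis.coord_apply] at h1 h2
    rw [map_zero, Finsupp.zero_apply]
    linarith

theorem mem_sup_hull_singleton {σ : PointedCone ℝ V} {v x : V} :
    x ∈ σ ⊔ PointedCone.hull ℝ {v} ↔ ∃ s : ℝ, 0 ≤ s ∧ x - s • v ∈ σ := by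
  rw [Submodule.mem_sup]
  constructor
  · rintro ⟨y, hy, z, hz, rfl⟩
    obtain ⟨c, rfl⟩ := Submodule.mem_span_singleton.1 hz
    exact ⟨c.1, c.2, by
      have : y + c • v - (c : ℝ) • v = y := by
        rw [show c • v = (c : ℝ) • v from rfl]; abel
      rwa [this]⟩
  · rintro ⟨s, hs, h⟩
    exact ⟨_, h, s • v, Submodule.mem_span_singleton.2 ⟨⟨s, hs⟩, rfl⟩, by abel⟩

/-- One step of Fourier–Motzkin elimination. -/
theorem IsCutOut.exists_sup_hull_singleton {A : Finset (V →ₗ[ℝ] ℝ)} {σ : PointedCone ℝ V}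
    (hA : IsCutOut A σ) (v : V) :
    ∃ B : Finset (V →ₗ[ℝ] ℝ), IsCutOut B (σ ⊔ PointedCone.hull ℝ {v}) := by
  classical
  refine ⟨A.filter (fun l => 0 ≤ l v) ∪
    ((A ×ˢ A).filter (fun p => p.1 v < 0 ∧ 0 < p.2 v)).image
      (fun p => p.2 v • p.1 - p.1 v • p.2), fun x => ?_⟩
  rw [mem_sup_hull_singleton]
  constructor
  · rintro ⟨s, hs, h⟩ l hl
    rw [hA] at h
    rcases Finset.mem_union.1 hl with hl | hl
    · obtain ⟨hl, hv⟩ := Finset.mem_filter.1 hl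
      have := h l hl
      simp only [map_sub, map_smul, smul_eq_mul] at this
      nlinarith
    · obtain ⟨p, hp, rfl⟩ := Finset.mem_image.1 hl
      obtain ⟨hp, h1, h2⟩ := Finset.mem_filter.1 hp
      obtain ⟨hp1, hp2⟩ := Finset.mem_product.1 hp
      have e1 := h _ hp1
      have e2 := h _ hp2
      simp only [map_sub, map_smul, smul_eq_mul, LinearMap.sub_apply, LinearMap.smul_apply]
        at e1 e2 ⊢
      nlinarith [mul_nonneg h2.le e1, mul_nonneg (neg_pos.2 h1).le e2]
  · intro h
    -- the largest of the lower bounds that the constraints put on the coefficient of `v`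
    set S : Finset ℝ := insert 0 ((A.filter (fun l => l v < 0)).image (fun l => l x / l v)) with hS
    have hne : S.Nonempty := Finset.insert_nonempty _ _
    refine ⟨S.max' hne, S.le_max' _ (Finset.mem_insert_self _ _), (hA _).2 fun l hl => ?_⟩
    simp only [map_sub, map_smul, smul_eq_mul]
    rcases lt_trichotomy (l v) 0 with hv | hv | hv
    · have : l x / l v ≤ S.max' hne := S.le_max' _ (Finset.mem_insert_of_mem
        (Finset.mem_image.2 ⟨l, Finset.mem_filter.2 ⟨hl, hv⟩, rfl⟩))
      rw [div_le_iff_of_neg hv] at this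
      linarith
    · have := h l (Finset.mem_union_left _ (Finset.mem_filter.2 ⟨hl, hv.ge⟩))
      rw [hv]; linarith
    · have h0 := h l (Finset.mem_union_left _ (Finset.mem_filter.2 ⟨hl, hv.le⟩))
      have : S.max' hne ≤ l x / l v := by
        refine Finset.max'_le _ _ _ fun y hy => ?_
        rcases Finset.mem_insert.1 hy with rfl | hy
        · positivity
        · obtain ⟨l', hl', rfl⟩ := Finset.mem_image.1 hy
          obtain ⟨hl', hv'⟩ := Finset.mem_filter.1 hl'
          have := h _ (Finset.mem_union_right _ (Finset.mem_image.2
            ⟨(l', l), Finset.mem_filter.2 ⟨Finset.mem_product.2 ⟨hl', hl⟩, hv', hv⟩, rfl⟩))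
          simp only [LinearMap.sub_apply, LinearMap.smul_apply, smul_eq_mul] at this
          rw [div_le_iff_of_neg hv', div_mul_eq_mul_div, div_le_iff₀ hv]
          linarith
      rw [le_div_iff₀ hv] at this
      linarith

/-- Weyl's theorem: a finitely generated cone is cut out by finitely many linear inequalities. -/
theorem exists_isCutOut [FiniteDimensional ℝ V] {σ : PointedCone ℝ V} (h : σ.FG) :
    ∃ A : Finset (V →ₗ[ℝ] ℝ), IsCutOut A σ := by
  classical
  obtain ⟨s, rfl⟩ := h
  induction s using Finset.induction_on with
  | empty => simpa using exists_isCutOut_bot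
  | insert v s _ ih =>
    obtain ⟨A, hA⟩ := ih
    obtain ⟨B, hB⟩ := hA.exists_sup_hull_singleton v
    refine ⟨B, ?_⟩
    rwa [Finset.coe_insert, Submodule.span_insert, sup_comm]

end HalfSpaces

/-! ### Faces -/

section Faces

variable {V : Type*} [AddCommGroup V] [Module ℝ V]

theorem IsFace.le {F σ : PointedCone ℝ V} (h : IsFace F σ) : F ≤ σ := by
  obtain ⟨w, -, hF⟩ := h
  intro x hx
  have : x ∈ (F : Set V) := hx
  rw [hF] at this
  exact this.1

theorem IsFace.refl (σ : PointedCone ℝ V) : IsFace σ σ := self_mem_faces σ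

theorem IsFace.mem_of_add_mem {F σ : PointedCone ℝ V} (h : IsFace F σ) {x y : V} (hx : x ∈ σ)
    (hy : y ∈ σ) (hxy : x + y ∈ F) : x ∈ F := by
  obtain ⟨w, hw, hF⟩ := h
  have h1 : x + y ∈ (F : Set V) := hxy
  rw [hF] at h1
  have h2 := h1.2
  rw [map_add] at h2
  have : x ∈ (F : Set V) := by
    rw [hF]
    exact ⟨hx, by linarith [hw x hx, hw y hy]⟩
  exact this

/-- Points of `span F` that lie in `σ` are in the face `F`. -/
theorem IsFace.mem_of_mem_span {F σ : PointedCone ℝ V} (h : IsFace F σ) {x : V} (hx : x ∈ σ)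
    (hs : x ∈ Submodule.span ℝ (F : Set V)) : x ∈ F := by
  obtain ⟨w, hw, hF⟩ := h
  have h1 : Submodule.span ℝ (F : Set V) ≤ LinearMap.ker w := by
    rw [Submodule.span_le, hF]
    exact fun y hy => hy.2
  have : x ∈ (F : Set V) := by
    rw [hF]
    exact ⟨hx, h1 hs⟩
  exact this

theorem exists_sub_of_mem_span {σ : PointedCone ℝ V} {u : V}
    (hu : u ∈ Submodule.span ℝ (σ : Set V)) : ∃ a ∈ σ, ∃ b ∈ σ, u = a - b := by
  induction hu using Submodule.span_induction with
  | mem x hx => exact ⟨x, hx, 0, zero_mem _, by simp⟩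
  | zero => exact ⟨0, zero_mem _, 0, zero_mem _, by simp⟩
  | add x y _ _ hx hy =>
    obtain ⟨a, ha, b, hb, rfl⟩ := hx
    obtain ⟨a', ha', b', hb', rfl⟩ := hy
    exact ⟨a + a', add_mem ha ha', b + b', add_mem hb hb', by abel⟩
  | smul c x _ hx =>
    obtain ⟨a, ha, b, hb, rfl⟩ := hx
    rcases le_total 0 c with hc | hc
    · exact ⟨c • a, σ.smul_mem hc ha, c • b, σ.smul_mem hc hb, smul_sub _ _ _⟩
    · refine ⟨(-c) • b, σ.smul_mem (by linarith) hb, (-c) • a, σ.smul_mem (by linarith) ha, ?_⟩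
      rw [smul_sub]; module

theorem coneDim_mono [FiniteDimensional ℝ V] {σ τ : PointedCone ℝ V} (h : σ ≤ τ) :
    coneDim σ ≤ coneDim τ :=
  Submodule.finrank_mono (Submodule.span_mono h)

theorem IsFace.coneDim_lt [FiniteDimensional ℝ V] {F σ : PointedCone ℝ V} (h : IsFace F σ)
    (hne : F ≠ σ) : coneDim F < coneDim σ := by
  refine Submodule.finrank_lt_finrank_of_lt
    (lt_of_le_of_ne (Submodule.span_mono h.le) fun he => hne (le_antisymm h.le fun x hx => ?_))
  exact h.mem_of_mem_span hx (he ▸ Submodule.subset_span hx)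

theorem coneDim_eq_zero [FiniteDimensional ℝ V] {σ : PointedCone ℝ V} :
    coneDim σ = 0 ↔ σ = ⊥ := by
  rw [coneDim, Submodule.finrank_eq_zero, Submodule.span_eq_bot]
  constructor
  · intro h
    exact (Submodule.eq_bot_iff _).2 h
  · rintro rfl x hx
    exact hx

variable {A : Finset (V →ₗ[ℝ] ℝ)} {σ : PointedCone ℝ V}

/-- The inequalities of a system that are equations on `F`. -/
def activeSet (A : Finset (V →ₗ[ℝ] ℝ)) (F : PointedCone ℝ V) : Finset (V →ₗ[ℝ] ℝ) := by
  classical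
  exact A.filter fun l => ∀ x ∈ F, l x = 0

theorem mem_activeSet {F : PointedCone ℝ V} {l : V →ₗ[ℝ] ℝ} :
    l ∈ activeSet A F ↔ l ∈ A ∧ ∀ x ∈ F, l x = 0 := by
  classical
  simp [activeSet]

/-- The relative interior of a face of the cone cut out by `A`. -/
def relInt (A : Finset (V →ₗ[ℝ] ℝ)) (F : PointedCone ℝ V) : Set V :=
  {x | x ∈ F ∧ ∀ l ∈ A, l ∉ activeSet A F → 0 < l x}

theorem IsCutOut.relInt_nonempty (hA : IsCutOut A σ) {F : PointedCone ℝ V} (hF : F ≤ σ) :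
    (relInt A F).Nonempty := by
  classical
  have key : ∀ B ⊆ A, ∃ x ∈ F, ∀ l ∈ B, l ∉ activeSet A F → 0 < l x := by
    intro B
    induction B using Finset.induction_on with
    | empty => exact fun _ => ⟨0, zero_mem _, by simp⟩
    | insert l B _ ih =>
      intro hB
      obtain ⟨x, hx, h⟩ := ih fun _ h => hB (Finset.mem_insert_of_mem h)
      have hlA : l ∈ A := hB (Finset.mem_insert_self _ _)
      by_cases hl : l ∈ activeSet A F
      · refine ⟨x, hx, fun l' hl' hn => ?_⟩
        rcases Finset.mem_insert.1 hl' with rfl | hl'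
        · exact absurd hl hn
        · exact h l' hl' hn
      · have : ∃ y ∈ F, l y ≠ 0 := by
          by_contra! hc
          exact hl (mem_activeSet.2 ⟨hlA, hc⟩)
        obtain ⟨y, hy, hly⟩ := this
        have hpos : 0 < l y := lt_of_le_of_ne ((hA y).1 (hF hy) l hlA) hly.symm
        refine ⟨x + y, add_mem hx hy, fun l' hl' hn => ?_⟩
        rw [map_add]
        rcases Finset.mem_insert.1 hl' with rfl | hl'
        · linarith [(hA x).1 (hF hx) l' hlA]
        · linarith [h l' hl' hn, (hA y).1 (hF hy) l' (hB (Finset.mem_insert_of_mem hl'))]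
  obtain ⟨x, hx, h⟩ := key A subset_rfl
  exact ⟨x, hx, h⟩

/-- Finitely many positive numbers `a i` stay positive after subtracting a small multiple of
`b i`. -/
theorem exists_pos_forall_sub_mul_pos {ι : Type*} (s : Finset ι) (a b : ι → ℝ)
    (h : ∀ i ∈ s, 0 < a i) : ∃ ε > 0, ∀ i ∈ s, 0 < a i - ε * b i := by
  classical
  induction s using Finset.induction_on with
  | empty => exact ⟨1, one_pos, by simp⟩
  | insert i s _ ih =>
    obtain ⟨ε, hε, h'⟩ := ih fun j hj => h j (Finset.mem_insert_of_mem hj)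
    have hi := h i (Finset.mem_insert_self _ _)
    refine ⟨min ε (a i / (|b i| + 1)), by positivity, fun j hj => ?_⟩
    have hp : 0 < min ε (a i / (|b i| + 1)) := by positivity
    rcases Finset.mem_insert.1 hj with rfl | hj
    · have h1 : min ε (a j / (|b j| + 1)) * (|b j| + 1) ≤ a j := by
        rw [← le_div_iff₀ (by positivity)]; exact min_le_right _ _
      nlinarith [le_abs_self (b j)]
    · have h1 := min_le_left ε (a i / (|b i| + 1))
      rcases le_total (b j) 0 with hb | hb
      · nlinarith [h j (Finset.mem_insert_of_mem hj)]
      · nlinarith [h' j hj]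

/-- A face is cut out of `σ` by the equations that hold on it. -/
theorem IsCutOut.mem_face_iff (hA : IsCutOut A σ) {F : PointedCone ℝ V} (hF : IsFace F σ) {x : V}
    (hx : x ∈ σ) : x ∈ F ↔ ∀ l ∈ activeSet A F, l x = 0 := by
  refine ⟨fun h l hl => (mem_activeSet.1 hl).2 x h, fun h => ?_⟩
  obtain ⟨p, hp, hpos⟩ := hA.relInt_nonempty hF.le
  classical
  obtain ⟨ε, hε, h'⟩ := exists_pos_forall_sub_mul_pos (A \ activeSet A F) (fun l => l p)
    (fun l => l x) fun l hl => hpos l (Finset.mem_sdiff.1 hl).1 (Finset.mem_sdiff.1 hl).2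
  have hmem : p - ε • x ∈ σ := by
    refine (hA _).2 fun l hl => ?_
    rw [map_sub, map_smul, smul_eq_mul]
    by_cases hla : l ∈ activeSet A F
    · rw [h l hla, (mem_activeSet.1 hla).2 p hp]; simp
    · exact (h' l (Finset.mem_sdiff.2 ⟨hl, hla⟩)).le
  have := hF.mem_of_add_mem (σ.smul_mem hε.le hx) hmem (by simpa using hp)
  exact (F.smul_mem_iff hε).1 this

/-- The face of `σ` on which the inequalities in `J` are equations. -/
def faceOf (σ : PointedCone ℝ V) (J : Finset (V →ₗ[ℝ] ℝ)) : PointedCone ℝ V where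
  carrier := {x | x ∈ σ ∧ ∀ l ∈ J, l x = 0}
  add_mem' := fun ⟨h1, h2⟩ ⟨h3, h4⟩ =>
    ⟨add_mem h1 h3, fun l hl => by rw [map_add, h2 l hl, h4 l hl, add_zero]⟩
  zero_mem' := ⟨zero_mem _, fun l _ => map_zero l⟩
  smul_mem' := fun c x ⟨h1, h2⟩ => ⟨σ.smul_mem c.2 h1, fun l hl => by
    rw [show c • x = (c : ℝ) • x from rfl, map_smul, h2 l hl, smul_zero]⟩

theorem mem_faceOf {J : Finset (V →ₗ[ℝ] ℝ)} {x : V} :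
    x ∈ faceOf σ J ↔ x ∈ σ ∧ ∀ l ∈ J, l x = 0 := Iff.rfl

theorem IsCutOut.isFace_faceOf (hA : IsCutOut A σ) {J : Finset (V →ₗ[ℝ] ℝ)} (hJ : J ⊆ A) :
    IsFace (faceOf σ J) σ := by
  refine ⟨∑ l ∈ J, l, fun u hu => ?_, ?_⟩
  · rw [LinearMap.sum_apply]
    exact Finset.sum_nonneg fun l hl => (hA u).1 hu l (hJ hl)
  · ext u
    simp only [SetLike.mem_coe, mem_faceOf, Set.mem_ofPred_eq, and_congr_right_iff]
    intro hu
    rw [LinearMap.sum_apply, Finset.sum_eq_zero_iff_of_nonneg fun l hl => (hA u).1 hu l (hJ hl)]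

theorem IsCutOut.face_ext (hA : IsCutOut A σ) {F F' : PointedCone ℝ V} (hF : IsFace F σ)
    (hF' : IsFace F' σ) (h : activeSet A F = activeSet A F') : F = F' := by
  ext x
  constructor
  · exact fun hx => (hA.mem_face_iff hF' (hF.le hx)).2 (h ▸ (hA.mem_face_iff hF (hF.le hx)).1 hx)
  · exact fun hx => (hA.mem_face_iff hF (hF'.le hx)).2 (h ▸ (hA.mem_face_iff hF' (hF'.le hx)).1 hx)

theorem IsCutOut.finite_faces (hA : IsCutOut A σ) : (faces σ).Finite := by
  refine Set.Finite.of_finite_image (f := activeSet A)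
    ((A.powerset.finite_toSet).subset ?_) fun F hF F' hF' h => hA.face_ext hF hF' h
  rintro _ ⟨F, -, rfl⟩
  rw [Finset.mem_coe, Finset.mem_powerset]
  exact fun l hl => (mem_activeSet.1 hl).1

/-- Every point of `σ` lies in the relative interior of some face. -/
theorem IsCutOut.exists_face_mem_relInt (hA : IsCutOut A σ) {x : V} (hx : x ∈ σ) :
    ∃ F, IsFace F σ ∧ x ∈ relInt A F := by
  classical
  set J := A.filter fun l => l x = 0 with hJ
  have hmem : x ∈ faceOf σ J := mem_faceOf.2 ⟨hx, fun l hl => (Finset.mem_filter.1 hl).2⟩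
  refine ⟨faceOf σ J, hA.isFace_faceOf (Finset.filter_subset _ _), hmem, fun l hl hn => ?_⟩
  refine lt_of_le_of_ne ((hA x).1 hx l hl) fun h0 => hn (mem_activeSet.2 ⟨hl, fun y hy => ?_⟩)
  exact (mem_faceOf.1 hy).2 l (Finset.mem_filter.2 ⟨hl, h0.symm⟩)

theorem activeSet_eq_of_mem_relInt {F : PointedCone ℝ V} {x : V} (hx : x ∈ relInt A F)
    {l : V →ₗ[ℝ] ℝ} : l ∈ activeSet A F ↔ l ∈ A ∧ l x = 0 := by
  refine ⟨fun h => ⟨(mem_activeSet.1 h).1, (mem_activeSet.1 h).2 x hx.1⟩, fun ⟨h1, h2⟩ => ?_⟩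
  by_contra hn
  exact (hx.2 l h1 hn).ne' h2

end Faces

/-! ### Euler characteristics of relatively open cones -/

section EulerCharacteristic

variable {V : Type*} [AddCommGroup V] [Module ℝ V]

/-- A relatively open convex cone. Openness in the linear span is expressed algebraically: one can
move a little from any point of `S` away from any other point of `S`. -/
structure IsRelOpenCone (S : Set V) : Prop where
  add_mem : ∀ x ∈ S, ∀ y ∈ S, x + y ∈ S
  smul_mem : ∀ c : ℝ, 0 < c → ∀ x ∈ S, c • x ∈ S
  exists_sub_mem : ∀ x ∈ S, ∀ y ∈ S, ∃ ε : ℝ, 0 < ε ∧ x - ε • y ∈ S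

namespace IsRelOpenCone

variable {S : Set V}

theorem exists_forall_sub_mem (hS : IsRelOpenCone S) {x y : V} (hx : x ∈ S) (hy : y ∈ S) :
    ∃ ε : ℝ, 0 < ε ∧ ∀ δ, 0 < δ → δ ≤ ε → x - δ • y ∈ S := by
  obtain ⟨ε, hε, h⟩ := hS.exists_sub_mem x hx y hy
  refine ⟨ε, hε, fun δ hδ hle => ?_⟩
  rcases hle.eq_or_lt with rfl | hlt
  · exact h
  have h1 : 0 < 1 - δ / ε := by rw [sub_pos, div_lt_one hε]; exact hlt
  have := hS.add_mem _ (hS.smul_mem _ (div_pos hδ hε) _ h) _ (hS.smul_mem _ h1 _ hx)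
  convert! this using 1
  rw [smul_sub, smul_smul, div_mul_cancel₀ _ hε.ne']
  module

theorem exists_eq_sub_of_mem_span (hS : IsRelOpenCone S) (hne : S.Nonempty) {u : V}
    (hu : u ∈ Submodule.span ℝ S) : ∃ a ∈ S, ∃ b ∈ S, u = a - b := by
  obtain ⟨p, hp⟩ := hne
  induction hu using Submodule.span_induction with
  | mem x hx => exact ⟨x + p, hS.add_mem _ hx _ hp, p, hp, by abel⟩
  | zero => exact ⟨p, hp, p, hp, by simp⟩
  | add x y _ _ hx hy =>
    obtain ⟨a, ha, b, hb, rfl⟩ := hx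
    obtain ⟨a', ha', b', hb', rfl⟩ := hy
    exact ⟨a + a', hS.add_mem _ ha _ ha', b + b', hS.add_mem _ hb _ hb', by abel⟩
  | smul c x _ hx =>
    obtain ⟨a, ha, b, hb, rfl⟩ := hx
    rcases lt_trichotomy c 0 with hc | hc | hc
    · refine ⟨(-c) • b, hS.smul_mem _ (by linarith) _ hb, (-c) • a,
        hS.smul_mem _ (by linarith) _ ha, ?_⟩
      module
    · exact ⟨p, hp, p, hp, by simp [hc]⟩
    · exact ⟨c • a, hS.smul_mem _ hc _ ha, c • b, hS.smul_mem _ hc _ hb, smul_sub _ _ _⟩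

theorem exists_add_smul_mem (hS : IsRelOpenCone S) {x u : V} (hx : x ∈ S)
    (hu : u ∈ Submodule.span ℝ S) : ∃ ε : ℝ, 0 < ε ∧ x + ε • u ∈ S := by
  obtain ⟨a, ha, b, hb, rfl⟩ := hS.exists_eq_sub_of_mem_span ⟨x, hx⟩ hu
  obtain ⟨ε, hε, h⟩ := hS.exists_sub_mem x hx b hb
  refine ⟨ε, hε, ?_⟩
  convert! hS.add_mem _ h _ (hS.smul_mem ε hε a ha) using 1
  module

theorem inter_pos (hS : IsRelOpenCone S) (l : V →ₗ[ℝ] ℝ) :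
    IsRelOpenCone (S ∩ {x | 0 < l x}) where
  add_mem := fun x ⟨hx, h1⟩ y ⟨hy, h2⟩ => ⟨hS.add_mem x hx y hy, by
    simp only [Set.mem_ofPred_eq, map_add] at *; linarith⟩
  smul_mem := fun c hc x ⟨hx, h1⟩ => ⟨hS.smul_mem c hc x hx, by
    simp only [Set.mem_ofPred_eq, map_smul, smul_eq_mul] at *; positivity⟩
  exists_sub_mem := fun x ⟨hx, h1⟩ y ⟨hy, h2⟩ => by
    obtain ⟨ε, hε, h⟩ := hS.exists_forall_sub_mem hx hy
    simp only [Set.mem_ofPred_eq] at h1 h2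
    have hp : 0 < min ε (l x / (2 * l y)) := by positivity
    refine ⟨_, hp, h _ hp (min_le_left _ _), ?_⟩
    have := min_le_right ε (l x / (2 * l y))
    rw [le_div_iff₀ (by positivity)] at this
    simp only [Set.mem_ofPred_eq, map_sub, map_smul, smul_eq_mul]
    linarith

theorem inter_neg (hS : IsRelOpenCone S) (l : V →ₗ[ℝ] ℝ) :
    IsRelOpenCone (S ∩ {x | l x < 0}) := by
  have := hS.inter_pos (-l)
  simpa using this

theorem inter_zero (hS : IsRelOpenCone S) (l : V →ₗ[ℝ] ℝ) :
    IsRelOpenCone (S ∩ {x | l x = 0}) where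
  add_mem := fun x ⟨hx, h1⟩ y ⟨hy, h2⟩ => ⟨hS.add_mem x hx y hy, by
    simp only [Set.mem_ofPred_eq, map_add] at *; linarith⟩
  smul_mem := fun c hc x ⟨hx, h1⟩ => ⟨hS.smul_mem c hc x hx, by
    simp only [Set.mem_ofPred_eq, map_smul, smul_eq_mul] at *; simp [h1]⟩
  exists_sub_mem := fun x ⟨hx, h1⟩ y ⟨hy, h2⟩ => by
    obtain ⟨ε, hε, h⟩ := hS.exists_sub_mem x hx y hy
    refine ⟨ε, hε, h, ?_⟩
    simp only [Set.mem_ofPred_eq, map_sub, map_smul, smul_eq_mul] at *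
    simp [h1, h2]

theorem span_inter_pos (hS : IsRelOpenCone S) {l : V →ₗ[ℝ] ℝ} {a : V} (ha : a ∈ S)
    (hla : 0 < l a) : Submodule.span ℝ (S ∩ {x | 0 < l x}) = Submodule.span ℝ S := by
  refine le_antisymm (Submodule.span_mono Set.inter_subset_left) (Submodule.span_le.2 fun u hu => ?_)
  -- a large multiple of `a` dominates `u`
  set c : ℝ := (|l u| + 1) / l a
  have hc : 0 < c := by positivity
  have hca : c * l a = |l u| + 1 := div_mul_cancel₀ _ hla.ne'
  have h1 : c • a + u ∈ S ∩ {x | 0 < l x} := by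
    refine ⟨hS.add_mem _ (hS.smul_mem c hc a ha) _ hu, ?_⟩
    simp only [Set.mem_ofPred_eq, map_add, map_smul, smul_eq_mul, hca]
    linarith [neg_abs_le (l u)]
  have h2 : c • a ∈ S ∩ {x | 0 < l x} := by
    refine ⟨hS.smul_mem c hc a ha, ?_⟩
    simp only [Set.mem_ofPred_eq, map_smul, smul_eq_mul, hca]
    positivity
  have := Submodule.sub_mem _ (Submodule.subset_span (R := ℝ) h1) (Submodule.subset_span h2)
  simpa using this

theorem span_inter_zero (hS : IsRelOpenCone S) {l : V →ₗ[ℝ] ℝ} {z : V} (hz : z ∈ S)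
    (hlz : l z = 0) :
    Submodule.span ℝ (S ∩ {x | l x = 0}) = Submodule.span ℝ S ⊓ LinearMap.ker l := by
  refine le_antisymm (Submodule.span_le.2 fun x hx => ⟨Submodule.subset_span hx.1, hx.2⟩) ?_
  rintro u ⟨hu, hlu⟩
  obtain ⟨ε, hε, h⟩ := hS.exists_add_smul_mem hz hu
  have hlu : l u = 0 := hlu
  have h1 : z + ε • u ∈ S ∩ {x | l x = 0} := ⟨h, by simp [hlz, hlu]⟩
  have h2 := Submodule.sub_mem _ (Submodule.subset_span (R := ℝ) h1)
    (Submodule.subset_span (⟨hz, hlz⟩ : z ∈ S ∩ {x | l x = 0}))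
  have h3 := Submodule.smul_mem _ ε⁻¹ h2
  rwa [add_sub_cancel_left, smul_smul, inv_mul_cancel₀ hε.ne', one_smul] at h3

end IsRelOpenCone

open Classical in
/-- `(-1) ^ dim S` if `S` is nonempty, and `0` otherwise. -/
def dimSign (S : Set V) : ℤ :=
  if S.Nonempty then (-1) ^ Module.finrank ℝ (Submodule.span ℝ S) else 0

@[simp] theorem dimSign_empty : dimSign (∅ : Set V) = 0 := by simp [dimSign]

theorem dimSign_of_nonempty {S : Set V} (h : S.Nonempty) :
    dimSign S = (-1) ^ Module.finrank ℝ (Submodule.span ℝ S) := by simp [dimSign, h]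

/-- The Euler characteristic with compact supports of a set `S`, computed from the partition of `S`
into sign cells of the linear forms in a list. -/
def cellEuler : List (V →ₗ[ℝ] ℝ) → Set V → ℤ
  | [], S => dimSign S
  | l :: A, S => cellEuler A (S ∩ {x | 0 < l x}) + cellEuler A (S ∩ {x | l x = 0}) +
      cellEuler A (S ∩ {x | l x < 0})

@[simp] theorem cellEuler_empty (A : List (V →ₗ[ℝ] ℝ)) : cellEuler A (∅ : Set V) = 0 := by
  induction A with
  | nil => simp [cellEuler]
  | cons l A ih => simp [cellEuler, ih]

/-- Cutting a relatively open cone by a hyperplane does not change its Euler characteristic. -/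
theorem IsRelOpenCone.dimSign_cut [FiniteDimensional ℝ V] {S : Set V} (hS : IsRelOpenCone S)
    (l : V →ₗ[ℝ] ℝ) :
    dimSign (S ∩ {x | 0 < l x}) + dimSign (S ∩ {x | l x = 0}) + dimSign (S ∩ {x | l x < 0}) =
      dimSign S := by
  -- if `l` is nonnegative on `S` and not identically zero, then it is positive on `S`
  have key : ∀ l : V →ₗ[ℝ] ℝ, (∀ x ∈ S, 0 ≤ l x) → ∀ a ∈ S, 0 < l a → ∀ x ∈ S, 0 < l x := by
    intro l h a ha hla x hx
    refine lt_of_le_of_ne (h x hx) fun h0 => ?_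
    obtain ⟨ε, hε, hm⟩ := hS.exists_sub_mem x hx a ha
    have := h _ hm
    rw [map_sub, map_smul, smul_eq_mul, ← h0] at this
    nlinarith
  by_cases hp : ∃ a ∈ S, 0 < l a
  · obtain ⟨a, ha, hla⟩ := hp
    by_cases hn : ∃ b ∈ S, l b < 0
    · obtain ⟨b, hb, hlb⟩ := hn
      have hz : (-l b) • a + l a • b ∈ S :=
        hS.add_mem _ (hS.smul_mem _ (by linarith) _ ha) _ (hS.smul_mem _ hla _ hb)
      have hlz : l ((-l b) • a + l a • b) = 0 := by
        simp only [map_add, map_smul, smul_eq_mul]; ring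
      have e1 := hS.span_inter_pos ha hla
      have e2 := hS.span_inter_zero hz hlz
      have e3 : Submodule.span ℝ (S ∩ {x | l x < 0}) = Submodule.span ℝ S := by
        have := hS.span_inter_pos (l := -l) hb (by simpa using hlb)
        simpa using this
      have e4 : Module.finrank ℝ (Submodule.span ℝ S) =
          Module.finrank ℝ (Submodule.span ℝ S ⊓ LinearMap.ker l : Submodule ℝ V) + 1 := by
        set W := Submodule.span ℝ S
        have h1 := LinearMap.finrank_range_add_finrank_ker (l.domRestrict W)
        have h2 : LinearMap.range (l.domRestrict W) = ⊤ := by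
          rw [LinearMap.range_eq_top]
          refine LinearMap.surjective fun h => hla.ne' ?_
          have := LinearMap.congr_fun h ⟨a, Submodule.subset_span ha⟩
          simpa using this
        have h3 : Module.finrank ℝ (LinearMap.ker (l.domRestrict W)) =
            Module.finrank ℝ (W ⊓ LinearMap.ker l : Submodule ℝ V) := by
          have : (LinearMap.ker (l.domRestrict W)).map W.subtype = W ⊓ LinearMap.ker l := by
            ext x
            simp only [Submodule.mem_map, LinearMap.mem_ker, Submodule.mem_inf]
            constructor
            · rintro ⟨y, hy, rfl⟩
              exact ⟨y.2, hy⟩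
            · rintro ⟨h1, h2⟩
              exact ⟨⟨x, h1⟩, h2, rfl⟩
          rw [← this]
          exact (Submodule.finrank_map_subtype_eq W _).symm
        rw [h2, finrank_top, Module.finrank_self, h3] at h1
        omega
      rw [dimSign_of_nonempty (S := S ∩ {x | 0 < l x}) ⟨a, ha, hla⟩,
        dimSign_of_nonempty (S := S ∩ {x | l x = 0}) ⟨_, hz, hlz⟩,
        dimSign_of_nonempty (S := S ∩ {x | l x < 0}) ⟨b, hb, hlb⟩,
        dimSign_of_nonempty ⟨a, ha⟩, e1, e2, e3, e4]
      ring
    · push Not at hn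
      have h1 := key l hn a ha hla
      have e1 : S ∩ {x | 0 < l x} = S := Set.inter_eq_left.2 h1
      have e2 : S ∩ {x | l x = 0} = ∅ :=
        Set.eq_empty_of_forall_notMem fun x ⟨hx, h0⟩ => (h1 x hx).ne' h0
      have e3 : S ∩ {x | l x < 0} = ∅ :=
        Set.eq_empty_of_forall_notMem fun x ⟨hx, h0⟩ => absurd (h1 x hx) (not_lt.2 (le_of_lt h0))
      rw [e1, e2, e3]; simp
  · push Not at hp
    have e1 : S ∩ {x | 0 < l x} = ∅ :=
        Set.eq_empty_of_forall_notMem fun x ⟨hx, h0⟩ => absurd (hp x hx) (not_le.2 h0)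
    by_cases hn : ∃ b ∈ S, l b < 0
    · obtain ⟨b, hb, hlb⟩ := hn
      have h1 : ∀ x ∈ S, l x < 0 := by
        have := key (-l) (by simpa using hp) b hb (by simpa using hlb)
        simpa using this
      have e3 : S ∩ {x | l x < 0} = S := Set.inter_eq_left.2 h1
      have e2 : S ∩ {x | l x = 0} = ∅ :=
        Set.eq_empty_of_forall_notMem fun x ⟨hx, h0⟩ => (h1 x hx).ne h0
      rw [e1, e2, e3]; simp
    · push Not at hn
      have e2 : S ∩ {x | l x = 0} = S :=
        Set.inter_eq_left.2 fun x hx => le_antisymm (hp x hx) (hn x hx)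
      have e3 : S ∩ {x | l x < 0} = ∅ :=
        Set.eq_empty_of_forall_notMem fun x ⟨hx, h0⟩ => absurd (hn x hx) (not_le.2 h0)
      rw [e1, e2, e3]; simp

theorem IsRelOpenCone.cellEuler_eq [FiniteDimensional ℝ V] (A : List (V →ₗ[ℝ] ℝ)) {S : Set V}
    (hS : IsRelOpenCone S) : cellEuler A S = dimSign S := by
  induction A generalizing S with
  | nil => rfl
  | cons l A ih =>
    rw [cellEuler, ih (hS.inter_pos l), ih (hS.inter_zero l), ih (hS.inter_neg l), hS.dimSign_cut]

/-- Additivity of the Euler characteristic for a partition of `S` into the fibres of a map that is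
constant on the sign cells. -/
theorem cellEuler_eq_sum {ι : Type*} [Fintype ι] (A : List (V →ₗ[ℝ] ℝ)) (S : Set V) (c : V → ι)
    (hc : ∀ x ∈ S, ∀ y ∈ S, (∀ l ∈ A, SignType.sign (l x) = SignType.sign (l y)) → c x = c y) :
    cellEuler A S = ∑ i, cellEuler A (S ∩ {x | c x = i}) := by
  classical
  induction A generalizing S with
  | nil =>
    rcases S.eq_empty_or_nonempty with rfl | ⟨p, hp⟩
    · simp
    · rw [Finset.sum_eq_single (c p)]
      · congr 1
        exact (Set.inter_eq_left.2 fun x hx => hc x hx p hp (by simp)).symm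
      · intro i _ hi
        rw [Set.eq_empty_of_forall_notMem (s := S ∩ {x | c x = i}), cellEuler_empty]
        rintro x ⟨hx, rfl⟩
        exact hi (hc x hx p hp (by simp))
      · simp
  | cons l A ih =>
    have h : ∀ (s : SignType) (T : Set V), (∀ x, x ∈ T ↔ SignType.sign (l x) = s) →
        cellEuler A (S ∩ T) = ∑ i, cellEuler A (S ∩ {x | c x = i} ∩ T) := by
      intro s T hT
      rw [ih]
      · simp only [Set.inter_right_comm]
      · rintro x ⟨hx, hx'⟩ y ⟨hy, hy'⟩ hl
        refine hc x hx y hy fun l' hl' => ?_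
        rcases List.mem_cons.1 hl' with rfl | hl'
        · rw [(hT x).1 hx', (hT y).1 hy']
        · exact hl l' hl'
    simp only [cellEuler, Finset.sum_add_distrib]
    rw [h 1 {x | 0 < l x} fun x => by rw [sign_eq_one_iff]; rfl,
      h 0 {x | l x = 0} fun x => by rw [sign_eq_zero_iff]; rfl,
      h (-1) {x | l x < 0} fun x => by rw [sign_eq_neg_one_iff]; rfl]

end EulerCharacteristic

/-! ### The Euler relation -/

section EulerRelation

variable {V : Type*} [AddCommGroup V] [Module ℝ V]
variable {A : Finset (V →ₗ[ℝ] ℝ)} {σ : PointedCone ℝ V}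

theorem IsCutOut.isRelOpenCone_relInt (hA : IsCutOut A σ) {F : PointedCone ℝ V}
    (hF : IsFace F σ) : IsRelOpenCone (relInt A F) where
  add_mem := fun x hx y hy => ⟨add_mem hx.1 hy.1, fun l hl hn => by
    rw [map_add]; exact add_pos (hx.2 l hl hn) (hy.2 l hl hn)⟩
  smul_mem := fun c hc x hx => ⟨F.smul_mem hc.le hx.1, fun l hl hn => by
    rw [map_smul]; exact mul_pos hc (hx.2 l hl hn)⟩
  exists_sub_mem := fun x hx y hy => by
    classical
    obtain ⟨ε, hε, h⟩ := exists_pos_forall_sub_mul_pos (A \ activeSet A F) (fun l => l x)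
      (fun l => l y) fun l hl => hx.2 l (Finset.mem_sdiff.1 hl).1 (Finset.mem_sdiff.1 hl).2
    have h0 : ∀ l ∈ activeSet A F, l (x - ε • y) = 0 := fun l hl => by
      rw [map_sub, map_smul, (mem_activeSet.1 hl).2 x hx.1, (mem_activeSet.1 hl).2 y hy.1]
      simp
    have hp : ∀ l ∈ A, l ∉ activeSet A F → 0 < l (x - ε • y) := fun l hl hn => by
      have := h l (Finset.mem_sdiff.2 ⟨hl, hn⟩)
      simpa using this
    have hσ : x - ε • y ∈ σ := (hA _).2 fun l hl => by
      by_cases hn : l ∈ activeSet A F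
      · exact (h0 l hn).ge
      · exact (hp l hl hn).le
    exact ⟨ε, hε, (hA.mem_face_iff hF hσ).2 h0, hp⟩

theorem IsCutOut.add_mem_relInt (hA : IsCutOut A σ) {F : PointedCone ℝ V}
    (hF : F ≤ σ) {p x : V} (hp : p ∈ relInt A F) (hx : x ∈ F) : p + x ∈ relInt A F :=
  ⟨add_mem hp.1 hx, fun l hl hn => by
    rw [map_add]
    linarith [hp.2 l hl hn, (hA x).1 (hF hx) l hl]⟩

theorem IsCutOut.span_relInt (hA : IsCutOut A σ) {F : PointedCone ℝ V} (hF : F ≤ σ) :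
    Submodule.span ℝ (relInt A F) = Submodule.span ℝ (F : Set V) := by
  refine le_antisymm (Submodule.span_mono fun x hx => hx.1) (Submodule.span_le.2 fun x hx => ?_)
  obtain ⟨p, hp⟩ := hA.relInt_nonempty hF
  have := Submodule.sub_mem _ (Submodule.subset_span (R := ℝ) (hA.add_mem_relInt hF hp hx))
    (Submodule.subset_span hp)
  simpa using this

theorem IsCutOut.dimSign_relInt (hA : IsCutOut A σ) {F : PointedCone ℝ V} (hF : F ≤ σ) :
    dimSign (relInt A F) = (-1) ^ coneDim F := by
  rw [dimSign_of_nonempty (hA.relInt_nonempty hF), hA.span_relInt hF, coneDim]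

theorem IsCutOut.faceOf_activeSet (hA : IsCutOut A σ) {F : PointedCone ℝ V} (hF : IsFace F σ) :
    faceOf σ (activeSet A F) = F := by
  ext x
  rw [mem_faceOf]
  exact ⟨fun h => (hA.mem_face_iff hF h.1).2 h.2,
    fun h => ⟨hF.le h, (hA.mem_face_iff hF (hF.le h)).1 h⟩⟩

/-- The points from which one reaches the relative interior of `F` by moving in the direction
`-v`. -/
def shadow (A : Finset (V →ₗ[ℝ] ℝ)) (v : V) (F : PointedCone ℝ V) : Set V :=
  {x | ∃ p ∈ relInt A F, ∃ s : ℝ, 0 < s ∧ x = p + s • v}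

theorem IsCutOut.isRelOpenCone_shadow (hA : IsCutOut A σ) (v : V) {F : PointedCone ℝ V}
    (hF : IsFace F σ) : IsRelOpenCone (shadow A v F) where
  add_mem := by
    rintro _ ⟨p, hp, s, hs, rfl⟩ _ ⟨q, hq, t, ht, rfl⟩
    exact ⟨p + q, (hA.isRelOpenCone_relInt hF).add_mem _ hp _ hq, s + t, add_pos hs ht, by module⟩
  smul_mem := by
    rintro c hc _ ⟨p, hp, s, hs, rfl⟩
    exact ⟨c • p, (hA.isRelOpenCone_relInt hF).smul_mem _ hc _ hp, c * s, mul_pos hc hs, by module⟩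
  exists_sub_mem := by
    rintro _ ⟨p, hp, s, hs, rfl⟩ _ ⟨q, hq, t, ht, rfl⟩
    obtain ⟨ε, hε, h⟩ := (hA.isRelOpenCone_relInt hF).exists_forall_sub_mem hp hq
    have hm : 0 < min ε (s / (2 * t)) := by positivity
    have := min_le_right ε (s / (2 * t))
    rw [le_div_iff₀ (by positivity)] at this
    exact ⟨_, hm, _, h _ hm (min_le_left _ _), s - min ε (s / (2 * t)) * t, by linarith, by module⟩

theorem IsCutOut.span_shadow (hA : IsCutOut A σ) (v : V) {F : PointedCone ℝ V}
    (hF : IsFace F σ) :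
    Submodule.span ℝ (shadow A v F) = Submodule.span ℝ (F : Set V) ⊔ Submodule.span ℝ {v} := by
  apply le_antisymm
  · rw [Submodule.span_le]
    rintro _ ⟨p, hp, s, hs, rfl⟩
    exact Submodule.add_mem_sup (Submodule.subset_span hp.1)
      (Submodule.smul_mem _ _ (Submodule.mem_span_singleton_self v))
  · obtain ⟨p, hp⟩ := hA.relInt_nonempty hF.le
    have h1 : ∀ q ∈ relInt A F, ∀ s : ℝ, 0 < s → q + s • v ∈ Submodule.span ℝ (shadow A v F) :=
      fun q hq s hs => Submodule.subset_span ⟨q, hq, s, hs, rfl⟩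
    have hv : v ∈ Submodule.span ℝ (shadow A v F) := by
      have := Submodule.sub_mem _ (h1 p hp 2 two_pos) (h1 p hp 1 one_pos)
      convert! this using 1
      module
    refine sup_le ?_ ((Submodule.span_singleton_le_iff_mem _ _).2 hv)
    rw [← hA.span_relInt hF.le, Submodule.span_le]
    intro q hq
    have := Submodule.sub_mem _ (h1 q hq 1 one_pos) hv
    simpa using this

theorem IsCutOut.dimSign_shadow [FiniteDimensional ℝ V] (hA : IsCutOut A σ) {v : V}
    {F : PointedCone ℝ V} (hF : IsFace F σ) (hv : v ∉ Submodule.span ℝ (F : Set V)) :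
    dimSign (shadow A v F) = -(-1) ^ coneDim F := by
  obtain ⟨p, hp⟩ := hA.relInt_nonempty hF.le
  rw [dimSign_of_nonempty (S := shadow A v F) ⟨p + (1 : ℝ) • v, p, hp, 1, one_pos, rfl⟩, hA.span_shadow v hF]
  have h0 : v ≠ 0 := by
    rintro rfl
    exact hv (zero_mem _)
  have h1 := Submodule.finrank_sup_add_finrank_inf_eq (Submodule.span ℝ (F : Set V))
    (Submodule.span ℝ {v})
  have h2 : Submodule.span ℝ (F : Set V) ⊓ Submodule.span ℝ {v} = ⊥ := by
    rw [← disjoint_iff]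
    exact ((Submodule.disjoint_span_singleton' h0).2 hv)
  rw [h2, finrank_bot, finrank_span_singleton h0, add_zero] at h1
  rw [h1, coneDim, pow_succ]
  ring

/-- The Euler relation: the relative interior of `σ` is the disjoint union of the shadows of the
proper faces of `σ`, in a direction `v` of the relative interior, and the shadow of `F` is a
relatively open cone of dimension `dim F + 1`. -/
theorem finsum_faces_neg_one_pow_coneDim [FiniteDimensional ℝ V] (hfg : σ.FG)
    (hpt : ∀ x ∈ σ, -x ∈ σ → x = 0) (hne : σ ≠ ⊥) :
    ∑ᶠ F ∈ faces σ, (-1 : ℤ) ^ coneDim F = 0 := by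
  classical
  obtain ⟨A, hA⟩ := exists_isCutOut hfg
  have hσ := IsFace.refl σ
  obtain ⟨v, hv⟩ := hA.relInt_nonempty le_rfl
  set I := A \ activeSet A σ with hI
  have hIv : ∀ l ∈ I, 0 < l v := fun l hl =>
    hv.2 l (Finset.mem_sdiff.1 hl).1 (Finset.mem_sdiff.1 hl).2
  have hIne : I.Nonempty := by
    rw [Finset.nonempty_iff_ne_empty]
    intro h
    refine hne ((Submodule.eq_bot_iff _).2 fun x hx => hpt x hx ((hA _).2 fun l hl => ?_))
    have : l ∈ activeSet A σ := by
      by_contra hn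
      exact Finset.notMem_empty l (h ▸ Finset.mem_sdiff.2 ⟨hl, hn⟩)
    rw [map_neg, (mem_activeSet.1 this).2 x hx, neg_zero]
  -- the time at which the ray from `x` in direction `-v` leaves `σ`
  set r : V → ℝ := fun x => I.inf' hIne fun l => l x / l v with hr
  have hr_le : ∀ x, ∀ l ∈ I, r x * l v ≤ l x := fun x l hl => by
    rw [← le_div_iff₀ (hIv l hl)]
    exact Finset.inf'_le (f := fun l : V →ₗ[ℝ] ℝ => l x / l v) hl
  have hr_eq : ∀ x, ∃ l ∈ I, l x = r x * l v := fun x => by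
    obtain ⟨l, hl, h⟩ := Finset.exists_mem_eq_inf' hIne fun l : V →ₗ[ℝ] ℝ => l x / l v
    refine ⟨l, hl, ?_⟩
    simp only [hr]
    rw [h, div_mul_cancel₀ _ (hIv l hl).ne']
  have hproj : ∀ x ∈ σ, x - r x • v ∈ σ := fun x hx => (hA _).2 fun l hl => by
    rw [map_sub, map_smul, smul_eq_mul]
    by_cases hn : l ∈ activeSet A σ
    · rw [(mem_activeSet.1 hn).2 x hx, (mem_activeSet.1 hn).2 v hv.1]; simp
    · linarith [hr_le x l (Finset.mem_sdiff.2 ⟨hl, hn⟩)]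
  -- the face through which it leaves
  have : Fintype (faces σ) := hA.finite_faces.fintype
  set J : V → Finset (V →ₗ[ℝ] ℝ) := fun x => A.filter fun l => l (x - r x • v) = 0 with hJ
  set c : V → faces σ := fun x => ⟨faceOf σ (J x), hA.isFace_faceOf (Finset.filter_subset _ _)⟩
    with hc
  have hcell : ∀ F : faces σ, relInt A σ ∩ {x | c x = F} =
      if F.1 = σ then ∅ else shadow A v F.1 := by
    rintro ⟨F, hF⟩
    replace hF : IsFace F σ := hF
    change _ = if F = σ then ∅ else shadow A v F
    ext x
    split_ifs with hFσ
    · refine iff_of_false ?_ (Set.notMem_empty x)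
      rintro ⟨-, hx⟩
      have hx : c x = ⟨F, hF⟩ := hx
      obtain ⟨l, hl, h⟩ := hr_eq x
      have hlJ : l ∈ J x := Finset.mem_filter.2 ⟨(Finset.mem_sdiff.1 hl).1, by
        rw [map_sub, map_smul, smul_eq_mul, h, sub_self]⟩
      have hvF : v ∈ faceOf σ (J x) := by
        have : faceOf σ (J x) = F := congrArg Subtype.val hx
        rw [this, hFσ]
        exact hv.1
      exact (hIv l hl).ne' ((mem_faceOf.1 hvF).2 l hlJ)
    · constructor
      · rintro ⟨hxσ, hx⟩
        have hx : faceOf σ (J x) = F := congrArg Subtype.val (show c x = ⟨F, hF⟩ from hx)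
        refine ⟨x - r x • v, ⟨?_, fun l hl hn => ?_⟩, r x, ?_, by abel⟩
        · rw [← hx]
          exact mem_faceOf.2 ⟨hproj x hxσ.1, fun l hl => (Finset.mem_filter.1 hl).2⟩
        · refine lt_of_le_of_ne ((hA _).1 (hproj x hxσ.1) l hl) fun h0 =>
            hn (mem_activeSet.2 ⟨hl, fun y hy => ?_⟩)
          rw [← hx] at hy
          exact (mem_faceOf.1 hy).2 l (Finset.mem_filter.2 ⟨hl, h0.symm⟩)
        · obtain ⟨l, hl, h⟩ := hr_eq x
          have := hxσ.2 l (Finset.mem_sdiff.1 hl).1 (Finset.mem_sdiff.1 hl).2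
          rw [h] at this
          exact pos_of_mul_pos_left this (hIv l hl).le
      · rintro ⟨p, hp, s, hs, rfl⟩
        obtain ⟨l₀, hl₀, hl₀p⟩ : ∃ l ∈ I, l p = 0 := by
          by_contra! hcon
          refine hFσ (hA.face_ext hF hσ (Finset.ext fun l => ?_))
          rw [activeSet_eq_of_mem_relInt hp]
          refine ⟨fun h => ?_, fun h => ⟨(mem_activeSet.1 h).1,
            (mem_activeSet.1 h).2 p (hF.le hp.1)⟩⟩
          by_contra hn
          exact hcon l (Finset.mem_sdiff.2 ⟨h.1, hn⟩) h.2
        have hps : p + s • v ∈ relInt A σ := by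
          rw [add_comm]
          exact hA.add_mem_relInt le_rfl
            ((hA.isRelOpenCone_relInt hσ).smul_mem s hs v hv) (hF.le hp.1)
        have hrs : r (p + s • v) = s := by
          apply le_antisymm
          · have := hr_le (p + s • v) l₀ hl₀
            rw [map_add, map_smul, smul_eq_mul, hl₀p, zero_add] at this
            exact le_of_mul_le_mul_right this (hIv _ hl₀)
          · obtain ⟨l, hl, h⟩ := hr_eq (p + s • v)
            have h1 := (hA p).1 (hF.le hp.1) l (Finset.mem_sdiff.1 hl).1
            rw [map_add, map_smul, smul_eq_mul] at h
            exact le_of_mul_le_mul_right (by linarith) (hIv l hl)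
        refine ⟨hps, Subtype.ext ?_⟩
        have : J (p + s • v) = activeSet A F := by
          ext l
          simp only [hJ]
          rw [Finset.mem_filter, hrs, add_sub_cancel_right, activeSet_eq_of_mem_relInt hp]
        change faceOf σ (J (p + s • v)) = F
        rw [this, hA.faceOf_activeSet hF]
  -- the face is determined by the signs of the forms that compare the exit times
  set L : List (V →ₗ[ℝ] ℝ) := ((I ×ˢ I).image fun q => q.1 v • q.2 - q.2 v • q.1).toList with hL
  have hsign : ∀ x ∈ relInt A σ, ∀ y ∈ relInt A σ,
      (∀ l ∈ L, SignType.sign (l x) = SignType.sign (l y)) → c x = c y := by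
    have hJiff : ∀ x ∈ relInt A σ, ∀ l ∈ A, (l ∈ J x ↔ (l ∈ activeSet A σ ∨ l ∈ I ∧ ∀ l' ∈ I,
        0 ≤ (l v • l' - l' v • l) x)) := by
      intro x hx l hl
      simp only [hJ, Finset.mem_filter, hl, true_and, map_sub, map_smul, smul_eq_mul,
        LinearMap.sub_apply, LinearMap.smul_apply]
      by_cases hn : l ∈ activeSet A σ
      · rw [(mem_activeSet.1 hn).2 x hx.1, (mem_activeSet.1 hn).2 v hv.1]
        simp [hn]
      · have hlI : l ∈ I := Finset.mem_sdiff.2 ⟨hl, hn⟩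
        simp only [hn, hlI, false_or, true_and]
        have hlv := hIv l hlI
        constructor
        · intro h l' hl'
          have := mul_le_mul_of_nonneg_left (hr_le x l' hl') hlv.le
          have e : l x = r x * l v := by linarith
          rw [e]
          linarith
        · intro h
          obtain ⟨l', hl', h'⟩ := hr_eq x
          have h1 := h l' hl'
          rw [h'] at h1
          have h2 : l x * l' v ≤ (r x * l v) * l' v := by linarith
          have h3 := le_of_mul_le_mul_right h2 (hIv l' hl')
          linarith [hr_le x l hlI]
    intro x hx y hy h
    have : J x = J y := by
      ext l
      by_cases hl : l ∈ A
      · rw [hJiff x hx l hl, hJiff y hy l hl]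
        refine or_congr_right (and_congr_right fun hlI => forall₂_congr fun l' hl' => ?_)
        have := h (l v • l' - l' v • l) (Finset.mem_toList.2
          (Finset.mem_image.2 ⟨(l, l'), Finset.mem_product.2 ⟨hlI, hl'⟩, rfl⟩))
        rw [← sign_nonneg_iff, this, sign_nonneg_iff]
      · simp [hJ, hl]
    exact Subtype.ext (congrArg (faceOf σ) this)
  have hmain := cellEuler_eq_sum L (relInt A σ) c hsign
  rw [(hA.isRelOpenCone_relInt hσ).cellEuler_eq, hA.dimSign_relInt le_rfl] at hmain
  have hterm : ∀ F : faces σ, cellEuler L (relInt A σ ∩ {x | c x = F}) =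
      (if F = ⟨σ, hσ⟩ then (-1) ^ coneDim σ else 0) - (-1) ^ coneDim F.1 := by
    rintro ⟨F, hF⟩
    rw [hcell]
    by_cases hFσ : F = σ
    · subst hFσ
      simp
    · have hvF : v ∉ Submodule.span ℝ (F : Set V) := fun h => hFσ <| hA.face_ext hF hσ <|
        Finset.ext fun l => by
          have hvF := IsFace.mem_of_mem_span hF hv.1 h
          refine ⟨fun hl => ?_, fun hl => mem_activeSet.2 ⟨(mem_activeSet.1 hl).1, fun x hx =>
            (mem_activeSet.1 hl).2 x (IsFace.le hF hx)⟩⟩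
          rw [activeSet_eq_of_mem_relInt hv]
          exact ⟨(mem_activeSet.1 hl).1, (mem_activeSet.1 hl).2 v hvF⟩
      rw [if_neg hFσ, (hA.isRelOpenCone_shadow v hF).cellEuler_eq, hA.dimSign_shadow hF hvF,
        if_neg fun h => hFσ (congrArg Subtype.val h), zero_sub]
  rw [Finset.sum_congr rfl fun F _ => hterm F, Finset.sum_sub_distrib,
    Finset.sum_ite_eq' Finset.univ] at hmain
  rw [finsum_mem_eq_finite_toFinset_sum _ hA.finite_faces]
  have e : ∑ F : faces σ, (-1 : ℤ) ^ coneDim F.1 = 0 := by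
    simp only [Finset.mem_univ, if_true] at hmain
    linarith
  rw [← e]
  exact Finset.sum_subtype _ (by simp) _

end EulerRelation

/-! ### Reversal of polynomials -/

section Reversal

theorem thePoly_spec {Q : ℤ[X] → Prop} (h : ∃ p, Q p) : Q (thePoly Q) := by
  rw [thePoly, dif_pos h]
  exact h.choose_spec

/-- The coefficients of a polynomial, extended by zero to all integer exponents. -/
def intCoeff (p : ℤ[X]) (k : ℤ) : ℤ := p.toLaurent.coeff k

theorem intCoeff_natCast (p : ℤ[X]) (k : ℕ) : intCoeff p k = p.coeff k := by
  rw [intCoeff, LaurentPolynomial.coeff_toLaurent]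
  exact Finsupp.mapDomain_apply (Nat.castEmbedding (R := ℤ)).injective _ k

theorem intCoeff_of_neg (p : ℤ[X]) {k : ℤ} (hk : k < 0) : intCoeff p k = 0 := by
  rw [intCoeff, LaurentPolynomial.coeff_toLaurent]
  refine Finsupp.mapDomain_of_notMem_range _ _ ?_
  rintro ⟨n, hn⟩
  simp only [Nat.castEmbedding_apply] at hn
  omega

theorem intCoeff_add (p q : ℤ[X]) (k : ℤ) : intCoeff (p + q) k = intCoeff p k + intCoeff q k := by
  simp [intCoeff, map_add, -LaurentPolynomial.coeff_toLaurent]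

theorem intCoeff_neg (p : ℤ[X]) (k : ℤ) : intCoeff (-p) k = -intCoeff p k := by
  simp [intCoeff, map_neg, -LaurentPolynomial.coeff_toLaurent]

theorem isReversal_iff {n : ℕ} {p q : ℤ[X]} :
    IsReversal n p q ↔ ∀ k : ℤ, intCoeff p (n - k) = intCoeff q k := by
  have h : ∀ k : ℤ, (LaurentPolynomial.T (n : ℤ) *
      LaurentPolynomial.invert p.toLaurent).coeff k = intCoeff p (n - k) := by
    intro k
    rw [LaurentPolynomial.T, AddMonoidAlgebra.coeff_single_mul_apply, one_mul,
      LaurentPolynomial.invert_apply, intCoeff]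
    congr 1
    ring
  constructor
  · intro hr k
    rw [← h, hr]
    rfl
  · intro hr
    exact LaurentPolynomial.ext fun k => (h k).trans (hr k)

theorem IsReversal.unique {n : ℕ} {p q q' : ℤ[X]} (h : IsReversal n p q)
    (h' : IsReversal n p q') : q = q' :=
  Polynomial.toLaurent_injective (h.symm.trans h')

theorem IsReversal.symm {n : ℕ} {p q : ℤ[X]} (h : IsReversal n p q) : IsReversal n q p := by
  rw [isReversal_iff] at *
  intro k
  rw [← h]
  congr 1
  ring

theorem IsReversal.mul {m n : ℕ} {p q p' q' : ℤ[X]} (h : IsReversal m p q)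
    (h' : IsReversal n p' q') : IsReversal (m + n) (p * p') (q * q') := by
  unfold IsReversal at *
  rw [map_mul, map_mul, map_mul, ← h, ← h', Nat.cast_add, LaurentPolynomial.T_add]
  ring

theorem IsReversal.sum {ι : Type*} {n : ℕ} {s : Finset ι} {p q : ι → ℤ[X]}
    (h : ∀ i ∈ s, IsReversal n (p i) (q i)) : IsReversal n (∑ i ∈ s, p i) (∑ i ∈ s, q i) := by
  unfold IsReversal
  rw [map_sum, map_sum, map_sum, Finset.mul_sum]
  exact Finset.sum_congr rfl h

theorem isReversal_zero (n : ℕ) : IsReversal n 0 0 := by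
  unfold IsReversal
  simp

theorem isReversal_one : IsReversal 0 1 1 := by
  unfold IsReversal
  simp

theorem isReversal_intCast (c : ℤ) : IsReversal 0 (c : ℤ[X]) c := by
  unfold IsReversal
  simp

theorem IsReversal.neg_one_pow_mul {n : ℕ} {p q : ℤ[X]} (k : ℕ) (h : IsReversal n p q) :
    IsReversal n ((-1) ^ k * p) ((-1) ^ k * q) := by
  have := (isReversal_intCast ((-1) ^ k)).mul h
  simpa using this

theorem isReversal_X_sub_one_pow (n : ℕ) : IsReversal n ((X - 1) ^ n) ((1 - X) ^ n) := by
  induction n with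
  | zero => simpa using isReversal_one
  | succ n ih =>
    rw [pow_succ, pow_succ]
    refine ih.mul ?_
    unfold IsReversal
    rw [map_sub, map_sub, Polynomial.toLaurent_X, Polynomial.toLaurent_one, map_sub,
      Polynomial.toLaurent_X, Polynomial.toLaurent_one, LaurentPolynomial.invert_T, map_one,
      mul_sub, ← LaurentPolynomial.T_add]
    simp

theorem one_sub_X_pow (n : ℕ) : (1 - X : ℤ[X]) ^ n = (-1) ^ n * (X - 1) ^ n := by
  rw [← mul_pow]
  congr 1
  ring

theorem intCoeff_eq_zero_of_natDegree {n : ℕ} {p : ℤ[X]} (h : 2 * p.natDegree < n) {k : ℤ}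
    (hk : (n : ℤ) ≤ 2 * k) : intCoeff p k = 0 := by
  obtain ⟨m, rfl⟩ : ∃ m : ℕ, k = m := ⟨k.toNat, by omega⟩
  rw [intCoeff_natCast]
  exact Polynomial.coeff_eq_zero_of_natDegree_lt (by omega)

theorem eq_zero_of_intCoeff {p : ℤ[X]} (h : ∀ k, intCoeff p k = 0) : p = 0 := by
  ext k
  rw [← intCoeff_natCast, h, coeff_zero]

/-- A palindromic polynomial of degree less than half its formal degree vanishes. -/
theorem IsReversal.eq_zero {n : ℕ} {p : ℤ[X]} (h : IsReversal n p p) (hd : 2 * p.natDegree < n) :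
    p = 0 := by
  rw [isReversal_iff] at h
  refine eq_zero_of_intCoeff fun k => ?_
  rcases le_total (n : ℤ) (2 * k) with hk | hk
  · exact intCoeff_eq_zero_of_natDegree hd hk
  · rw [← h]
    exact intCoeff_eq_zero_of_natDegree hd (by omega)

/-- An antipalindromic `f` is the difference of the reversal of `p` and `p`, for `-p` the part of
`f` of degree less than `n / 2`. -/
theorem exists_isReversal_add {n : ℕ} (hn : n ≠ 0) {f : ℤ[X]} (hf : IsReversal n f (-f)) :
    ∃ p : ℤ[X], 2 * p.natDegree < n ∧ IsReversal n p (p + f) := by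
  rw [isReversal_iff] at hf
  set p : ℤ[X] := -∑ k ∈ (Finset.range n).filter (fun k => 2 * k < n), monomial k (f.coeff k)
  have hp : ∀ k : ℤ, intCoeff p k = if 2 * k < n then -intCoeff f k else 0 := by
    intro k
    rcases lt_or_ge k 0 with hk | hk
    · rw [intCoeff_of_neg _ hk, intCoeff_of_neg _ hk]; simp
    · obtain ⟨m, rfl⟩ : ∃ m : ℕ, k = m := ⟨k.toNat, by omega⟩
      rw [intCoeff_natCast, intCoeff_natCast, coeff_neg, finsetSum_coeff]
      simp only [coeff_monomial]
      rw [Finset.sum_ite_eq' _ m]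
      simp only [Finset.mem_filter, Finset.mem_range]
      by_cases h : 2 * m < n
      · rw [if_pos ⟨by omega, h⟩, if_pos (by exact_mod_cast h)]
      · rw [if_neg (by tauto), if_neg (by exact_mod_cast h), neg_zero]
  refine ⟨p, ?_, isReversal_iff.2 fun k => ?_⟩
  · suffices p.natDegree ≤ (n - 1) / 2 by omega
    rw [natDegree_neg]
    refine natDegree_sum_le_of_forall_le _ _ fun k hk => (natDegree_monomial_le _).trans ?_
    have := (Finset.mem_filter.1 hk).2
    omega
  · have h1 := hf k
    rw [intCoeff_neg] at h1
    rw [intCoeff_add, hp, hp]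
    rcases lt_trichotomy (2 * k) n with h | h | h
    · rw [if_neg (by omega), if_pos h]; ring
    · have : (n : ℤ) - k = k := by omega
      rw [this] at h1 ⊢
      rw [if_neg (by omega)]
      omega
    · rw [if_pos (by omega), if_neg (by omega), h1]; ring

end Reversal

/-! ### Toric polynomials of Eulerian posets -/

section Eulerian

/-- The rank function `ρ` is strictly increasing, and each interval of positive length has as many
elements of even rank as of odd rank. -/
structure IsEulerian {P : Type*} [PartialOrder P] [Finite P] (ρ : P → ℕ) : Prop where
  strictMono : StrictMono ρ
  finsum_eq_zero : ∀ x y, x < y → ∑ᶠ z ∈ Set.Icc x y, (-1 : ℤ) ^ ρ z = 0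

variable {P : Type*} [PartialOrder P] [Fintype P] {ρ : P → ℕ}

open Classical in
theorem IsEulerian.sum_eq_zero (h : IsEulerian ρ) {x y : P} (hxy : x < y) :
    ∑ z with x ≤ z ∧ z ≤ y, (-1 : ℤ) ^ ρ z = 0 := by
  have := h.finsum_eq_zero x y hxy
  rw [finsum_mem_eq_finite_toFinset_sum _ (Set.toFinite _)] at this
  rw [← this]
  refine Finset.sum_congr ?_ fun _ _ => rfl
  ext z
  simp

theorem neg_one_pow_sub {R : Type*} [CommRing R] {a b : ℕ} (h : a ≤ b) :
    (-1 : R) ^ (b - a) = (-1) ^ b * (-1) ^ a := by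
  obtain ⟨c, rfl⟩ := Nat.exists_eq_add_of_le h
  rw [Nat.add_sub_cancel_left, pow_add, mul_right_comm, ← pow_add, ← two_mul, pow_mul]
  simp

open Classical in
theorem IsEulerian.sum_mul_eq_ite (h : IsEulerian ρ) {x y : P} (hxy : x ≤ y) :
    ∑ z with x ≤ z ∧ z ≤ y, (1 - X : ℤ[X]) ^ (ρ z - ρ x) * (X - 1) ^ (ρ y - ρ z) =
      if x = y then 1 else 0 := by
  split_ifs with he
  · subst he
    rw [Finset.sum_eq_single x]
    · simp
    · intro z hz hne
      obtain ⟨-, h1, h2⟩ := Finset.mem_filter.1 hz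
      exact absurd (le_antisymm h2 h1) hne
    · simp
  · have hlt := lt_of_le_of_ne hxy he
    have h0 := congrArg (Int.cast : ℤ → ℤ[X]) (h.sum_eq_zero hlt)
    rw [Int.cast_sum] at h0
    rw [Finset.sum_congr rfl (g := fun z =>
      ((-1) ^ ρ x * (X - 1) ^ (ρ y - ρ x)) * (((-1 : ℤ) ^ ρ z : ℤ) : ℤ[X])), ← Finset.mul_sum, h0]
    · simp
    · intro z hz
      obtain ⟨-, h1, h2⟩ := Finset.mem_filter.1 hz
      have h1 := h.strictMono.monotone h1
      have h2 := h.strictMono.monotone h2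
      rw [one_sub_X_pow, neg_one_pow_sub h1,
        show ρ y - ρ x = (ρ z - ρ x) + (ρ y - ρ z) by omega, pow_add]
      push_cast
      ring

theorem toricGPoset_of_rank_eq_zero {Q : Type*} [Preorder Q] {ρ : Q → ℕ} {x : Q} (h : ρ x = 0) :
    toricGPoset ρ x = 1 := by
  rw [toricGPoset, if_pos h]

open Classical in
theorem toricGPoset_of_rank_ne_zero (hρ : StrictMono ρ) {x : P} (h : ρ x ≠ 0) :
    toricGPoset ρ x = thePoly fun p => 2 * p.natDegree < ρ x ∧
      IsReversal (ρ x) p (p + ∑ y with y < x, toricGPoset ρ y * (X - 1) ^ (ρ x - ρ y)) := by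
  rw [toricGPoset, if_neg h]
  congr! 5
  rw [finsum_eq_sum_of_fintype]
  symm
  refine Finset.sum_subtype (p := fun y => y < x ∧ ρ y < ρ x) _ (fun y => ?_)
    (fun y => toricGPoset ρ y * (X - 1) ^ (ρ x - ρ y))
  simp only [Finset.mem_filter, Finset.mem_univ, true_and]
  exact ⟨fun h => ⟨h, hρ h⟩, fun h => h.1⟩

/-- The toric polynomial exists: it has the required degree and satisfies the defining equation.
The sum over the proper lower intervals is antipalindromic by the Euler relation. -/
theorem IsEulerian.toricGPoset_spec (h : IsEulerian ρ) {b : P} (hb : ∀ x, b ≤ x) (hρb : ρ b = 0)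
    (x : P) : (x ≠ b → 2 * (toricGPoset ρ x).natDegree < ρ x) ∧
      IsReversal (ρ x) (toricGPoset ρ x)
        (∑ᶠ y ∈ Set.Iic x, toricGPoset ρ y * (X - 1) ^ (ρ x - ρ y)) := by
  classical
  have hsum : ∀ x, ∑ᶠ y ∈ Set.Iic x, toricGPoset ρ y * (X - 1) ^ (ρ x - ρ y) =
      toricGPoset ρ x + ∑ y with y < x, toricGPoset ρ y * (X - 1) ^ (ρ x - ρ y) := by
    intro x
    rw [finsum_mem_eq_finite_toFinset_sum _ (Set.toFinite _)]
    have : (Set.toFinite (Set.Iic x)).toFinset = insert x (Finset.univ.filter (· < x)) := by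
      ext y
      simp [le_iff_eq_or_lt]
    rw [this, Finset.sum_insert (by simp)]
    simp
  simp only [hsum]
  induction hn : ρ x using Nat.strong_induction_on generalizing x with
  | _ n ih =>
  subst hn
  rcases eq_or_ne x b with rfl | hxb
  · refine ⟨fun h => absurd rfl h, ?_⟩
    rw [toricGPoset_of_rank_eq_zero hρb, hρb]
    have : Finset.univ.filter (· < x) = ∅ :=
      Finset.filter_eq_empty_iff.2 fun y _ => not_lt_of_ge (hb y)
    rw [this]
    simpa using isReversal_one
  · have hρx : ρ x ≠ 0 := by
      have := h.strictMono (lt_of_le_of_ne (hb x) hxb.symm)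
      omega
    set f := ∑ y with y < x, toricGPoset ρ y * (X - 1) ^ (ρ x - ρ y) with hf
    have hanti : IsReversal (ρ x) f (-f) := by
      have h1 : IsReversal (ρ x) f (∑ y with y < x,
          (∑ z with z ≤ y, toricGPoset ρ z * (X - 1) ^ (ρ y - ρ z)) * (1 - X) ^ (ρ x - ρ y)) := by
        refine IsReversal.sum fun y hy => ?_
        have hlt := h.strictMono (Finset.mem_filter.1 hy).2
        have h2 := (ih (ρ y) hlt y rfl).2
        rw [← hsum, finsum_mem_eq_finite_toFinset_sum _ (Set.toFinite _)] at h2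
        have h3 := h2.mul (isReversal_X_sub_one_pow (ρ x - ρ y))
        rw [show ρ y + (ρ x - ρ y) = ρ x by omega] at h3
        convert! h3 using 3
        ext z
        simp
      convert! h1 using 1
      simp only [Finset.sum_mul, Finset.sum_filter]
      rw [← Finset.sum_filter, Finset.sum_comm' (t' := Finset.univ)
        (s' := fun _ => Finset.univ.filter (· < x)) (by simp), hf, Finset.sum_filter,
        ← Finset.sum_neg_distrib]
      refine Finset.sum_congr rfl fun z _ => ?_
      simp only [ite_mul, zero_mul]
      rw [← Finset.sum_filter, Finset.filter_filter]
      split_ifs with hz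
      · -- the terms over `z ≤ y < x` add up to minus the term at `y = x`
        have h4 := h.sum_mul_eq_ite hz.le
        rw [if_neg hz.ne] at h4
        have h5 : Finset.univ.filter (fun y => z ≤ y ∧ y ≤ x) =
            insert x (Finset.univ.filter (fun y => y < x ∧ z ≤ y)) := by
          ext y
          simp only [Finset.mem_filter, Finset.mem_univ, true_and, Finset.mem_insert]
          constructor
          · rintro ⟨h1, h2⟩
            exact (eq_or_lt_of_le h2).imp id fun h => ⟨h, h1⟩
          · rintro (rfl | ⟨h1, h2⟩)
            · exact ⟨hz.le, le_rfl⟩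
            · exact ⟨h2, h1.le⟩
        rw [h5, Finset.sum_insert (by simp)] at h4
        have h6 : ∀ y ∈ Finset.univ.filter (fun y => y < x ∧ z ≤ y),
            toricGPoset ρ z * (X - 1) ^ (ρ y - ρ z) * (1 - X) ^ (ρ x - ρ y) =
              (toricGPoset ρ z * (-1) ^ (ρ x - ρ z)) *
                ((1 - X : ℤ[X]) ^ (ρ y - ρ z) * (X - 1) ^ (ρ x - ρ y)) := by
          intro y hy
          obtain ⟨-, h1, h2⟩ := Finset.mem_filter.1 hy
          have h1 := h.strictMono h1
          have h2 := h.strictMono.monotone h2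
          rw [one_sub_X_pow, one_sub_X_pow, neg_one_pow_sub h1.le, neg_one_pow_sub h2,
            neg_one_pow_sub (h2.trans h1.le)]
          have : (-1 : ℤ[X]) ^ ρ y * (-1) ^ ρ y = 1 := by rw [← mul_pow]; simp
          have h7 : (-1 : ℤ[X]) ^ ρ z * (-1) ^ ρ z = 1 := by rw [← mul_pow]; simp
          linear_combination -(toricGPoset ρ z * (X - 1) ^ (ρ y - ρ z) * (X - 1) ^ (ρ x - ρ y) *
            (-1) ^ ρ x * (-1) ^ ρ y) * h7
        rw [Finset.sum_congr rfl h6, ← Finset.mul_sum, eq_neg_of_add_eq_zero_right h4,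
          one_sub_X_pow]
        simp only [tsub_self, pow_zero, mul_one]
        have h7 : (-1 : ℤ[X]) ^ (ρ x - ρ z) * (-1) ^ (ρ x - ρ z) = 1 := by rw [← mul_pow]; simp
        linear_combination (toricGPoset ρ z * (X - 1) ^ (ρ x - ρ z)) * h7
      · symm
        rw [neg_zero]
        refine Finset.sum_eq_zero fun y hy => ?_
        obtain ⟨-, h1, h2⟩ := Finset.mem_filter.1 hy
        exact absurd (h2.trans_lt h1) hz
    have hspec := thePoly_spec (exists_isReversal_add hρx hanti)
    rw [hf, ← toricGPoset_of_rank_ne_zero h.strictMono hρx] at hspec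
    exact ⟨fun _ => hspec.1, hspec.2⟩

/-- Toric polynomials depend on lower intervals only. -/
theorem toricGPoset_comp {Q : Type*} [PartialOrder Q] [Finite Q] (f : Q ↪o P)
    (hf : IsLowerSet (Set.range f)) (hρ : StrictMono ρ) (x : Q) :
    toricGPoset (fun y => ρ (f y)) x = toricGPoset ρ (f x) := by
  classical
  have := Fintype.ofFinite Q
  induction hn : ρ (f x) using Nat.strong_induction_on generalizing x with
  | _ n ih =>
  subst hn
  by_cases h0 : ρ (f x) = 0
  · rw [toricGPoset_of_rank_eq_zero (ρ := fun y => ρ (f y)) h0, toricGPoset_of_rank_eq_zero h0]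
  · rw [toricGPoset_of_rank_ne_zero hρ h0,
      toricGPoset_of_rank_ne_zero (ρ := fun y => ρ (f y)) (hρ.comp f.strictMono) h0]
    congr! 5
    refine Finset.sum_bij (fun y _ => f y) ?_ (fun _ _ _ _ h => f.injective h) ?_ ?_
    · intro y hy
      simpa using hy
    · intro y hy
      have hy := (Finset.mem_filter.1 hy).2
      obtain ⟨y, rfl⟩ := hf hy.le ⟨x, rfl⟩
      exact ⟨y, by simpa using hy, rfl⟩
    · intro y hy
      have hy := (Finset.mem_filter.1 hy).2
      rw [ih (ρ (f y)) (hρ (f.strictMono hy)) y rfl]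

end Eulerian

/-! ### Kazhdan–Lusztig–Stanley inversion -/

section Inversion

/-- The Eulerian property passes to posets whose intervals are mapped onto intervals, with rank
functions that agree up to a constant in parity. It applies to the intervals of an Eulerian poset
and to their duals. -/
theorem IsEulerian.of_map {P Q : Type*} [PartialOrder P] [Finite P] [PartialOrder Q] [Finite Q]
    {ρ : P → ℕ} (h : IsEulerian ρ) {ρ' : Q → ℕ} (hρ' : StrictMono ρ') (f : Q → P)
    (hf : Function.Injective f)
    (hIcc : ∀ a b, a < b → ∃ x y, x < y ∧ f '' Set.Icc a b = Set.Icc x y) (ε : ℤ)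
    (hε : ∀ q, (-1 : ℤ) ^ ρ' q = ε * (-1) ^ ρ (f q)) : IsEulerian ρ' where
  strictMono := hρ'
  finsum_eq_zero := fun a b hab => by
    obtain ⟨x, y, hxy, he⟩ := hIcc a b hab
    rw [finsum_mem_congr rfl fun q _ => hε q, ← mul_finsum_mem (fun q => (-1 : ℤ) ^ ρ (f q)) ε,
      ← finsum_mem_image (f := fun p => (-1 : ℤ) ^ ρ p) hf.injOn, he, h.finsum_eq_zero x y hxy,
      mul_zero]

variable {P : Type*} [PartialOrder P]

open Classical in
/-- The toric polynomial of the interval `[x, y]`, and `0` unless `x ≤ y`. -/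
def intervalG (ρ : P → ℕ) : Matrix P P ℤ[X] := fun x y =>
  if h : x ≤ y then toricGPoset (fun z : Set.Ici x => ρ z - ρ x) ⟨y, h⟩ else 0

open Classical in
/-- The toric polynomial of the dual of the interval `[x, y]`, and `0` unless `x ≤ y`. -/
def intervalGDual (ρ : P → ℕ) : Matrix P P ℤ[X] := fun x y =>
  if h : x ≤ y then
    toricGPoset (fun z : (Set.Iic y)ᵒᵈ => ρ y - ρ (OrderDual.ofDual z).1) (OrderDual.toDual ⟨x, h⟩)
  else 0

theorem intervalG_apply (ρ : P → ℕ) {x : P} (y : Set.Ici x) :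
    intervalG ρ x y = toricGPoset (fun z : Set.Ici x => ρ z - ρ x) y :=
  dif_pos y.2

theorem intervalGDual_apply (ρ : P → ℕ) {y : P} (x : Set.Iic y) :
    intervalGDual ρ x y = toricGPoset
      (fun z : (Set.Iic y)ᵒᵈ => ρ y - ρ (OrderDual.ofDual z).1) (OrderDual.toDual x) :=
  dif_pos x.2

/-- The dual toric polynomials with the sign of the length of the interval. -/
def signedGDual (ρ : P → ℕ) : Matrix P P ℤ[X] := fun x y =>
  (-1) ^ (ρ y - ρ x) * intervalGDual ρ x y

open Classical in
/-- The kernel `(t - 1) ^ (ρ y - ρ x)` of the incidence algebra. -/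
def kernel (ρ : P → ℕ) : Matrix P P ℤ[X] := fun x y =>
  if x ≤ y then (X - 1) ^ (ρ y - ρ x) else 0

open Classical in
/-- The reversal `(1 - t) ^ (ρ y - ρ x)` of the kernel. -/
def kernelRev (ρ : P → ℕ) : Matrix P P ℤ[X] := fun x y =>
  if x ≤ y then (1 - X) ^ (ρ y - ρ x) else 0

/-- Membership in the incidence algebra. -/
def IsIncidence (M : Matrix P P ℤ[X]) : Prop := ∀ x y, ¬ x ≤ y → M x y = 0

theorem isIncidence_intervalG (ρ : P → ℕ) : IsIncidence (intervalG ρ) :=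
  fun _ _ h => dif_neg h

theorem isIncidence_intervalGDual (ρ : P → ℕ) : IsIncidence (intervalGDual ρ) :=
  fun _ _ h => dif_neg h

theorem isIncidence_signedGDual (ρ : P → ℕ) : IsIncidence (signedGDual ρ) :=
  fun x y h => by rw [signedGDual, isIncidence_intervalGDual ρ x y h, mul_zero]

theorem isIncidence_kernel (ρ : P → ℕ) : IsIncidence (kernel ρ) := fun _ _ h => if_neg h

theorem isIncidence_kernelRev (ρ : P → ℕ) : IsIncidence (kernelRev ρ) := fun _ _ h => if_neg h

variable [Fintype P] {ρ : P → ℕ}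

theorem IsIncidence.mul {M N : Matrix P P ℤ[X]} (hM : IsIncidence M) (hN : IsIncidence N) :
    IsIncidence (M * N) := by
  intro x y h
  rw [Matrix.mul_apply]
  refine Finset.sum_eq_zero fun z _ => ?_
  by_cases h1 : x ≤ z
  · rw [hN z y fun h2 => h (h1.trans h2), mul_zero]
  · rw [hM x z h1, zero_mul]

/-- `N` is the reversal of `M`, where the entry at `x ≤ y` has formal degree `ρ y - ρ x`. -/
def IsMatrixReversal (ρ : P → ℕ) (M N : Matrix P P ℤ[X]) : Prop :=
  ∀ x y, x ≤ y → IsReversal (ρ y - ρ x) (M x y) (N x y)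

theorem IsMatrixReversal.mul (hρ : Monotone ρ) {M N M' N' : Matrix P P ℤ[X]}
    (h : IsMatrixReversal ρ M N) (h' : IsMatrixReversal ρ M' N') (hM : IsIncidence M)
    (hN : IsIncidence N) (hM' : IsIncidence M') (hN' : IsIncidence N') :
    IsMatrixReversal ρ (M * M') (N * N') := by
  intro x y _
  rw [Matrix.mul_apply, Matrix.mul_apply]
  refine IsReversal.sum fun z _ => ?_
  by_cases h1 : x ≤ z
  · by_cases h2 : z ≤ y
    · have := (h x z h1).mul (h' z y h2)
      rwa [show ρ z - ρ x + (ρ y - ρ z) = ρ y - ρ x by have := hρ h1; have := hρ h2; omega] at this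
    · rw [hM' z y h2, hN' z y h2, mul_zero, mul_zero]
      exact isReversal_zero _
  · rw [hM x z h1, hN x z h1, zero_mul, zero_mul]
    exact isReversal_zero _

/-- The kernel and its reversal are mutually inverse: this is the Euler relation, weighted by a
power of `1 - t` that is constant on each interval. -/
theorem IsEulerian.kernelRev_mul_kernel [DecidableEq P] (h : IsEulerian ρ) :
    kernelRev ρ * kernel ρ = 1 := by
  classical
  ext1 x y
  by_cases hxy : x ≤ y
  · rw [Matrix.one_apply]
    refine Eq.trans ?_ ((h.sum_mul_eq_ite hxy).trans (by congr))
    rw [Matrix.mul_apply, Finset.sum_filter]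
    refine Finset.sum_congr rfl fun z _ => ?_
    simp only [kernelRev, kernel]
    by_cases h1 : x ≤ z <;> by_cases h2 : z ≤ y <;> simp [h1, h2]
  · rw [(isIncidence_kernelRev ρ).mul (isIncidence_kernel ρ) x y hxy,
      Matrix.one_apply_ne fun he => hxy he.le]

/-- The defining properties of the toric polynomials of intervals, in the incidence algebra. -/
theorem IsEulerian.intervalG_spec (h : IsEulerian ρ) :
    (∀ x, intervalG ρ x x = 1) ∧
    (∀ x y, x < y → 2 * (intervalG ρ x y).natDegree < ρ y - ρ x) ∧
    IsMatrixReversal ρ (intervalG ρ) (intervalG ρ * kernel ρ) := by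
  classical
  have hm := h.strictMono.monotone
  have hE : ∀ x, IsEulerian (fun z : Set.Ici x => ρ z - ρ x) := by
    intro x
    refine h.of_map (fun a b hab => ?_) Subtype.val Subtype.val_injective (fun a b hab => ?_)
      ((-1) ^ ρ x) fun q => ?_
    · have h1 : ρ a < ρ b := h.strictMono hab
      have h3 : ρ x ≤ ρ a := hm a.2
      change ρ a - ρ x < ρ b - ρ x
      omega
    · refine ⟨a, b, hab, ?_⟩
      ext z
      constructor
      · rintro ⟨z, hz, rfl⟩
        exact hz
      · exact fun hz => ⟨⟨z, le_trans a.2 hz.1⟩, hz, rfl⟩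
    · rw [neg_one_pow_sub (hm q.2), mul_comm]
  have hspec := fun x => (hE x).toricGPoset_spec (b := ⟨x, le_rfl⟩) (fun z => z.2) (by simp)
  refine ⟨fun x => ?_, fun x y hxy => ?_, fun x y hxy => ?_⟩
  · rw [intervalG, dif_pos le_rfl, toricGPoset_of_rank_eq_zero]
    simp
  · rw [intervalG, dif_pos hxy.le]
    exact (hspec x ⟨y, hxy.le⟩).1 fun he => hxy.ne' (congrArg Subtype.val he)
  · lift y to Set.Ici x using hxy
    rw [intervalG_apply]
    convert! (hspec x y).2 using 1
    rw [Matrix.mul_apply, finsum_mem_def, finsum_eq_sum_of_fintype]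
    symm
    refine Fintype.sum_of_injective Subtype.val Subtype.val_injective _ _ (fun z hz => ?_)
      fun z => ?_
    · rw [isIncidence_intervalG ρ x z fun hxz => hz ⟨⟨z, hxz⟩, rfl⟩, zero_mul]
    · rw [intervalG_apply]
      by_cases hzy : z ≤ y
      · have h1 : ρ x ≤ ρ z := hm z.2
        rw [Set.indicator_of_mem (show z ∈ Set.Iic y from hzy), kernel,
          if_pos (show z.1 ≤ y.1 from hzy),
          Nat.sub_sub_sub_cancel_right h1]
      · rw [Set.indicator_of_notMem (show z ∉ Set.Iic y from hzy),
          isIncidence_kernel ρ z.1 y.1 hzy, mul_zero]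

/-- In the dual poset the kernel acts from the other side. -/
theorem IsEulerian.intervalGDual_spec (h : IsEulerian ρ) :
    (∀ x, intervalGDual ρ x x = 1) ∧
    (∀ x y, x < y → 2 * (intervalGDual ρ x y).natDegree < ρ y - ρ x) ∧
    IsMatrixReversal ρ (intervalGDual ρ) (kernel ρ * intervalGDual ρ) := by
  classical
  have hm := h.strictMono.monotone
  have hE : ∀ y, IsEulerian (fun z : (Set.Iic y)ᵒᵈ => ρ y - ρ (OrderDual.ofDual z).1) := by
    intro y
    refine h.of_map (fun a b hab => ?_) (fun z => (OrderDual.ofDual z).1)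
      (Subtype.val_injective.comp OrderDual.ofDual.injective) (fun a b hab => ?_)
      ((-1) ^ ρ y) fun q => ?_
    · have h1 : ρ (OrderDual.ofDual b).1 < ρ (OrderDual.ofDual a).1 := h.strictMono hab
      have h2 : ρ (OrderDual.ofDual a).1 ≤ ρ y := hm (OrderDual.ofDual a).2
      change ρ y - ρ (OrderDual.ofDual a).1 < ρ y - ρ (OrderDual.ofDual b).1
      omega
    · refine ⟨(OrderDual.ofDual b).1, (OrderDual.ofDual a).1, hab, ?_⟩
      ext z
      constructor
      · rintro ⟨z, hz, rfl⟩
        exact ⟨hz.2, hz.1⟩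
      · exact fun hz => ⟨OrderDual.toDual ⟨z, le_trans hz.2 (OrderDual.ofDual a).2⟩,
          ⟨hz.2, hz.1⟩, rfl⟩
    · exact neg_one_pow_sub (hm (OrderDual.ofDual q).2)
  have hspec := fun y => (hE y).toricGPoset_spec (b := OrderDual.toDual ⟨y, le_rfl⟩)
    (fun z => (OrderDual.ofDual z).2) (by simp)
  refine ⟨fun x => ?_, fun x y hxy => ?_, fun x y hxy => ?_⟩
  · rw [intervalGDual, dif_pos le_rfl, toricGPoset_of_rank_eq_zero]
    simp
  · rw [intervalGDual, dif_pos hxy.le]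
    exact (hspec y (OrderDual.toDual ⟨x, hxy.le⟩)).1 fun he => hxy.ne (congrArg Subtype.val he)
  · lift x to Set.Iic y using hxy
    rw [intervalGDual_apply]
    convert! (hspec y (OrderDual.toDual x)).2 using 1
    rw [Matrix.mul_apply, finsum_mem_def, finsum_eq_sum_of_fintype]
    symm
    refine Fintype.sum_of_injective (fun z => (OrderDual.ofDual z).1)
      (Subtype.val_injective.comp OrderDual.ofDual.injective) _ _ (fun z hz => ?_) fun z => ?_
    · rw [isIncidence_intervalGDual ρ z y fun hxz => hz ⟨OrderDual.toDual ⟨z, hxz⟩, rfl⟩, mul_zero]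
    · obtain ⟨z, rfl⟩ := OrderDual.toDual.surjective z
      simp only [OrderDual.ofDual_toDual]
      rw [intervalGDual_apply]
      by_cases hxz : x ≤ z
      · have h1 : ρ x ≤ ρ z := hm hxz
        have h2 : ρ z ≤ ρ y := hm z.2
        rw [Set.indicator_of_mem (show OrderDual.toDual z ∈ Set.Iic (OrderDual.toDual x) from hxz),
          kernel, if_pos (show x.1 ≤ z.1 from hxz), OrderDual.ofDual_toDual,
          show ρ y - ρ x - (ρ y - ρ z) = ρ z - ρ x by omega, mul_comm]
      · rw [Set.indicator_of_notMem
          (show OrderDual.toDual z ∉ Set.Iic (OrderDual.toDual x) from hxz),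
          isIncidence_kernel ρ x.1 z.1 hxz, zero_mul]

/-- The signs turn the kernel into its inverse. -/
theorem IsEulerian.isMatrixReversal_signedGDual (h : IsEulerian ρ) :
    IsMatrixReversal ρ (signedGDual ρ) (kernelRev ρ * signedGDual ρ) := by
  intro x y hxy
  have := (h.intervalGDual_spec.2.2 x y hxy).neg_one_pow_mul (ρ y - ρ x)
  convert! this using 1
  rw [Matrix.mul_apply, Matrix.mul_apply, Finset.mul_sum]
  refine Finset.sum_congr rfl fun z _ => ?_
  by_cases h1 : x ≤ z
  · by_cases h2 : z ≤ y
    · have e1 := h.strictMono.monotone h1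
      have e2 := h.strictMono.monotone h2
      rw [kernelRev, if_pos h1, kernel, if_pos h1, signedGDual, one_sub_X_pow,
        show ρ y - ρ x = (ρ z - ρ x) + (ρ y - ρ z) by omega, pow_add]
      ring
    · rw [isIncidence_signedGDual ρ z y h2, isIncidence_intervalGDual ρ z y h2]
      simp
  · rw [isIncidence_kernelRev ρ x z h1, isIncidence_kernel ρ x z h1]
    simp

/-- Stanley's inversion formula. The product `F` of the two matrices satisfies
`rev F = K' * F * K` with mutually inverse kernels `K'` and `K`, so that, by induction on the length
of the interval, each entry off the diagonal is palindromic; its degree is too small for that unless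
it vanishes. -/
theorem IsEulerian.signedGDual_mul_intervalG [DecidableEq P] (h : IsEulerian ρ) :
    signedGDual ρ * intervalG ρ = 1 := by
  classical
  have hm := h.strictMono.monotone
  obtain ⟨hg1, hg2, hg3⟩ := h.intervalG_spec
  obtain ⟨hl1, hl2, -⟩ := h.intervalGDual_spec
  have hL := isIncidence_signedGDual ρ
  have hG := isIncidence_intervalG ρ
  have hK := isIncidence_kernel ρ
  have hK' := isIncidence_kernelRev ρ
  have hs1 : ∀ x, signedGDual ρ x x = 1 := fun x => by simp [signedGDual, hl1]
  have hs2 : ∀ x y, (signedGDual ρ x y).natDegree ≤ (intervalGDual ρ x y).natDegree := by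
    intro x y
    refine natDegree_mul_le.trans ?_
    have : ((-1 : ℤ[X]) ^ (ρ y - ρ x)).natDegree = 0 := by
      rw [← Int.cast_one, ← Int.cast_neg, ← Int.cast_pow, natDegree_intCast]
    omega
  set F := signedGDual ρ * intervalG ρ with hF
  have hFI : IsIncidence F := hL.mul hG
  have hrev : IsMatrixReversal ρ F (kernelRev ρ * F * kernel ρ) := by
    have := h.isMatrixReversal_signedGDual.mul hm hg3 hL (hK'.mul hL) hG (hG.mul hK)
    convert! this using 1
    rw [hF]
    simp only [Matrix.mul_assoc]
  have hdiag : ∀ x, F x x = 1 := by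
    intro x
    rw [hF, Matrix.mul_apply, Finset.sum_eq_single x, hs1, hg1, mul_one]
    · intro z _ hz
      by_cases h1 : x ≤ z
      · rw [hG z x fun h2 => hz (le_antisymm h2 h1), mul_zero]
      · rw [hL x z h1, zero_mul]
    · simp
  suffices ∀ n x y, ρ y - ρ x = n → x < y → F x y = 0 by
    ext1 x y
    by_cases hxy : x ≤ y
    · rcases hxy.eq_or_lt with rfl | hlt
      · rw [hdiag, Matrix.one_apply_eq]
      · rw [this _ x y rfl hlt, Matrix.one_apply_ne hlt.ne]
    · rw [hFI x y hxy, Matrix.one_apply_ne fun he => hxy he.le]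
  intro n
  induction n using Nat.strong_induction_on with
  | _ n ih =>
  intro x y hn hxy
  subst hn
  have hρ := h.strictMono hxy
  have hpal : (kernelRev ρ * F * kernel ρ) x y = F x y := by
    -- by induction `F - 1` vanishes on all shorter intervals, so that the kernels act on its entry
    -- at `(x, y)` by their diagonal entries, which are `1`
    have e : kernelRev ρ * F * kernel ρ = 1 + kernelRev ρ * (F - 1) * kernel ρ := by
      rw [mul_sub, sub_mul, mul_one, h.kernelRev_mul_kernel]
      abel
    have hsmall : ∀ a b, x ≤ a → b ≤ y → (a, b) ≠ (x, y) → (F - 1) a b = 0 := by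
      intro a b ha hb hne
      rw [Matrix.sub_apply]
      by_cases hab : a ≤ b
      · rcases hab.eq_or_lt with rfl | hlt
        · rw [hdiag, Matrix.one_apply_eq, sub_self]
        · rw [Matrix.one_apply_ne hlt.ne, sub_zero]
          refine ih _ ?_ a b rfl hlt
          have h1 := hm ha
          have h2 := hm hb
          have h3 := h.strictMono hlt
          by_contra hc
          refine hne (Prod.ext ?_ ?_)
          · refine (ha.eq_or_lt.resolve_right fun hlt => ?_).symm
            have := h.strictMono hlt
            omega
          · refine hb.eq_or_lt.resolve_right fun hlt => ?_
            have := h.strictMono hlt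
            omega
      · rw [hFI a b hab, Matrix.one_apply_ne fun he => hab he.le, sub_zero]
    rw [e, Matrix.add_apply, Matrix.one_apply_ne hxy.ne, zero_add, Matrix.mul_apply,
      Finset.sum_eq_single y, Matrix.mul_apply, Finset.sum_eq_single x]
    · rw [Matrix.sub_apply, Matrix.one_apply_ne hxy.ne, kernelRev, kernel, if_pos le_rfl,
        if_pos le_rfl]
      simp
    · intro a _ ha
      by_cases h1 : x ≤ a
      · rw [hsmall a y h1 le_rfl (by simpa using ha), mul_zero]
      · rw [hK' x a h1, zero_mul]
    · simp
    · intro b _ hb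
      by_cases h1 : b ≤ y
      · rw [Matrix.mul_apply, Finset.sum_eq_zero, zero_mul]
        intro a _
        by_cases h2 : x ≤ a
        · rw [hsmall a b h2 h1 (by simp [hb]), mul_zero]
        · rw [hK' x a h2, zero_mul]
      · rw [hK b y h1, mul_zero]
    · simp
  have hr := hrev x y hxy.le
  rw [hpal] at hr
  refine hr.eq_zero ?_
  -- the two factors of each term have degrees less than half the lengths of `[x, z]` and `[z, y]`
  suffices (F x y).natDegree ≤ (ρ y - ρ x - 1) / 2 by omega
  rw [hF, Matrix.mul_apply]
  refine natDegree_sum_le_of_forall_le _ _ fun z _ => ?_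
  by_cases h1 : x ≤ z
  · by_cases h2 : z ≤ y
    · have e1 := hm h1
      have e2 := hm h2
      have d0 := natDegree_mul_le (p := signedGDual ρ x z) (q := intervalG ρ z y)
      have d1 := hs2 x z
      rcases h1.eq_or_lt with rfl | h1
      · have d2 := hg2 x y hxy
        rw [hs1, one_mul]
        omega
      · have d2 := hl2 x z h1
        rcases h2.eq_or_lt with rfl | h2
        · rw [hg1, mul_one]
          omega
        · have d3 := hg2 z y h2
          omega
    · rw [hG z y h2]; simp
  · rw [hL x z h1]; simp

/-- The sum of `g([x, y]; t) * (t - 1) ^ (d - ρ y)` over `y ≥ x` has a reversal `H x` of formal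
degree `d - ρ x`; the second half is the value of `∑ (-1) ^ (ρ y - ρ x) * g([x, y]*; t) * H y`. -/
theorem IsEulerian.exists_reversal_of_sum (h : IsEulerian ρ) {d : ℕ} (hd : ∀ x, ρ x ≤ d) :
    ∃ H : P → ℤ[X], (∀ x, IsReversal (d - ρ x) (H x)
      (∑ y, intervalG ρ x y * (X - 1) ^ (d - ρ y))) ∧
      (signedGDual ρ).mulVec H = (kernel ρ).mulVec fun y => (1 - X) ^ (d - ρ y) := by
  classical
  refine ⟨(intervalG ρ * kernel ρ).mulVec fun y => (1 - X) ^ (d - ρ y), fun x => ?_, ?_⟩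
  · refine IsReversal.symm ?_
    simp only [Matrix.mulVec, dotProduct]
    refine IsReversal.sum fun y _ => ?_
    by_cases hxy : x ≤ y
    · have := (h.intervalG_spec.2.2 x y hxy).mul (isReversal_X_sub_one_pow (d - ρ y))
      rwa [show ρ y - ρ x + (d - ρ y) = d - ρ x by
        have := h.strictMono.monotone hxy; have := hd y; omega] at this
    · rw [isIncidence_intervalG ρ x y hxy,
        (isIncidence_intervalG ρ).mul (isIncidence_kernel ρ) x y hxy, zero_mul, zero_mul]
      exact isReversal_zero _
  · rw [Matrix.mulVec_mulVec, ← Matrix.mul_assoc, h.signedGDual_mul_intervalG, Matrix.one_mul]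

open Classical in
/-- Möbius inversion on an Eulerian poset. -/
theorem IsEulerian.mobius_inversion {R : Type*} [CommRing R] (h : IsEulerian ρ) (e E : P → R)
    (hE : ∀ y, E y = ∑ x with x ≤ y, e x) (y : P) :
    e y = ∑ x with x ≤ y, (-1) ^ (ρ y - ρ x) * E x := by
  have hm := h.strictMono.monotone
  symm
  simp only [hE, Finset.mul_sum, Finset.sum_filter]
  rw [← Finset.sum_filter, Finset.sum_comm' (t' := Finset.univ)
    (s' := fun _ => Finset.univ.filter (· ≤ y)) (by simp), Finset.sum_eq_single y]
  · rw [Finset.sum_eq_single y]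
    · simp
    · intro x hx hne
      rw [if_neg fun hle => hne (le_antisymm (Finset.mem_filter.1 hx).2 hle), mul_zero]
    · simp
  · intro z _ hz
    simp only [mul_ite, mul_zero]
    rw [← Finset.sum_filter, Finset.filter_filter]
    by_cases hzy : z ≤ y
    · have h0 := congrArg (Int.cast : ℤ → R) (h.sum_eq_zero (lt_of_le_of_ne hzy hz))
      rw [Int.cast_sum, Int.cast_zero] at h0
      rw [Finset.sum_congr rfl (g := fun x => ((-1) ^ ρ y * e z) * (((-1 : ℤ) ^ ρ x : ℤ) : R)),
        ← Finset.mul_sum]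
      · have : Finset.univ.filter (fun x => x ≤ y ∧ z ≤ x) =
            Finset.univ.filter (fun x => z ≤ x ∧ x ≤ y) := by
          ext; simp [and_comm]
        rw [this, h0, mul_zero]
      · intro x hx
        have h1 := congrArg (Int.cast : ℤ → R)
          (neg_one_pow_sub (hm (Finset.mem_filter.1 hx).2.1))
        push_cast at h1 ⊢
        rw [h1]
        ring
    · refine Finset.sum_eq_zero fun x hx => ?_
      obtain ⟨-, h1, h2⟩ := Finset.mem_filter.1 hx
      exact absurd (h2.trans h1) hzy
  · simp

end Inversion

/-! ### Fans and links -/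

section Fans

variable {V : Type*} [AddCommGroup V] [Module ℝ V] {Δ : Set (PointedCone ℝ V)}

theorem IsFan.isFace_of_le (h : IsFan Δ) {τ σ : PointedCone ℝ V} (hτ : τ ∈ Δ) (hσ : σ ∈ Δ)
    (hle : τ ≤ σ) : IsFace τ σ := by
  have := (h.inter_face τ hτ σ hσ).2
  rwa [inf_eq_left.2 hle] at this

theorem IsFan.mem_faces_iff (h : IsFan Δ) {τ σ : PointedCone ℝ V} (hσ : σ ∈ Δ) :
    τ ∈ faces σ ↔ τ ∈ Δ ∧ τ ≤ σ :=
  ⟨fun hf => ⟨h.face_mem σ hσ τ hf, IsFace.le hf⟩, fun hf => h.isFace_of_le hf.1 hσ hf.2⟩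

theorem IsFan.inf_mem (h : IsFan Δ) {τ σ : PointedCone ℝ V} (hτ : τ ∈ Δ) (hσ : σ ∈ Δ) :
    τ ⊓ σ ∈ Δ :=
  h.face_mem τ hτ _ (h.inter_face τ hτ σ hσ).1

theorem IsFan.faces (h : IsFan Δ) {σ : PointedCone ℝ V} (hσ : σ ∈ Δ) : IsFan (faces σ) := by
  have hsub : ∀ τ ∈ FanEhrhart.faces σ, τ ∈ Δ := fun τ hτ => h.face_mem σ hσ τ hτ
  refine ⟨h.finite.subset hsub, fun τ hτ => h.fg τ (hsub τ hτ),
    fun τ hτ => h.pointed τ (hsub τ hτ), fun τ hτ F hF => ?_,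
    fun τ hτ τ' hτ' => h.inter_face τ (hsub τ hτ) τ' (hsub τ' hτ')⟩
  exact (h.mem_faces_iff hσ).2 ⟨h.face_mem τ (hsub τ hτ) F hF, hF.le.trans (IsFace.le hτ)⟩

/-- The image of the cone `τ` in the quotient by the span of `σ`. -/
abbrev quotCone (σ τ : PointedCone ℝ V) :
    PointedCone ℝ (V ⧸ Submodule.span ℝ (σ : Set V)) :=
  PointedCone.map (Submodule.span ℝ (σ : Set V)).mkQ τ

theorem mkQ_eq_zero_of_mem {σ : PointedCone ℝ V} {x : V} (hx : x ∈ σ) :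
    (Submodule.span ℝ (σ : Set V)).mkQ x = 0 := by
  rw [Submodule.mkQ_apply, Submodule.Quotient.mk_eq_zero]
  exact Submodule.subset_span hx

theorem quotCone_mono (σ : PointedCone ℝ V) {τ₁ τ₂ : PointedCone ℝ V} (h : τ₁ ≤ τ₂) :
    quotCone σ τ₁ ≤ quotCone σ τ₂ := by
  rintro _ ⟨x, hx, rfl⟩
  exact ⟨x, h hx, rfl⟩

theorem quotCone_self (σ : PointedCone ℝ V) : quotCone σ σ = ⊥ := by
  refine (Submodule.eq_bot_iff _).2 ?_
  rintro _ ⟨x, hx, rfl⟩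
  exact mkQ_eq_zero_of_mem hx

/-- The cones of a fan above `σ` are determined by their images modulo `σ`. -/
theorem IsFan.quotCone_le_iff (h : IsFan Δ) {σ τ₁ τ₂ : PointedCone ℝ V} (h₁ : τ₁ ∈ Δ) (h₂ : τ₂ ∈ Δ)
    (hσ₁ : σ ≤ τ₁) (hσ₂ : σ ≤ τ₂) : quotCone σ τ₁ ≤ quotCone σ τ₂ ↔ τ₁ ≤ τ₂ := by
  refine ⟨fun hle x hx => ?_, quotCone_mono σ⟩
  obtain ⟨y, hy, hxy⟩ := hle ⟨x, hx, rfl⟩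
  have hxy : (Submodule.span ℝ (σ : Set V)).mkQ y = (Submodule.span ℝ (σ : Set V)).mkQ x := hxy
  rw [Submodule.mkQ_apply, Submodule.mkQ_apply, Submodule.Quotient.eq] at hxy
  obtain ⟨a, ha, b, hb, he⟩ := exists_sub_of_mem_span hxy
  have hmem : x + a ∈ τ₁ ⊓ τ₂ := by
    refine ⟨add_mem hx (hσ₁ ha), ?_⟩
    have : x + a = y + b := by
      rw [sub_eq_sub_iff_add_eq_add] at he
      rw [he, add_comm]
    rw [this]
    exact add_mem hy (hσ₂ hb)
  exact ((h.inter_face τ₁ h₁ τ₂ h₂).1.mem_of_add_mem hx (hσ₁ ha) hmem).2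

theorem IsFan.quotCone_injOn (h : IsFan Δ) (σ : PointedCone ℝ V) :
    Set.InjOn (quotCone σ) {τ | τ ∈ Δ ∧ σ ≤ τ} := fun _ h₁ _ h₂ he =>
  le_antisymm ((h.quotCone_le_iff h₁.1 h₂.1 h₁.2 h₂.2).1 he.le)
    ((h.quotCone_le_iff h₂.1 h₁.1 h₂.2 h₁.2).1 he.ge)

/-- The faces of the image of `τ` modulo `σ` are the images of the faces between `σ` and `τ`. -/
theorem isFace_quotCone_iff {σ τ : PointedCone ℝ V} (hσ : σ ≤ τ)
    {γ : PointedCone ℝ (V ⧸ Submodule.span ℝ (σ : Set V))} :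
    IsFace γ (quotCone σ τ) ↔ ∃ F, IsFace F τ ∧ σ ≤ F ∧ γ = quotCone σ F := by
  constructor
  · rintro ⟨w, hw, hγ⟩
    set w' := w.comp (Submodule.span ℝ (σ : Set V)).mkQ with hw'
    refine ⟨faceOf τ {w'}, ⟨w', fun u hu => hw _ ⟨u, hu, rfl⟩, ?_⟩, fun x hx => ?_, ?_⟩
    · ext x
      exact mem_faceOf.trans (by simp)
    · refine mem_faceOf.2 ⟨hσ hx, fun l hl => ?_⟩
      rw [Finset.mem_singleton.1 hl, hw', LinearMap.comp_apply, mkQ_eq_zero_of_mem hx, map_zero]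
    · refine SetLike.coe_injective (hγ.trans ?_)
      ext u
      constructor
      · rintro ⟨⟨x, hx, rfl⟩, h0⟩
        exact ⟨x, mem_faceOf.2 ⟨hx, fun l hl => by rw [Finset.mem_singleton.1 hl]; exact h0⟩, rfl⟩
      · rintro ⟨x, hx, rfl⟩
        have hx := mem_faceOf.1 hx
        exact ⟨⟨x, hx.1, rfl⟩, hx.2 w' (Finset.mem_singleton_self _)⟩
  · rintro ⟨F, ⟨w, hw, hF⟩, hσF, rfl⟩
    have hF' : ∀ x, x ∈ F ↔ x ∈ τ ∧ w x = 0 := fun x => Set.ext_iff.1 hF x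
    have hker : Submodule.span ℝ (σ : Set V) ≤ LinearMap.ker w :=
      Submodule.span_le.2 fun x hx => ((hF' x).1 (hσF hx)).2
    refine ⟨(Submodule.span ℝ (σ : Set V)).liftQ w hker, ?_, ?_⟩
    · rintro _ ⟨x, hx, rfl⟩
      exact hw x hx
    · ext u
      constructor
      · rintro ⟨x, hx, rfl⟩
        exact ⟨⟨x, ((hF' x).1 hx).1, rfl⟩, ((hF' x).1 hx).2⟩
      · rintro ⟨⟨x, hx, rfl⟩, h0⟩
        exact ⟨x, (hF' x).2 ⟨hx, h0⟩, rfl⟩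

theorem IsFan.bijOn_faces_quotCone (h : IsFan Δ) {σ τ : PointedCone ℝ V} (hτ : τ ∈ Δ)
    (hle : σ ≤ τ) :
    Set.BijOn (quotCone σ) {F | F ∈ Δ ∧ σ ≤ F ∧ F ≤ τ} (FanEhrhart.faces (quotCone σ τ)) := by
  refine ⟨fun F hF => (isFace_quotCone_iff hle).2
    ⟨F, h.isFace_of_le hF.1 hτ hF.2.2, hF.2.1, rfl⟩,
    (h.quotCone_injOn σ).mono (show _ ⊆ {τ | τ ∈ Δ ∧ σ ≤ τ} from fun F hF => ⟨hF.1, hF.2.1⟩),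
    fun γ hγ => ?_⟩
  obtain ⟨F, hF, hσF, rfl⟩ := (isFace_quotCone_iff hle).1 hγ
  exact ⟨F, ⟨h.face_mem τ hτ F hF, hσF, hF.le⟩, rfl⟩

theorem IsFan.bijOn_link (h : IsFan Δ) {σ : PointedCone ℝ V} (hσ : σ ∈ Δ) :
    Set.BijOn (quotCone σ) {τ | τ ∈ Δ ∧ σ ≤ τ} (link Δ σ) := by
  refine ⟨fun τ hτ => ⟨τ, hτ.1, h.isFace_of_le hσ hτ.1 hτ.2, rfl⟩, h.quotCone_injOn σ, ?_⟩
  rintro _ ⟨τ, hτ, hf, rfl⟩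
  exact ⟨τ, ⟨hτ, hf.le⟩, rfl⟩

variable [FiniteDimensional ℝ V]

theorem coneDim_quotCone {σ τ : PointedCone ℝ V} (hle : σ ≤ τ) :
    coneDim (quotCone σ τ) = coneDim τ - coneDim σ := by
  set N := Submodule.span ℝ (σ : Set V)
  set W := Submodule.span ℝ (τ : Set V)
  have hNW : N ≤ W := Submodule.span_mono hle
  have h1 : Submodule.span ℝ (quotCone σ τ : Set (V ⧸ N)) = W.map N.mkQ := by
    rw [Submodule.map_span]
    rfl
  have h2 := LinearMap.finrank_range_add_finrank_ker (N.mkQ.domRestrict W)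
  rw [LinearMap.range_domRestrict] at h2
  have h3 : Module.finrank ℝ (LinearMap.ker (N.mkQ.domRestrict W)) = Module.finrank ℝ N := by
    have : (LinearMap.ker (N.mkQ.domRestrict W)).map W.subtype = N := by
      ext x
      simp only [Submodule.mem_map, LinearMap.mem_ker]
      constructor
      · rintro ⟨y, hy, rfl⟩
        exact (Submodule.Quotient.mk_eq_zero N).1 hy
      · exact fun hx => ⟨(⟨x, hNW hx⟩ : W), (Submodule.Quotient.mk_eq_zero N).2 hx, rfl⟩
    rw [← Submodule.finrank_map_subtype_eq W, this]
  rw [h3] at h2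
  rw [coneDim, h1]
  exact Nat.eq_sub_of_add_eq h2

/-- The interval `[σ, τ]` of a fan is the face poset of the image of `τ` modulo `σ`, to which the
Euler relation for cones applies. -/
theorem IsFan.isEulerian (h : IsFan Δ) [Finite Δ] :
    IsEulerian (fun σ : Δ => coneDim σ.1) where
  strictMono := fun τ σ hlt => (h.isFace_of_le τ.2 σ.2 hlt.le).coneDim_lt fun he =>
    hlt.ne (Subtype.ext he)
  finsum_eq_zero := by
    rintro ⟨σ, hσ⟩ ⟨τ, hτ⟩ hlt
    have hle : σ ≤ τ := hlt.le
    have hf := h.isFace_of_le hσ hτ hle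
    have hne : σ ≠ τ := fun he => hlt.ne (Subtype.ext he)
    have e1 : ∑ᶠ γ ∈ FanEhrhart.faces (quotCone σ τ), (-1 : ℤ) ^ coneDim γ = 0 := by
      refine finsum_faces_neg_one_pow_coneDim ((h.fg τ hτ).map _) ?_ ?_
      · rintro _ ⟨x, hx, rfl⟩ ⟨y, hy, hxy⟩
        have hxy : (Submodule.span ℝ (σ : Set V)).mkQ (x + y) = 0 := by
          rw [map_add]
          exact add_eq_zero_iff_neg_eq.2 hxy.symm
        rw [Submodule.mkQ_apply, Submodule.Quotient.mk_eq_zero] at hxy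
        exact mkQ_eq_zero_of_mem
          (hf.mem_of_add_mem hx hy (hf.mem_of_mem_span (add_mem hx hy) hxy))
      · intro hbot
        have := coneDim_quotCone hle
        rw [coneDim_eq_zero.2 hbot] at this
        have := hf.coneDim_lt hne
        omega
    rw [← finsum_mem_eq_of_bijOn _ (h.bijOn_faces_quotCone hτ hle) (fun F hF => rfl)] at e1
    have e2 : ∑ᶠ F ∈ {F | F ∈ Δ ∧ σ ≤ F ∧ F ≤ τ}, (-1 : ℤ) ^ coneDim F =
        (-1) ^ coneDim σ * ∑ᶠ F ∈ {F | F ∈ Δ ∧ σ ≤ F ∧ F ≤ τ}, (-1) ^ coneDim (quotCone σ F) := by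
      rw [mul_finsum_mem]
      refine finsum_mem_congr rfl fun F hF => ?_
      rw [coneDim_quotCone hF.2.1, ← pow_add,
        Nat.add_sub_cancel' (coneDim_mono hF.2.1)]
    rw [e1, mul_zero] at e2
    rw [← e2]
    refine finsum_mem_eq_of_bijOn Subtype.val ⟨fun F hF => ⟨F.2, hF.1, hF.2⟩,
      Subtype.val_injective.injOn, fun F hF => ⟨⟨F, hF.1⟩, ⟨hF.2.1, hF.2.2⟩, rfl⟩⟩ fun F _ => rfl

/-! ### Toric polynomials of links -/

/-- The toric polynomial of a cone of the link of `σ` is that of an interval of the fan. -/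
theorem IsFan.toricG_quotCone (h : IsFan Δ) (σ τ : Δ) (hle : σ ≤ τ) :
    toricG (quotCone σ.1 τ.1) = intervalG (fun σ : Δ => coneDim σ.1) σ τ := by
  have hfin := h.finite.to_subtype
  have := Fintype.ofFinite Δ
  have hb := h.bijOn_faces_quotCone τ.2 (show σ.1 ≤ τ.1 from hle)
  have hsurj : ∀ γ, γ ∈ FanEhrhart.faces (quotCone σ.1 τ.1) → ∃ F,
      (F ∈ Δ ∧ σ.1 ≤ F ∧ F ≤ τ.1) ∧ quotCone σ.1 F = γ := fun γ hγ => hb.surjOn hγ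
  choose! g hg hgq using hsurj
  replace hg := fun {a} => hg a
  replace hgq := fun {a} => hgq a
  have hle_iff : ∀ a ∈ FanEhrhart.faces (quotCone σ.1 τ.1),
      ∀ b ∈ FanEhrhart.faces (quotCone σ.1 τ.1), (g a ≤ g b ↔ a ≤ b) := by
    intro a ha b hb
    rw [← h.quotCone_le_iff (hg ha).1 (hg hb).1 (hg ha).2.1 (hg hb).2.1, hgq ha, hgq hb]
  let f : FanEhrhart.faces (quotCone σ.1 τ.1) ↪o Set.Ici σ :=
    OrderEmbedding.ofMapLEIff (fun a => ⟨⟨g a.1, (hg a.2).1⟩, (hg a.2).2.1⟩)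
      fun a b => hle_iff a.1 a.2 b.1 b.2
  have hgF : ∀ F : PointedCone ℝ V, F ∈ Δ → σ.1 ≤ F → F ≤ τ.1 → g (quotCone σ.1 F) = F :=
    fun F hF h1 h2 => hb.injOn (hg (hb.mapsTo ⟨hF, h1, h2⟩)) ⟨hF, h1, h2⟩
      (hgq (hb.mapsTo ⟨hF, h1, h2⟩))
  have hlow : IsLowerSet (Set.range f) := by
    rintro _ b hba ⟨a, rfl⟩
    have h1 : b.1.1 ≤ τ.1 := le_trans (show b.1.1 ≤ g a.1 from hba) (hg a.2).2.2
    have h2 : σ.1 ≤ b.1.1 := b.2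
    exact ⟨⟨quotCone σ.1 b.1.1, hb.mapsTo ⟨b.1.2, h2, h1⟩⟩,
      Subtype.ext (Subtype.ext (hgF _ b.1.2 h2 h1))⟩
  have hmono : StrictMono (fun z : Set.Ici σ => coneDim z.1.1 - coneDim σ.1) := by
    intro a b hab
    have h1 := h.isEulerian.strictMono (show a.1 < b.1 from hab)
    have h2 := h.isEulerian.strictMono.monotone (show σ ≤ a.1 from a.2)
    simp only at h1 h2 ⊢
    omega
  have hfin' : Finite (FanEhrhart.faces (quotCone σ.1 τ.1)) := Finite.of_injective f f.injective
  have := Fintype.ofFinite (Set.Ici σ)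
  have key := toricGPoset_comp f hlow hmono ⟨quotCone σ.1 τ.1, self_mem_faces _⟩
  lift τ to Set.Ici σ using hle
  rw [intervalG_apply]
  refine Eq.trans ?_ (key.trans (congrArg _ ?_))
  · refine congrArg (fun ρ => toricGPoset ρ _) (funext fun a => ?_)
    change coneDim a.1 = coneDim (g a.1) - coneDim σ.1
    rw [← coneDim_quotCone (hg a.2).2.1, hgq a.2]
  · exact Subtype.ext (Subtype.ext (hgF _ τ.1.2 τ.2 le_rfl))

theorem fanDim_eq_of_isPure {d : ℕ} (hfin : Δ.Finite) (hp : IsPure d Δ) (hne : Δ.Nonempty) :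
    fanDim Δ = d ∧ ∀ σ ∈ Δ, coneDim σ ≤ d ∧ ∃ τ ∈ Δ, σ ≤ τ ∧ coneDim τ = d := by
  have hmax : ∀ σ ∈ Δ, ∃ τ ∈ Δ, σ ≤ τ ∧ coneDim τ = d := by
    intro σ hσ
    obtain ⟨τ, hle, hτ⟩ := hfin.exists_le_maximal hσ
    exact ⟨τ, hτ.prop, hle, hp τ hτ⟩
  have hle : ∀ σ ∈ Δ, coneDim σ ≤ d := by
    intro σ hσ
    obtain ⟨τ, -, h1, h2⟩ := hmax σ hσ
    rw [← h2]
    exact coneDim_mono h1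
  refine ⟨?_, fun σ hσ => ⟨hle σ hσ, hmax σ hσ⟩⟩
  obtain ⟨σ, hσ⟩ := hne
  obtain ⟨τ, hτ, -, h2⟩ := hmax σ hσ
  refine IsGreatest.csSup_eq ⟨⟨τ, hτ, h2⟩, ?_⟩
  rintro _ ⟨σ, hσ, rfl⟩
  exact hle σ hσ

theorem IsFan.fanDim_link (h : IsFan Δ) {d : ℕ} (hd : ∀ σ ∈ Δ, coneDim σ ≤ d)
    {σ τ : PointedCone ℝ V} (hσ : σ ∈ Δ) (hτ : τ ∈ Δ) (hle : σ ≤ τ) (hτd : coneDim τ = d) :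
    fanDim (link Δ σ) = d - coneDim σ := by
  refine IsGreatest.csSup_eq ⟨⟨quotCone σ τ, (h.bijOn_link hσ).mapsTo ⟨hτ, hle⟩, ?_⟩, ?_⟩
  · rw [coneDim_quotCone hle, hτd]
  · rintro _ ⟨γ, hγ, rfl⟩
    obtain ⟨F, hF, rfl⟩ := (h.bijOn_link hσ).surjOn hγ
    rw [coneDim_quotCone hF.2]
    exact Nat.sub_le_sub_right (hd F hF.1) _

theorem fanDim_faces (σ : PointedCone ℝ V) :
    fanDim (FanEhrhart.faces σ) = coneDim σ := by
  refine IsGreatest.csSup_eq ⟨⟨σ, self_mem_faces σ, rfl⟩, ?_⟩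
  rintro _ ⟨F, hF, rfl⟩
  exact coneDim_mono (IsFace.le hF)

/-- The dual toric polynomial of the link of `τ` in `⟨σ⟩` is that of the interval `[τ, σ]`. -/
theorem IsFan.toricGDual_link (h : IsFan Δ) (τ σ : Δ) (hle : τ ≤ σ) :
    toricGDual (link (FanEhrhart.faces σ.1) τ.1) =
      intervalGDual (fun σ : Δ => coneDim σ.1) τ σ := by
  have hfin := h.finite.to_subtype
  have := Fintype.ofFinite Δ
  have hle' : τ.1 ≤ σ.1 := hle
  have hF := h.faces σ.2
  have hτF : τ.1 ∈ FanEhrhart.faces σ.1 := h.isFace_of_le τ.2 σ.2 hle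
  have hmem : ∀ F, F ∈ FanEhrhart.faces σ.1 ↔ F ∈ Δ ∧ F ≤ σ.1 := fun F => h.mem_faces_iff σ.2
  have hb := hF.bijOn_link hτF
  have hbot : (⊥ : PointedCone ℝ _) ∈ link (FanEhrhart.faces σ.1) τ.1 := by
    rw [← quotCone_self]
    exact hb.mapsTo ⟨hτF, le_rfl⟩
  have hdim : fanDim (link (FanEhrhart.faces σ.1) τ.1) = coneDim σ.1 - coneDim τ.1 :=
    hF.fanDim_link (fun F hF => coneDim_mono (IsFace.le hF)) hτF (self_mem_faces σ.1) hle' rfl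
  rw [toricGDual, dif_pos hbot, hdim]
  have hsurj : ∀ γ, γ ∈ link (FanEhrhart.faces σ.1) τ.1 → ∃ F,
      (F ∈ FanEhrhart.faces σ.1 ∧ τ.1 ≤ F) ∧ quotCone τ.1 F = γ := fun γ hγ => hb.surjOn hγ
  choose! g hg hgq using hsurj
  replace hg := fun {a} => hg a
  replace hgq := fun {a} => hgq a
  have hle_iff : ∀ a ∈ link (FanEhrhart.faces σ.1) τ.1,
      ∀ b ∈ link (FanEhrhart.faces σ.1) τ.1, (g a ≤ g b ↔ a ≤ b) := by
    intro a ha b hb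
    rw [← hF.quotCone_le_iff (hg ha).1 (hg hb).1 (hg ha).2 (hg hb).2, hgq ha, hgq hb]
  let f : (link (FanEhrhart.faces σ.1) τ.1)ᵒᵈ ↪o (Set.Iic σ)ᵒᵈ :=
    OrderEmbedding.ofMapLEIff (fun a => OrderDual.toDual
      ⟨⟨g (OrderDual.ofDual a).1, ((hmem _).1 (hg (OrderDual.ofDual a).2).1).1⟩,
        ((hmem _).1 (hg (OrderDual.ofDual a).2).1).2⟩)
      fun a b => hle_iff _ (OrderDual.ofDual b).2 _ (OrderDual.ofDual a).2
  have hgF : ∀ F : PointedCone ℝ V, F ∈ FanEhrhart.faces σ.1 → τ.1 ≤ F →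
      g (quotCone τ.1 F) = F :=
    fun F hF h1 => hb.injOn (hg (hb.mapsTo ⟨hF, h1⟩)) ⟨hF, h1⟩ (hgq (hb.mapsTo ⟨hF, h1⟩))
  have hlow : IsLowerSet (Set.range f) := by
    rintro _ b hba ⟨a, rfl⟩
    have h1 : τ.1 ≤ (OrderDual.ofDual b).1.1 :=
      le_trans (hg (OrderDual.ofDual a).2).2
        (show g (OrderDual.ofDual a).1 ≤ (OrderDual.ofDual b).1.1 from hba)
    have h2 : (OrderDual.ofDual b).1.1 ∈ FanEhrhart.faces σ.1 :=
      (hmem _).2 ⟨(OrderDual.ofDual b).1.2, (OrderDual.ofDual b).2⟩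
    exact ⟨OrderDual.toDual ⟨quotCone τ.1 (OrderDual.ofDual b).1.1, hb.mapsTo ⟨h2, h1⟩⟩,
      Subtype.ext (Subtype.ext (hgF _ h2 h1))⟩
  have hmono : StrictMono (fun z : (Set.Iic σ)ᵒᵈ =>
      coneDim σ.1 - coneDim (OrderDual.ofDual z).1.1) := by
    intro a b hab
    have h1 := h.isEulerian.strictMono
      (show (OrderDual.ofDual b).1 < (OrderDual.ofDual a).1 from hab)
    have h2 := h.isEulerian.strictMono.monotone
      (show (OrderDual.ofDual a).1 ≤ σ from (OrderDual.ofDual a).2)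
    simp only at h1 h2 ⊢
    omega
  have hfin' : Finite (link (FanEhrhart.faces σ.1) τ.1)ᵒᵈ := Finite.of_injective f f.injective
  have := Fintype.ofFinite (Set.Iic σ)ᵒᵈ
  have key := toricGPoset_comp f hlow hmono (OrderDual.toDual ⟨⊥, hbot⟩)
  have hle2 : τ ∈ Set.Iic σ := hle
  rw [show intervalGDual (fun σ : Δ => coneDim σ.1) τ σ = _ from
    intervalGDual_apply (fun σ : Δ => coneDim σ.1) (⟨τ, hle2⟩ : Set.Iic σ)]
  refine Eq.trans ?_ (key.trans (congrArg _ ?_))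
  · refine congrArg (fun ρ => toricGPoset ρ _) (funext fun a => ?_)
    obtain ⟨a, rfl⟩ := OrderDual.toDual.surjective a
    change coneDim σ.1 - coneDim τ.1 - coneDim a.1 = coneDim σ.1 - coneDim (g a.1)
    have h1 := coneDim_quotCone (hg a.2).2
    rw [hgq a.2] at h1
    have h2 := coneDim_mono (hg a.2).2
    omega
  · refine Subtype.ext (Subtype.ext ?_)
    change g ⊥ = τ.1
    rw [← quotCone_self, hgF _ hτF le_rfl]

/-- The defining equation of the toric `h`-polynomial of a link, as a sum over the cones of the
fan. -/
theorem IsFan.toricH_link_eq (h : IsFan Δ) [Fintype Δ] {d : ℕ} (hfd : ∀ σ ∈ Δ, coneDim σ ≤ d)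
    (σ : Δ) (hσ : ∃ τ ∈ Δ, σ.1 ≤ τ ∧ coneDim τ = d) {p : ℤ[X]}
    (hp : IsReversal (d - coneDim σ.1) p (∑ τ : Δ, intervalG (fun σ : Δ => coneDim σ.1) σ τ *
      (X - 1) ^ (d - coneDim τ.1))) : toricH (link Δ σ.1) = p := by
  obtain ⟨τ, hτ, hle, hτd⟩ := hσ
  have hsum : ∑ᶠ γ ∈ link Δ σ.1, toricG γ * (X - 1) ^ (fanDim (link Δ σ.1) - coneDim γ) =
      ∑ τ : Δ, intervalG (fun σ : Δ => coneDim σ.1) σ τ * (X - 1) ^ (d - coneDim τ.1) := by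
    rw [h.fanDim_link hfd σ.2 hτ hle hτd, ← finsum_mem_eq_of_bijOn _ (h.bijOn_link σ.2)
      (fun F hF => rfl), finsum_mem_eq_finite_toFinset_sum _
        (h.finite.subset fun F hF => hF.1)]
    refine Finset.sum_bij_ne_zero (fun F hF _ => ⟨F, ((Set.Finite.mem_toFinset _).1 hF).1⟩)
      (fun _ _ _ => Finset.mem_univ _) (fun _ _ _ _ _ _ he => congrArg Subtype.val he) ?_ ?_
    · intro F _ hF
      have hσF : σ ≤ F := by
        by_contra hn
        rw [isIncidence_intervalG _ σ F hn, zero_mul] at hF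
        exact hF rfl
      refine ⟨F.1, (Set.Finite.mem_toFinset _).2 ⟨F.2, hσF⟩, ?_, rfl⟩
      rw [h.toricG_quotCone σ F hσF, coneDim_quotCone hσF,
        Nat.sub_sub_sub_cancel_right (coneDim_mono hσF)]
      exact hF
    · intro F hF _
      have hF := (Set.Finite.mem_toFinset _).1 hF
      rw [← h.toricG_quotCone σ ⟨F, hF.1⟩ hF.2, coneDim_quotCone hF.2,
        Nat.sub_sub_sub_cancel_right (coneDim_mono hF.2)]
  rw [← hsum, ← h.fanDim_link hfd σ.2 hτ hle hτd] at hp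
  exact ((thePoly_spec (Q := fun p => IsReversal (fanDim (link Δ σ.1)) p
    (∑ᶠ γ ∈ link Δ σ.1, toricG γ * (X - 1) ^ (fanDim (link Δ σ.1) - coneDim γ)))
      ⟨p, hp⟩).symm.unique hp.symm)

end Fans

/-! ### Counting series -/

section CountSeries

variable {α β : Type*}

/-- The generating function of the elements of `S` by degree. Infinite fibres are counted as `0`,
because of the convention for `Set.ncard`; see `HasFiniteFibers`. -/
def countSeries (deg : α → ℕ) (S : Set α) : PowerSeries ℤ :=
  PowerSeries.mk fun n => ((S ∩ {x | deg x = n}).ncard : ℤ)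

/-- The fibres of the degree on `S` are finite. -/
def HasFiniteFibers (deg : α → ℕ) (S : Set α) : Prop :=
  ∀ n, (S ∩ {x | deg x = n}).Finite

theorem HasFiniteFibers.mono {deg : α → ℕ} {S T : Set α} (h : HasFiniteFibers deg T)
    (hST : S ⊆ T) : HasFiniteFibers deg S :=
  fun n => (h n).subset (Set.inter_subset_inter_left _ hST)

@[simp] theorem countSeries_empty (deg : α → ℕ) : countSeries deg ∅ = 0 := by
  ext n
  simp [countSeries]

theorem countSeries_eq_sum {ι : Type*} {deg : α → ℕ} {S : Set α} (h : HasFiniteFibers deg S)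
    (s : Finset ι) (c : α → ι) (hc : ∀ x ∈ S, c x ∈ s) :
    countSeries deg S = ∑ i ∈ s, countSeries deg (S ∩ {x | c x = i}) := by
  classical
  ext n
  rw [map_sum]
  simp only [countSeries, PowerSeries.coeff_mk]
  rw [← Nat.cast_sum, Nat.cast_inj]
  have hfin : ∀ i, (S ∩ {x | c x = i} ∩ {x | deg x = n}).Finite := fun i =>
    (h n).subset fun x hx => ⟨hx.1.1, hx.2⟩
  rw [Set.ncard_eq_toFinset_card _ (h n), Finset.card_eq_sum_card_fiberwise (f := c) (t := s)]
  · refine Finset.sum_congr rfl fun i _ => ?_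
    rw [Set.ncard_eq_toFinset_card _ (hfin i)]
    congr 1
    ext x
    simp only [Finset.mem_filter, Set.Finite.mem_toFinset, Set.mem_inter_iff, Set.mem_ofPred_eq]
    tauto
  · intro x hx
    exact hc x ((Set.Finite.mem_toFinset _).1 hx).1

theorem countSeries_image {deg : α → ℕ} {deg' : β → ℕ} {S : Set α} {f : α → β}
    (hf : Set.InjOn f S) (c : ℕ) (hdeg : ∀ x ∈ S, deg' (f x) = deg x + c) :
    countSeries deg' (f '' S) = PowerSeries.X ^ c * countSeries deg S := by
  ext n
  rw [PowerSeries.coeff_X_pow_mul']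
  simp only [countSeries, PowerSeries.coeff_mk]
  split_ifs with hn
  · rw [Nat.cast_inj, ← (hf.mono Set.inter_subset_left).ncard_image]
    congr 1
    ext y
    constructor
    · rintro ⟨⟨x, hx, rfl⟩, hy⟩
      have hy : deg' (f x) = n := hy
      refine ⟨x, ⟨hx, ?_⟩, rfl⟩
      rw [hdeg x hx] at hy
      exact Nat.eq_sub_of_add_eq hy
    · rintro ⟨x, ⟨hx, hd⟩, rfl⟩
      have hd : deg x = n - c := hd
      refine ⟨⟨x, hx, rfl⟩, ?_⟩
      change deg' (f x) = n
      rw [hdeg x hx]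
      omega
  · rw [Nat.cast_eq_zero, Set.eq_empty_of_forall_notMem (s := f '' S ∩ {x | deg' x = n})]
    · exact Set.ncard_empty β
    · rintro _ ⟨⟨x, hx, rfl⟩, hy⟩
      have hy : deg' (f x) = n := hy
      rw [hdeg x hx] at hy
      omega

/-- The power series that are polynomials. -/
def polynomialSeries : Subring (PowerSeries ℤ) :=
  (Polynomial.coeToPowerSeries.ringHom (R := ℤ)).range

theorem mem_polynomialSeries {f : PowerSeries ℤ} :
    f ∈ polynomialSeries ↔ ∃ p : ℤ[X], (p : PowerSeries ℤ) = f := Iff.rfl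

theorem X_mem_polynomialSeries : (PowerSeries.X : PowerSeries ℤ) ∈ polynomialSeries :=
  mem_polynomialSeries.2 ⟨X, Polynomial.coe_X⟩

theorem one_sub_X_mem_polynomialSeries : (1 - PowerSeries.X : PowerSeries ℤ) ∈ polynomialSeries :=
  sub_mem (one_mem _) X_mem_polynomialSeries

end CountSeries

/-! ### Hilbert series of monomial quotients -/

section LowerSets

theorem hasFiniteFibers_sum {k : ℕ} (S : Set (Fin k → ℕ)) :
    HasFiniteFibers (fun a => ∑ i, a i) S := by
  refine HasFiniteFibers.mono (T := Set.univ) (fun n => ?_) (Set.subset_univ S)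
  refine (Set.finite_Iic (fun _ : Fin k => n)).subset fun a ha i => ?_
  have ha : ∑ i, a i = n := ha.2
  rw [← ha]
  exact Finset.single_le_sum (f := a) (fun _ _ => Nat.zero_le _) (Finset.mem_univ i)

/-- A decreasing sequence of lower sets of a well-quasi-order, such as `ℕ ^ k`, is eventually
constant. -/
theorem exists_forall_ge_eq_of_isLowerSet {α : Type*} [PartialOrder α] [WellQuasiOrderedLE α]
    (S : ℕ → Set α) (hS : ∀ n, IsLowerSet (S n)) (hanti : Antitone S) :
    ∃ N, ∀ n, N ≤ n → S n = S N := by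
  -- the minimal elements of the complement of the intersection are finitely many
  set U : Set α := {a | ∃ n, a ∉ S n}
  set M : Set α := {a | Minimal (· ∈ U) a}
  have hM : M.Finite := by
    refine WellQuasiOrderedLE.finite_of_isAntichain fun a ha b hb hne hle => hne ?_
    exact le_antisymm hle (hb.2 ha.1 hle)
  have hn : ∀ a ∈ M, ∃ n, a ∉ S n := fun a ha => ha.1
  choose! n hn using hn
  obtain ⟨N, hN⟩ := (hM.image n).bddAbove
  refine ⟨N, fun m hm => le_antisymm (hanti hm) fun a ha => ?_⟩
  by_contra hc
  obtain ⟨b, hba, hb⟩ := exists_minimal_le_of_wellFoundedLT (· ∈ U) a ⟨m, hc⟩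
  exact hn b hb (hanti (hN ⟨b, hb, rfl⟩) (hS N hba ha))

/-- A lower set of `ℕ ^ k` that contains no coordinate cone of dimension more than `r` has a
generating function with denominator `(1 - t) ^ r`. -/
theorem countSeries_lowerSet_mul_mem {k : ℕ} (S : Set (Fin k → ℕ)) (hS : IsLowerSet S) (r : ℕ)
    (hr : ∀ I : Finset (Fin k), (∀ a : Fin k → ℕ, (∀ i ∉ I, a i = 0) → a ∈ S) → I.card ≤ r) :
    countSeries (fun a => ∑ i, a i) S * (1 - PowerSeries.X) ^ r ∈ polynomialSeries := by
  classical
  induction k generalizing r with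
  | zero =>
    refine mul_mem ?_ (pow_mem one_sub_X_mem_polynomialSeries r)
    rcases S.eq_empty_or_nonempty with rfl | ⟨a, ha⟩
    · rw [countSeries_empty]
      exact zero_mem _
    · have : countSeries (fun a : Fin 0 → ℕ => ∑ i, a i) S = 1 := by
        ext n
        rw [countSeries, PowerSeries.coeff_mk, PowerSeries.coeff_one]
        split_ifs with hn
        · have : S ∩ {x | ∑ i, x i = n} = {a} := by
            ext b
            rw [Subsingleton.elim b a]
            simp [ha, hn]
          rw [this, Set.ncard_singleton, Nat.cast_one]
        · have : S ∩ {x | ∑ i, x i = n} = ∅ :=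
            Set.eq_empty_of_forall_notMem fun b hb => hn (by simpa using hb.2.symm)
          rw [this, Set.ncard_empty, Nat.cast_zero]
      rw [this]
      exact one_mem _
  | succ k ih =>
    set slice : ℕ → Set (Fin k → ℕ) := fun n => {a | Fin.cons n a ∈ S} with hslice
    have hlow : ∀ n, IsLowerSet (slice n) := fun n a b hba ha =>
      hS (Fin.cons_le_cons.2 ⟨le_rfl, hba⟩) ha
    have hanti : Antitone slice := fun m n hmn a ha =>
      hS (Fin.cons_le_cons.2 ⟨hmn, le_rfl⟩) ha
    have hsum : ∀ n (a : Fin k → ℕ),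
        ∑ i, (Fin.cons n a : Fin (k + 1) → ℕ) i = ∑ i, a i + n := fun n a => by
      rw [Fin.sum_univ_succ, Fin.cons_zero, add_comm]
      simp
    have himage : ∀ n, S ∩ {a | a 0 = n} =
        (fun a => (Fin.cons n a : Fin (k + 1) → ℕ)) '' slice n := by
      intro n
      ext a
      constructor
      · rintro ⟨ha, rfl⟩
        refine ⟨Fin.tail a, ?_, Fin.cons_self_tail a⟩
        change Fin.cons (a 0) (Fin.tail a) ∈ S
        rwa [Fin.cons_self_tail]
      · rintro ⟨b, hb, rfl⟩
        exact ⟨hb, Fin.cons_zero _ _⟩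
    have hcs : ∀ n, countSeries (fun a => ∑ i, a i) (S ∩ {a | a 0 = n}) =
        PowerSeries.X ^ n * countSeries (fun a => ∑ i, a i) (slice n) := fun n => by
      rw [himage]
      exact countSeries_image (f := fun a => (Fin.cons n a : Fin (k + 1) → ℕ))
        (fun a _ b _ h => Fin.cons_right_injective (α := fun _ => ℕ) n h) n fun a _ => hsum n a
    have hcone : ∀ n (I : Finset (Fin k)), (∀ a : Fin k → ℕ, (∀ i ∉ I, a i = 0) → a ∈ slice n) →
        I.card ≤ r := by
      intro n I hI
      rw [← Finset.card_map (Fin.succEmb k)]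
      refine hr _ fun a ha => ?_
      have h0 : a 0 = 0 := ha 0 (by simp)
      have := hI (Fin.tail a) fun i hi => ha i.succ (by simpa using hi)
      have h1 := hanti (Nat.zero_le n) this
      have h2 : Fin.cons 0 (Fin.tail a) ∈ S := h1
      rwa [← h0, Fin.cons_self_tail] at h2
    -- the slices are constant from `N` on, so that `S` consists of `N` slices and a half-infinite
    -- cylinder `T` over the `N`-th one
    obtain ⟨N, hN⟩ := exists_forall_ge_eq_of_isLowerSet slice hlow hanti
    rw [countSeries_eq_sum (hasFiniteFibers_sum S) (Finset.range (N + 1)) (fun a => min (a 0) N)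
      (fun a _ => Finset.mem_range.2 (by omega)), Finset.sum_mul, Finset.sum_range_succ]
    refine add_mem (sum_mem fun n hn => ?_) ?_
    · have : S ∩ {a | min (a 0) N = n} = S ∩ {a | a 0 = n} := by
        ext a
        have := Finset.mem_range.1 hn
        simp only [Set.mem_inter_iff, Set.mem_ofPred_eq]
        constructor <;> rintro ⟨h1, h2⟩ <;> exact ⟨h1, by omega⟩
      rw [this, hcs, mul_assoc]
      exact mul_mem (pow_mem X_mem_polynomialSeries n) (ih _ (hlow n) r (hcone n))
    · set T : Set (Fin (k + 1) → ℕ) := S ∩ {a | min (a 0) N = N} with hT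
      have hmemT : ∀ a, a ∈ T ↔ N ≤ a 0 ∧ Fin.tail a ∈ slice N := by
        intro a
        have h1 : a ∈ S ↔ Fin.tail a ∈ slice (a 0) := by
          change _ ↔ Fin.cons (a 0) (Fin.tail a) ∈ S
          rw [Fin.cons_self_tail]
        rw [hT, Set.mem_inter_iff, h1]
        simp only [Set.mem_ofPred_eq, min_eq_right_iff]
        constructor
        · rintro ⟨h2, h3⟩
          exact ⟨h3, hN _ h3 ▸ h2⟩
        · rintro ⟨h3, h2⟩
          exact ⟨(hN _ h3).symm ▸ h2, h3⟩
      rcases (slice N).eq_empty_or_nonempty with hemp | ⟨a₀, ha₀⟩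
      · have : T = ∅ := Set.eq_empty_of_forall_notMem fun a ha => by
          have := ((hmemT a).1 ha).2
          rw [hemp] at this
          exact this
        rw [this, countSeries_empty, zero_mul]
        exact zero_mem _
      have hcone' : ∀ I : Finset (Fin k), (∀ a : Fin k → ℕ, (∀ i ∉ I, a i = 0) → a ∈ slice N) →
          I.card + 1 ≤ r := by
        intro I hI
        have : (insert 0 (I.map (Fin.succEmb k))).card = I.card + 1 := by
          rw [Finset.card_insert_of_notMem (by simp), Finset.card_map]
        rw [← this]
        refine hr _ fun a ha => ?_
        have h1 := hI (Fin.tail a) fun i hi => ha i.succ (by simpa using hi)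
        have h2 : Fin.tail a ∈ slice (a 0) := by
          rcases le_total N (a 0) with h | h
          · rwa [hN _ h]
          · exact hanti h h1
        have h3 : Fin.cons (a 0) (Fin.tail a) ∈ S := h2
        rwa [Fin.cons_self_tail] at h3
      obtain ⟨r, rfl⟩ : ∃ r', r = r' + 1 := by
        have := hcone' ∅ fun a ha => hlow N (fun i => by rw [ha i (by simp)]; exact Nat.zero_le _) ha₀
        exact ⟨r - 1, by omega⟩
      -- `T` is the disjoint union of its bottom layer and its translate
      have hTrec : countSeries (fun a => ∑ i, a i) T * (1 - PowerSeries.X) =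
          PowerSeries.X ^ N * countSeries (fun a => ∑ i, a i) (slice N) := by
        have h1 := countSeries_eq_sum (hasFiniteFibers_sum T) Finset.univ
          (fun a => decide (a 0 = N)) (fun _ _ => Finset.mem_univ _)
        rw [Fintype.sum_bool] at h1
        have h2 : T ∩ {a | decide (a 0 = N) = true} = S ∩ {a | a 0 = N} := by
          ext a
          simp only [hT, Set.mem_inter_iff, Set.mem_ofPred_eq, decide_eq_true_eq]
          constructor
          · rintro ⟨⟨h1, -⟩, h2⟩
            exact ⟨h1, h2⟩
          · rintro ⟨h1, h2⟩
            exact ⟨⟨h1, by omega⟩, h2⟩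
        have h3 : T ∩ {a | decide (a 0 = N) = false} =
            (fun a => (Fin.cons (a 0 + 1) (Fin.tail a) : Fin (k + 1) → ℕ)) '' T := by
          ext a
          simp only [Set.mem_inter_iff, Set.mem_ofPred_eq, decide_eq_false_iff_not]
          constructor
          · rintro ⟨h1, h2⟩
            obtain ⟨h4, h5⟩ := (hmemT a).1 h1
            refine ⟨Fin.cons (a 0 - 1) (Fin.tail a), (hmemT _).2 ⟨?_, ?_⟩, ?_⟩
            · rw [Fin.cons_zero]; omega
            · rwa [Fin.tail_cons]
            · simp only [Fin.cons_zero, Fin.tail_cons]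
              rw [Nat.sub_add_cancel (by omega), Fin.cons_self_tail]
          · rintro ⟨b, hb, rfl⟩
            obtain ⟨h4, h5⟩ := (hmemT b).1 hb
            refine ⟨(hmemT _).2 ⟨?_, ?_⟩, ?_⟩
            · simp only [Fin.cons_zero]; omega
            · simpa only [Fin.tail_cons]
            · simp only [Fin.cons_zero]; omega
        rw [h2, hcs, h3, countSeries_image (deg := fun a => ∑ i, a i) _ 1] at h1
        · linear_combination h1
        · intro a _
          rw [hsum, Fin.sum_univ_succ a]
          change ∑ i : Fin k, a i.succ + (a 0 + 1) = _
          ring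
        · intro a _ b _ hab
          have h4 := congrFun hab 0
          simp only [Fin.cons_zero, add_left_inj] at h4
          have h5 := congrArg Fin.tail hab
          simp only [Fin.tail_cons] at h5
          rw [← Fin.cons_self_tail a, ← Fin.cons_self_tail b, h4, h5]
      rw [pow_succ, mul_comm (_ ^ r), ← mul_assoc, hTrec, mul_assoc]
      exact mul_mem (pow_mem X_mem_polynomialSeries N)
        (ih _ (hlow N) r fun I hI => Nat.le_of_succ_le_succ (hcone' I hI))

end LowerSets

/-! ### Finitely generated lattice modules -/

section LatticeModules

variable {d : ℕ}

theorem latticePoint_add (m n : Fin d → ℤ) :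
    latticePoint (m + n) = latticePoint m + latticePoint n := by
  ext i
  simp [latticePoint]

theorem latticePoint_nsmul (c : ℕ) (m : Fin d → ℤ) :
    latticePoint (c • m) = (c : ℝ) • latticePoint m := by
  ext i
  simp [latticePoint]

theorem latticePoint_sum {ι : Type*} (s : Finset ι) (f : ι → Fin d → ℤ) :
    latticePoint (∑ i ∈ s, f i) = ∑ i ∈ s, latticePoint (f i) := by
  ext i
  simp [latticePoint]

theorem latticePoint_injective : Function.Injective (latticePoint (d := d)) := fun m n h => by
  ext i
  have := congrFun h i
  simpa [latticePoint] using this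

theorem linearIndependent_latticePoint {ι : Type*} {v : ι → Fin d → ℤ}
    (hv : LinearIndependent ℤ v) : LinearIndependent ℝ fun i => latticePoint (v i) := by
  have h := Module.Flat.linearIndependent_one_tmul (S := ℝ) hv
  have h' := h.map' (TensorProduct.piScalarRight ℤ ℝ ℝ (Fin d)).toLinearMap
    (LinearEquiv.ker _)
  convert! h' using 1
  ext i j
  simp [latticePoint]

/-- Linear independence of integer vectors can be tested on combinations with natural
coefficients. -/
theorem linearIndependent_int_of_nat {ι : Type*} [Fintype ι] {v : ι → Fin d → ℤ}
    (h : ∀ a b : ι → ℕ, ∑ i, a i • v i = ∑ i, b i • v i → a = b) : LinearIndependent ℤ v := by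
  rw [Fintype.linearIndependent_iff]
  intro g hg
  have := h (fun i => (g i).toNat) (fun i => (-g i).toNat) (by
    rw [← sub_eq_zero, ← Finset.sum_sub_distrib, ← hg]
    refine Finset.sum_congr rfl fun i _ => ?_
    rw [← natCast_zsmul, ← natCast_zsmul, ← sub_smul]
    congr 1
    omega)
  intro i
  have : (g i).toNat = (-g i).toNat := congrFun this i
  omega

/-- The Hilbert series of a finitely generated graded module of lattice points has denominator
`(1 - t) ^ r`, where `r` is the dimension of the span of the generators `v` of degree one. Each
point is represented by its least expression `b i + ∑ a j • v j`, for the lexicographic order on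
the pairs `(i, a)`. The least expressions with a given `i` form a lower set of `ℕ ^ k`, and if it
contains a coordinate cone, then the corresponding vectors `v j` are linearly independent. -/
theorem countSeries_lattice_mul_mem {k l : ℕ} (v : Fin k → Fin d → ℤ) (b : Fin l → Fin d → ℤ)
    (M : Set (Fin d → ℤ)) (hM : ∀ m, m ∈ M ↔ ∃ i, ∃ a : Fin k → ℕ, b i + ∑ j, a j • v j = m)
    (deg : (Fin d → ℤ) → ℕ)
    (hdeg : ∀ i (a : Fin k → ℕ), deg (b i + ∑ j, a j • v j) = deg (b i) + ∑ j, a j)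
    (W : Submodule ℝ (Fin d → ℝ)) (hW : ∀ j, latticePoint (v j) ∈ W) :
    HasFiniteFibers deg M ∧
      countSeries deg M * (1 - PowerSeries.X) ^ Module.finrank ℝ W ∈ polynomialSeries := by
  classical
  have hfib : HasFiniteFibers deg M := by
    intro n
    refine ((Set.finite_univ (α := Fin l)).prod
      (Set.finite_Iic (fun _ : Fin k => n))).image (fun p => b p.1 + ∑ j, p.2 j • v j)
        |>.subset ?_
    rintro m ⟨hm, hn⟩
    obtain ⟨i, a, rfl⟩ := (hM m).1 hm
    have hn : deg _ = n := hn
    rw [hdeg] at hn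
    refine ⟨(i, a), ⟨Set.mem_univ _, fun j => ?_⟩, rfl⟩
    have := Finset.single_le_sum (f := a) (fun _ _ => Nat.zero_le _) (Finset.mem_univ j)
    simp only
    omega
  refine ⟨hfib, ?_⟩
  rcases M.eq_empty_or_nonempty with rfl | ⟨m₀, hm₀⟩
  · rw [countSeries_empty, zero_mul]
    exact zero_mem _
  let φ : Fin l ×ₗ Lex (Fin k → ℕ) → Fin d → ℤ :=
    fun p => b (ofLex p).1 + ∑ j, ofLex (ofLex p).2 j • v j
  have hφ : ∀ i (a : Fin k → ℕ), φ (toLex (i, toLex a)) = b i + ∑ j, a j • v j := fun _ _ => rfl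
  have hφM : ∀ p, φ p ∈ M := fun p => (hM _).2 ⟨(ofLex p).1, ofLex (ofLex p).2, rfl⟩
  have hrep : ∀ m ∈ M, ∃ p, Minimal (fun p => φ p = m) p := fun m hm => by
    obtain ⟨i, a, h⟩ := (hM m).1 hm
    exact exists_minimal_of_wellFoundedLT _ ⟨toLex (i, toLex a), h⟩
  have : Nonempty (Fin l ×ₗ Lex (Fin k → ℕ)) := (hrep m₀ hm₀).nonempty
  choose! rep hrep using hrep
  have hrep_eq : ∀ p, (∀ q, φ q = φ p → p ≤ q) → rep (φ p) = p := fun p hp => by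
    have h1 := hrep _ (hφM p)
    exact le_antisymm (le_of_not_gt fun hlt => hlt.not_ge (h1.le_of_le rfl hlt.le)) (hp _ h1.prop)
  have hrep_le : ∀ p q, φ q = φ p → rep (φ p) ≤ q := fun p q hq =>
    le_of_not_gt fun hlt => hlt.not_ge ((hrep _ (hφM p)).le_of_le hq hlt.le)
  set S : Fin l → Set (Fin k → ℕ) := fun i => {a | rep (φ (toLex (i, toLex a))) = toLex (i, toLex a)}
    with hS
  have hadd : ∀ i (a c : Fin k → ℕ), φ (toLex (i, toLex (a + c))) =
      φ (toLex (i, toLex a)) + ∑ j, c j • v j := fun i a c => by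
    rw [hφ, hφ, add_assoc, ← Finset.sum_add_distrib]
    simp [add_smul]
  have hlow : ∀ i, IsLowerSet (S i) := by
    intro i a' a haa ha
    obtain ⟨c, rfl⟩ := exists_add_of_le haa
    have ha : rep (φ (toLex (i, toLex (a + c)))) = toLex (i, toLex (a + c)) := ha
    refine hrep_eq _ fun q hq => le_of_not_gt fun hlt => ?_
    -- translating a smaller expression for the first point gives one for the second
    have h1 := hrep_le (toLex (i, toLex (a + c)))
      (toLex ((ofLex q).1, toLex (ofLex (ofLex q).2 + c))) (by
        rw [hadd, hadd, ← hq]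
        rfl)
    rw [ha] at h1
    refine h1.not_gt ?_
    rw [Prod.Lex.toLex_lt_toLex]
    have h2 : toLex ((ofLex q).1, (ofLex q).2) < toLex (i, toLex a) := hlt
    rw [Prod.Lex.toLex_lt_toLex] at h2
    refine h2.imp id fun h2 => ⟨h2.1, ?_⟩
    change (ofLex q).2 + toLex c < toLex a + toLex c
    exact add_lt_add_left h2.2 _
  have hcard : ∀ i (I : Finset (Fin k)),
      (∀ a : Fin k → ℕ, (∀ j ∉ I, a j = 0) → a ∈ S i) → I.card ≤ Module.finrank ℝ W := by
    intro i I hI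
    have hlin : LinearIndependent ℤ fun j : I => v j := by
      refine linearIndependent_int_of_nat fun a a' haa => ?_
      let ext : (I → ℕ) → Fin k → ℕ := fun a j => if h : j ∈ I then a ⟨j, h⟩ else 0
      have hmem : ∀ a, ext a ∈ S i := fun a => hI _ fun j hj => dif_neg hj
      have hext : ∀ a : I → ℕ, ∑ j, ext a j • v j = ∑ j : I, a j • v j := by
        intro a
        rw [← Finset.sum_subset (Finset.subset_univ I) fun j _ hj => by simp [ext, hj],
          ← Finset.sum_coe_sort]
        refine Finset.sum_congr rfl fun j _ => ?_
        simp [ext]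
      have h1 : rep (φ (toLex (i, toLex (ext a)))) = toLex (i, toLex (ext a)) := hmem a
      have h2 : rep (φ (toLex (i, toLex (ext a')))) = toLex (i, toLex (ext a')) := hmem a'
      rw [hφ, hext, haa, ← hext, ← hφ, h2] at h1
      have h3 : ext a' = ext a := congrArg (fun p : Fin l ×ₗ Lex (Fin k → ℕ) => ofLex (ofLex p).2) h1
      ext j
      have := congrFun h3 j
      simpa [ext] using this.symm
    have h1 := linearIndependent_latticePoint hlin
    have h2 : LinearIndependent ℝ fun j : I => (⟨latticePoint (v j), hW j⟩ : W) :=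
      LinearIndependent.of_comp W.subtype h1
    have := h2.fintype_card_le_finrank
    rwa [Fintype.card_coe] at this
  rw [countSeries_eq_sum hfib Finset.univ (fun m => (ofLex (rep m)).1)
    fun _ _ => Finset.mem_univ _, Finset.sum_mul]
  refine sum_mem fun i _ => ?_
  have himage : M ∩ {m | (ofLex (rep m)).1 = i} = (fun a => φ (toLex (i, toLex a))) '' S i := by
    ext m
    constructor
    · rintro ⟨hm, rfl⟩
      have h1 : φ (rep m) = m := (hrep m hm).prop
      refine ⟨ofLex (ofLex (rep m)).2, ?_, h1⟩
      change rep (φ (rep m)) = rep m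
      rw [h1]
    · rintro ⟨a, ha, rfl⟩
      have ha : rep (φ (toLex (i, toLex a))) = toLex (i, toLex a) := ha
      refine ⟨hφM _, ?_⟩
      change (ofLex (rep (φ (toLex (i, toLex a))))).1 = i
      rw [ha]
      rfl
  rw [himage, countSeries_image (deg := fun a => ∑ j, a j) (S := S i) _ (deg (b i)), mul_assoc]
  · exact mul_mem (pow_mem X_mem_polynomialSeries _)
      (countSeries_lowerSet_mul_mem (S i) (hlow i) _ (hcard i))
  · intro a _
    rw [hφ, hdeg, add_comm]
  · intro a ha a' ha' haa
    have ha : rep (φ (toLex (i, toLex a))) = toLex (i, toLex a) := ha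
    have ha' : rep (φ (toLex (i, toLex a'))) = toLex (i, toLex a') := ha'
    have haa : φ (toLex (i, toLex a)) = φ (toLex (i, toLex a')) := haa
    rw [haa, ha'] at ha
    exact congrArg (fun p : Fin l ×ₗ Lex (Fin k → ℕ) => ofLex (ofLex p).2) ha.symm

end LatticeModules

/-! ### Rays of pointed cones -/

section Rays

theorem coneDim_hull_singleton {V : Type*} [AddCommGroup V] [Module ℝ V] {q : V} (hq : q ≠ 0) :
    coneDim (PointedCone.hull ℝ {q}) = 1 := by
  rw [coneDim, Submodule.span_span_of_tower, finrank_span_singleton hq]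

theorem mem_hull_singleton {V : Type*} [AddCommGroup V] [Module ℝ V] {q x : V} :
    x ∈ PointedCone.hull ℝ {q} ↔ ∃ c : ℝ, 0 ≤ c ∧ c • q = x := by
  rw [Submodule.mem_span_singleton]
  exact ⟨fun ⟨c, h⟩ => ⟨c.1, c.2, h⟩, fun ⟨c, hc, h⟩ => ⟨⟨c, hc⟩, h⟩⟩

/-- Each vector of a minimal generating set of a pointed cone spans a ray. -/
theorem exists_finset_rays {V : Type*} [AddCommGroup V] [Module ℝ V] [FiniteDimensional ℝ V]
    {σ : PointedCone ℝ V} (hpt : ∀ x ∈ σ, -x ∈ σ → x = 0) (s : Finset V)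
    (hs : PointedCone.hull ℝ (s : Set V) = σ) :
    ∃ t ⊆ s, PointedCone.hull ℝ (t : Set V) = σ ∧
      ∀ q ∈ t, q ≠ 0 ∧ IsFace (PointedCone.hull ℝ {q}) σ := by
  classical
  obtain ⟨t, ⟨hts, htσ⟩, hmin⟩ := exists_minimal_of_wellFoundedLT
    (fun t : Finset V => t ⊆ s ∧ PointedCone.hull ℝ (t : Set V) = σ) ⟨s, subset_rfl, hs⟩
  refine ⟨t, hts, htσ, fun q hq => ?_⟩
  obtain ⟨A, hA⟩ := exists_isCutOut (σ := σ) ⟨s, hs⟩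
  set τ := PointedCone.hull ℝ ((t.erase q : Finset V) : Set V) with hτ
  have hsup : σ = τ ⊔ PointedCone.hull ℝ {q} := by
    rw [← htσ, hτ, sup_comm, ← Submodule.span_insert, ← Finset.coe_insert, Finset.insert_erase hq]
  have hτσ : τ ≤ σ := hsup ▸ le_sup_left
  have hqσ : q ∈ σ := by
    rw [← htσ]
    exact Submodule.subset_span hq
  have hqτ : q ∉ τ := by
    intro h
    have h1 : τ = σ := by
      rw [hsup]
      exact (sup_eq_left.2 (Submodule.span_le.2 (Set.singleton_subset_iff.2 h))).symm
    have h2 := hmin ⟨(Finset.erase_subset q t).trans hts, h1⟩ (Finset.erase_subset q t)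
    exact Finset.notMem_erase q t (h2 hq)
  have hq0 : q ≠ 0 := by
    rintro rfl
    exact hqτ (zero_mem _)
  refine ⟨hq0, ?_⟩
  obtain ⟨F, hF, hqF⟩ := hA.exists_face_mem_relInt hqσ
  suffices PointedCone.hull ℝ {q} = F by rwa [this]
  refine le_antisymm (Submodule.span_le.2 (Set.singleton_subset_iff.2 hqF.1)) fun x hx => ?_
  obtain ⟨p, hε, hmem⟩ : ∃ ε : ℝ, 0 < ε ∧ q - ε • x ∈ σ := by
    obtain ⟨ε, hε, h⟩ := (hA.isRelOpenCone_relInt hF).exists_sub_mem q hqF (q + x)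
      (hA.add_mem_relInt hF.le hqF hx)
    refine ⟨ε, hε, ?_⟩
    have h1 := add_mem (hF.le h.1) (σ.smul_mem hε.le hqσ)
    convert! h1 using 1
    module
  have hxσ := hF.le hx
  rw [hsup, mem_sup_hull_singleton] at hxσ hmem
  obtain ⟨c, hc, hy⟩ := hxσ
  obtain ⟨c', hc', hy'⟩ := hmem
  have hz : (1 - p * c - c') • q ∈ τ := by
    have := add_mem (τ.smul_mem hε.le hy) hy'
    convert! this using 1
    module
  rcases lt_trichotomy (1 - p * c - c') 0 with h | h | h
  · refine absurd (hpt q hqσ ?_) hq0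
    have := σ.smul_mem (inv_nonneg.2 (neg_nonneg.2 h.le)) (hτσ hz)
    convert! this using 1
    rw [smul_smul, ← neg_one_smul ℝ q]
    congr 1
    rw [inv_neg, neg_mul, inv_mul_cancel₀ h.ne]
  · have hneg : -(x - c • q) ∈ σ := by
      rw [← PointedCone.smul_mem_iff σ hε,
        show p • -(x - c • q) = (q - p • x - c' • q) - (1 - p * c - c') • q by module, h,
        zero_smul, sub_zero]
      exact hτσ hy'
    have := hpt _ (hτσ hy) hneg
    exact mem_hull_singleton.2 ⟨c, hc, (sub_eq_zero.1 this).symm⟩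
  · exact absurd ((τ.smul_mem_iff h).1 hz) hqτ

variable {d : ℕ}

/-- A ray through a rational vector contains a primitive generator. -/
theorem exists_isPrimitiveGenerator {σ : PointedCone ℝ (Fin d → ℝ)} (q : Fin d → ℚ)
    (hq : (fun i => (q i : ℝ)) ≠ 0)
    (hface : IsFace (PointedCone.hull ℝ {fun i => (q i : ℝ)}) σ) :
    ∃ m, IsPrimitiveGenerator σ m ∧
      (fun i => (q i : ℝ)) ∈ PointedCone.hull ℝ {latticePoint m} := by
  set q' : Fin d → ℝ := fun i => (q i : ℝ) with hq'
  set r := PointedCone.hull ℝ {q'} with hr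
  have hex : ∃ m : Fin d → ℤ, m ≠ 0 ∧ latticePoint m ∈ r := by
    set N : ℕ := ∏ i, (q i).den with hN
    have hN0 : 0 < N := Finset.prod_pos fun i _ => (q i).den_pos
    have hint : ∀ i, ∃ z : ℤ, (z : ℝ) = N * q' i := fun i => by
      obtain ⟨c, hc⟩ := Finset.dvd_prod_of_mem (fun i => (q i).den) (Finset.mem_univ i)
      refine ⟨c * (q i).num, ?_⟩
      have h1 : (q i : ℝ) * (q i).den = (q i).num := by
        exact_mod_cast Rat.mul_den_eq_num (q i)
      have h2 : (N : ℝ) = (q i).den * c := by exact_mod_cast hc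
      rw [h2, hq']
      push_cast
      rw [← h1]
      ring
    choose m hm using hint
    have hmq : latticePoint m = (N : ℝ) • q' := by
      ext i
      simp [latticePoint, hm]
    refine ⟨m, fun h0 => hq ?_, mem_hull_singleton.2 ⟨N, by positivity, hmq.symm⟩⟩
    have h3 : latticePoint m = 0 := by rw [h0]; ext; simp [latticePoint]
    rw [h3] at hmq
    exact (smul_eq_zero.1 hmq.symm).resolve_left (by positivity)
  obtain ⟨m, ⟨hm0, hmr⟩, hmin⟩ := exists_minimalFor_of_wellFoundedLT
    (fun m : Fin d → ℤ => m ≠ 0 ∧ latticePoint m ∈ r) (fun m => ∑ i, (m i).natAbs) hex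
  have hpos : ∀ m : Fin d → ℤ, m ≠ 0 → latticePoint m ∈ r →
      ∃ a : ℝ, 0 < a ∧ a • q' = latticePoint m := by
    intro m hm hmr
    obtain ⟨a, ha, h⟩ := mem_hull_singleton.1 hmr
    refine ⟨a, lt_of_le_of_ne ha ?_, h⟩
    rintro rfl
    refine hm (latticePoint_injective ?_)
    rw [← h, zero_smul]
    ext
    simp [latticePoint]
  obtain ⟨a, ha, hma⟩ := hpos m hm0 hmr
  have hqm : q' = a⁻¹ • latticePoint m := by
    rw [← hma, smul_smul, inv_mul_cancel₀ ha.ne', one_smul]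
  refine ⟨m, ⟨hm0, r, hface, coneDim_hull_singleton hq, hmr, fun m' hm' hmr' => ?_⟩,
    mem_hull_singleton.2 ⟨a⁻¹, by positivity, hqm.symm⟩⟩
  obtain ⟨a', ha', hma'⟩ := hpos m' hm' hmr'
  have hc : latticePoint m' = (a' / a) • latticePoint m := by
    rw [← hma, ← hma', smul_smul, div_mul_cancel₀ _ ha.ne']
  refine ⟨a' / a, ?_, hc⟩
  have hnorm : ((∑ i, (m' i).natAbs : ℕ) : ℝ) = a' / a * ((∑ i, (m i).natAbs : ℕ) : ℝ) := by
    push_cast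
    rw [Finset.mul_sum]
    refine Finset.sum_congr rfl fun i _ => ?_
    have := congrFun hc i
    simp only [latticePoint, Pi.smul_apply, smul_eq_mul] at this
    rw [Nat.cast_natAbs, Nat.cast_natAbs, Int.cast_abs, Int.cast_abs, this, abs_mul,
      abs_of_pos (by positivity)]
  have hmpos : 0 < ((∑ i, (m i).natAbs : ℕ) : ℝ) := by
    rw [Nat.cast_pos, Nat.pos_iff_ne_zero]
    intro h0
    refine hm0 (funext fun i => ?_)
    have := (Finset.sum_eq_zero_iff.1 h0) i (Finset.mem_univ i)
    simpa using this
  by_contra hlt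
  push Not at hlt
  have h4 : ((∑ i, (m' i).natAbs : ℕ) : ℝ) < ((∑ i, (m i).natAbs : ℕ) : ℝ) := by
    rw [hnorm]
    exact mul_lt_of_lt_one_left hmpos hlt
  have h5 := hmin ⟨hm', hmr'⟩ (by exact_mod_cast h4.le)
  have : (∑ i, (m' i).natAbs) < ∑ i, (m i).natAbs := by exact_mod_cast h4
  exact absurd h5 (not_le.2 this)

/-- A pointed rational cone is generated by its primitive generators. -/
theorem IsRational.exists_generators {σ : PointedCone ℝ (Fin d → ℝ)} (h : IsRational σ)
    (hpt : ∀ x ∈ σ, -x ∈ σ → x = 0) :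
    ∃ (k : ℕ) (v : Fin k → Fin d → ℤ), (∀ j, IsPrimitiveGenerator σ (v j)) ∧
      σ = PointedCone.hull ℝ (Set.range fun j => latticePoint (v j)) := by
  classical
  obtain ⟨s, hs⟩ := h
  obtain ⟨t, hts, htσ, ht⟩ := exists_finset_rays hpt
    (s.image fun q i => (q i : ℝ)) (by rw [hs, Finset.coe_image])
  have hgen : ∀ x ∈ t, ∃ m, IsPrimitiveGenerator σ m ∧ x ∈ PointedCone.hull ℝ {latticePoint m} := by
    intro x hx
    obtain ⟨q, -, rfl⟩ := Finset.mem_image.1 (hts hx)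
    exact exists_isPrimitiveGenerator q (ht _ hx).1 (ht _ hx).2
  choose! g hg hgx using hgen
  refine ⟨t.card, fun j => g (t.equivFin.symm j), fun j => hg _ (t.equivFin.symm j).2,
    le_antisymm ?_ ?_⟩
  · rw [← htσ, Submodule.span_le]
    intro x hx
    refine Submodule.span_mono ?_ (hgx x hx)
    rw [Set.singleton_subset_iff]
    exact ⟨t.equivFin ⟨x, hx⟩, by simp⟩
  · rw [Submodule.span_le]
    rintro _ ⟨j, rfl⟩
    obtain ⟨-, r, hr, -, hmr, -⟩ := hg _ (t.equivFin.symm j).2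
    exact IsFace.le hr hmr

end Rays

/-! ### Ehrhart series of Gorenstein fans -/

section GorensteinFans

variable {d : ℕ}

theorem latticePoint_sub (m n : Fin d → ℤ) :
    latticePoint (m - n) = latticePoint m - latticePoint n := by
  ext i
  simp [latticePoint]

theorem IsGorensteinForm.cast_floor {σ : PointedCone ℝ (Fin d → ℝ)} {G : (Fin d → ℝ) →ₗ[ℝ] ℝ}
    (hG : IsGorensteinForm σ G) {m : Fin d → ℤ} (hm : latticePoint m ∈ σ) :
    ((⌊G (latticePoint m)⌋₊ : ℕ) : ℝ) = G (latticePoint m) := by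
  obtain ⟨n, hn⟩ := hG.1 m hm
  rw [hn, Nat.floor_natCast]

theorem IsPrimitiveGenerator.mem {σ : PointedCone ℝ (Fin d → ℝ)} {m : Fin d → ℤ}
    (h : IsPrimitiveGenerator σ m) : latticePoint m ∈ σ := by
  obtain ⟨-, r, hr, -, hmr, -⟩ := h
  exact IsFace.le hr hmr

/-- The Ehrhart series of a Gorenstein cone has denominator `(1 - t) ^ dim σ`: the lattice points
of `σ` are generated, over the primitive generators, by those with coordinates bounded by the ones
of the sum of the generators. -/
theorem countSeries_cone_mul_mem {σ : PointedCone ℝ (Fin d → ℝ)} (hrat : IsRational σ)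
    (hpt : ∀ x ∈ σ, -x ∈ σ → x = 0) {G : (Fin d → ℝ) →ₗ[ℝ] ℝ} (hG : IsGorensteinForm σ G) :
    HasFiniteFibers (fun m => ⌊G (latticePoint m)⌋₊) {m : Fin d → ℤ | latticePoint m ∈ σ} ∧
      countSeries (fun m => ⌊G (latticePoint m)⌋₊) {m : Fin d → ℤ | latticePoint m ∈ σ} *
        (1 - PowerSeries.X) ^ coneDim σ ∈ polynomialSeries := by
  classical
  obtain ⟨k, v, hv, hσ⟩ := hrat.exists_generators hpt
  have hvσ : ∀ j, latticePoint (v j) ∈ σ := fun j => (hv j).mem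
  set bound : Fin d → ℤ := fun i => ∑ j, |v j i| with hbound
  have hBfin : {m : Fin d → ℤ | latticePoint m ∈ σ ∧ m ∈ Set.Icc (-bound) bound}.Finite :=
    (Set.finite_Icc (-bound) bound).subset fun m hm => hm.2
  set B := hBfin.toFinset with hB
  have hmemB : ∀ m, m ∈ B ↔ latticePoint m ∈ σ ∧ m ∈ Set.Icc (-bound) bound := fun m =>
    Set.Finite.mem_toFinset _
  have hcomb : ∀ a : Fin k → ℕ, latticePoint (∑ j, a j • v j) =
      ∑ j, (a j : ℝ) • latticePoint (v j) := fun a => by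
    rw [latticePoint_sum]
    exact Finset.sum_congr rfl fun j _ => latticePoint_nsmul _ _
  refine countSeries_lattice_mul_mem v (fun i => (B.equivFin.symm i).1) _ (fun m => ?_) _
    (fun i a => ?_) (Submodule.span ℝ (σ : Set (Fin d → ℝ)))
    fun j => Submodule.subset_span (hvσ j)
  · constructor
    · intro hm
      have hm : latticePoint m ∈ σ := hm
      have hm' := hm
      rw [hσ, Submodule.mem_span_range_iff_exists_fun] at hm'
      obtain ⟨c, hc⟩ := hm'
      have hc : ∑ j, (c j : ℝ) • latticePoint (v j) = latticePoint m := hc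
      set a : Fin k → ℕ := fun j => ⌊(c j : ℝ)⌋₊ with ha
      have hfr : ∀ j, 0 ≤ (c j : ℝ) - a j ∧ (c j : ℝ) - a j ≤ 1 := fun j =>
        ⟨sub_nonneg.2 (Nat.floor_le (c j).2), by
          have := Nat.lt_floor_add_one (c j : ℝ)
          simp only [ha]
          linarith⟩
      have hrem : latticePoint (m - ∑ j, a j • v j) =
          ∑ j, ((c j : ℝ) - a j) • latticePoint (v j) := by
        rw [latticePoint_sub, hcomb, ← hc, ← Finset.sum_sub_distrib]
        exact Finset.sum_congr rfl fun j _ => (sub_smul _ _ _).symm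
      have habs : ∀ i, |(m - ∑ j, a j • v j) i| ≤ bound i := by
        intro i
        have h1 := congrFun hrem i
        rw [Finset.sum_apply] at h1
        have h2 : |((m - ∑ j, a j • v j) i : ℝ)| ≤ ∑ j, |(v j i : ℝ)| := by
          change |latticePoint (m - ∑ j, a j • v j) i| ≤ _
          rw [h1]
          refine (Finset.abs_sum_le_sum_abs _ _).trans (Finset.sum_le_sum fun j _ => ?_)
          rw [Pi.smul_apply, smul_eq_mul, abs_mul, abs_of_nonneg (hfr j).1]
          exact mul_le_of_le_one_left (abs_nonneg _) (hfr j).2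
        exact_mod_cast h2
      have hmem : m - ∑ j, a j • v j ∈ B := by
        refine (hmemB _).2 ⟨?_, fun i => (abs_le.1 (habs i)).1, fun i => (abs_le.1 (habs i)).2⟩
        rw [hrem]
        exact sum_mem fun j _ => σ.smul_mem (hfr j).1 (hvσ j)
      refine ⟨B.equivFin ⟨_, hmem⟩, a, ?_⟩
      rw [Equiv.symm_apply_apply, sub_add_cancel]
    · rintro ⟨i, a, rfl⟩
      change latticePoint _ ∈ σ
      rw [latticePoint_add, hcomb]
      exact add_mem ((hmemB _).1 (B.equivFin.symm i).2).1
        (sum_mem fun j _ => σ.smul_mem (Nat.cast_nonneg _) (hvσ j))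
  · have h1 : G (latticePoint (∑ j, a j • v j)) = ((∑ j, a j : ℕ) : ℝ) := by
      rw [hcomb, map_sum, Nat.cast_sum]
      refine Finset.sum_congr rfl fun j _ => ?_
      rw [map_smul, hG.2 _ (hv j), smul_eq_mul, mul_one]
    rw [latticePoint_add, map_add, h1, ← hG.cast_floor ((hmemB _).1 (B.equivFin.symm i).2).1,
      ← Nat.cast_add, Nat.floor_natCast, Nat.floor_natCast]

variable {Δ : Set (PointedCone ℝ (Fin d → ℝ))}

theorem IsFan.isPrimitiveGenerator_mono (h : IsFan Δ) {τ σ : PointedCone ℝ (Fin d → ℝ)}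
    (hτ : τ ∈ Δ) (hσ : σ ∈ Δ) (hle : τ ≤ σ) {m : Fin d → ℤ} (hm : IsPrimitiveGenerator τ m) :
    IsPrimitiveGenerator σ m := by
  obtain ⟨h0, r, hr, h1⟩ := hm
  exact ⟨h0, r, h.isFace_of_le (h.face_mem τ hτ r hr) hσ ((IsFace.le hr).trans hle), h1⟩

/-- Gorenstein forms of two cones agree on the common face, since it is generated by primitive
generators of both. Hence the degree map is well defined. -/
theorem IsFan.gorensteinForm_eq (h : IsFan Δ) (hG : IsGorenstein Δ)
    {σ τ : PointedCone ℝ (Fin d → ℝ)} (hσ : σ ∈ Δ) (hτ : τ ∈ Δ) {G G' : (Fin d → ℝ) →ₗ[ℝ] ℝ}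
    (h1 : IsGorensteinForm σ G) (h2 : IsGorensteinForm τ G') {x : Fin d → ℝ} (hxσ : x ∈ σ)
    (hxτ : x ∈ τ) : G x = G' x := by
  have hρ := h.inf_mem hσ hτ
  obtain ⟨k, v, hv, hgen⟩ := (hG _ hρ).1.exists_generators (h.pointed _ hρ)
  have hx : x ∈ σ ⊓ τ := ⟨hxσ, hxτ⟩
  rw [hgen] at hx
  induction hx using Submodule.span_induction with
  | mem x hx =>
    obtain ⟨j, rfl⟩ := hx
    simp only
    rw [h1.2 _ (h.isPrimitiveGenerator_mono hρ hσ inf_le_left (hv j)),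
      h2.2 _ (h.isPrimitiveGenerator_mono hρ hτ inf_le_right (hv j))]
  | zero => rw [map_zero, map_zero]
  | add x y hx hy ihx ihy =>
    have hx : x ∈ σ ⊓ τ := by rw [hgen]; exact hx
    have hy : y ∈ σ ⊓ τ := by rw [hgen]; exact hy
    rw [map_add, map_add, ihx hx.1 hx.2, ihy hy.1 hy.2]
  | smul c x hx ih =>
    have hx : x ∈ σ ⊓ τ := by rw [hgen]; exact hx
    rw [show c • x = (c : ℝ) • x from rfl, map_smul, map_smul, ih hx.1 hx.2]

theorem IsFan.degreeMap_eq (h : IsFan Δ) (hG : IsGorenstein Δ) {σ : PointedCone ℝ (Fin d → ℝ)}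
    (hσ : σ ∈ Δ) {G : (Fin d → ℝ) →ₗ[ℝ] ℝ} (hGσ : IsGorensteinForm σ G) {x : Fin d → ℝ}
    (hx : x ∈ σ) : degreeMap Δ x = G x := by
  have hex : ∃ r : ℝ, ∃ σ ∈ Δ, x ∈ σ ∧ ∃ G, IsGorensteinForm σ G ∧ G x = r :=
    ⟨G x, σ, hσ, hx, G, hGσ, rfl⟩
  rw [degreeMap, dif_pos hex]
  obtain ⟨τ, hτ, hxτ, G', hG', he⟩ := hex.choose_spec
  rw [← he]
  exact h.gorensteinForm_eq hG hτ hσ hG' hGσ hxτ hx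

/-- The degree of a lattice point of the support. It is a natural number there, so that the floor
only changes its type. -/
def latticeDegree (Δ : Set (PointedCone ℝ (Fin d → ℝ))) (m : Fin d → ℤ) : ℕ :=
  ⌊degreeMap Δ (latticePoint m)⌋₊

theorem IsFan.ehrhartSeries_eq (h : IsFan Δ) (hG : IsGorenstein Δ) :
    ehrhartSeries Δ = countSeries (latticeDegree Δ) {m | latticePoint m ∈ support Δ} := by
  ext n
  rw [ehrhartSeries, countSeries, PowerSeries.coeff_mk, PowerSeries.coeff_mk, Nat.cast_inj]
  congr 1
  ext m
  refine and_congr_right fun ⟨σ, hσ, hm⟩ => ?_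
  obtain ⟨-, G, hGσ⟩ := hG σ hσ
  change degreeMap Δ (latticePoint m) = n ↔ ⌊degreeMap Δ (latticePoint m)⌋₊ = n
  rw [h.degreeMap_eq hG hσ hGσ hm, ← hGσ.cast_floor hm, Nat.floor_natCast, Nat.cast_inj]

theorem support_faces (σ : PointedCone ℝ (Fin d → ℝ)) : support (faces σ) = σ := by
  ext x
  exact ⟨fun ⟨F, hF, hx⟩ => IsFace.le hF hx, fun hx => ⟨σ, self_mem_faces σ, hx⟩⟩

theorem countSeries_congr {α : Type*} {deg deg' : α → ℕ} {S : Set α}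
    (h : ∀ x ∈ S, deg x = deg' x) : countSeries deg S = countSeries deg' S := by
  ext n
  rw [countSeries, countSeries, PowerSeries.coeff_mk, PowerSeries.coeff_mk, Nat.cast_inj]
  congr 1
  ext x
  refine and_congr_right fun hx => ?_
  change deg x = n ↔ deg' x = n
  rw [h x hx]

theorem IsFan.latticeDegree_eq (h : IsFan Δ) (hG : IsGorenstein Δ)
    {σ : PointedCone ℝ (Fin d → ℝ)} (hσ : σ ∈ Δ) {G : (Fin d → ℝ) →ₗ[ℝ] ℝ}
    (hGσ : IsGorensteinForm σ G) {m : Fin d → ℤ} (hm : latticePoint m ∈ σ) :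
    latticeDegree Δ m = ⌊G (latticePoint m)⌋₊ := by
  rw [latticeDegree, h.degreeMap_eq hG hσ hGσ hm]

theorem IsFan.ehrhartSeries_faces_eq (h : IsFan Δ) (hG : IsGorenstein Δ)
    {σ : PointedCone ℝ (Fin d → ℝ)} (hσ : σ ∈ Δ) :
    ehrhartSeries (FanEhrhart.faces σ) =
      countSeries (latticeDegree Δ) {m | latticePoint m ∈ σ} := by
  have hG' : IsGorenstein (FanEhrhart.faces σ) := fun τ hτ => hG τ (h.face_mem σ hσ τ hτ)
  obtain ⟨-, G, hGσ⟩ := hG σ hσ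
  rw [(h.faces hσ).ehrhartSeries_eq hG', support_faces]
  refine countSeries_congr fun m hm => ?_
  rw [h.latticeDegree_eq hG hσ hGσ hm,
    (h.faces hσ).latticeDegree_eq hG' (self_mem_faces σ) hGσ hm]

theorem IsFan.countSeries_mul_mem (h : IsFan Δ) (hG : IsGorenstein Δ)
    {σ : PointedCone ℝ (Fin d → ℝ)} (hσ : σ ∈ Δ) :
    HasFiniteFibers (latticeDegree Δ) {m | latticePoint m ∈ σ} ∧
      countSeries (latticeDegree Δ) {m | latticePoint m ∈ σ} *
        (1 - PowerSeries.X) ^ coneDim σ ∈ polynomialSeries := by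
  obtain ⟨hr, G, hGσ⟩ := hG σ hσ
  obtain ⟨h1, h2⟩ := countSeries_cone_mul_mem hr (h.pointed σ hσ) hGσ
  have e : countSeries (latticeDegree Δ) {m | latticePoint m ∈ σ} =
      countSeries (fun m => ⌊G (latticePoint m)⌋₊) {m | latticePoint m ∈ σ} :=
    countSeries_congr fun m hm => h.latticeDegree_eq hG hσ hGσ hm
  rw [← e] at h2
  refine ⟨fun n => (h1 n).subset ?_, h2⟩
  rintro m ⟨hm, hn⟩
  exact ⟨hm, (h.latticeDegree_eq hG hσ hGσ hm).symm.trans hn⟩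

theorem IsFan.isHStar_faces (h : IsFan Δ) (hG : IsGorenstein Δ)
    {σ : PointedCone ℝ (Fin d → ℝ)} (hσ : σ ∈ Δ) :
    IsHStar (FanEhrhart.faces σ) (hStar (FanEhrhart.faces σ)) := by
  refine thePoly_spec ?_
  obtain ⟨p, hp⟩ := mem_polynomialSeries.1 (h.countSeries_mul_mem hG hσ).2
  refine ⟨p, ?_⟩
  rw [IsHStar, h.ehrhartSeries_faces_eq hG hσ, fanDim_faces, hp]

/-- Each point of the support lies in a smallest cone of the fan. -/
theorem IsFan.exists_carrier (h : IsFan Δ) {x : Fin d → ℝ} (hx : x ∈ support Δ) :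
    ∃ σ : Δ, ∀ τ : Δ, x ∈ τ.1 ↔ σ ≤ τ := by
  obtain ⟨σ, ⟨hσ, hxσ⟩, hmin⟩ := (h.finite.subset
    (fun σ hσ => hσ.1 : {σ | σ ∈ Δ ∧ x ∈ σ} ⊆ Δ)).exists_minimal hx
  refine ⟨⟨σ, hσ⟩, fun τ => ⟨fun hτ => ?_, fun hle => hle hxσ⟩⟩
  exact (hmin ⟨h.inf_mem hσ τ.2, hxσ, hτ⟩ inf_le_left).trans inf_le_right

open Classical in
/-- The lattice points are partitioned by their smallest cones, into parts with generating
functions `e σ`. -/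
theorem IsFan.exists_partition (h : IsFan Δ) (hG : IsGorenstein Δ) [Fintype Δ] :
    ∃ e : Δ → PowerSeries ℤ, ehrhartSeries Δ = ∑ σ, e σ ∧
      ∀ τ : Δ, ehrhartSeries (FanEhrhart.faces τ.1) = ∑ σ with σ ≤ τ, e σ := by
  rcases isEmpty_or_nonempty Δ with hemp | hne
  · refine ⟨fun _ => 0, ?_, fun τ => hemp.elim τ⟩
    have : {m : Fin d → ℤ | latticePoint m ∈ support Δ} = ∅ :=
      Set.eq_empty_of_forall_notMem fun m ⟨σ, hσ, _⟩ => hemp.elim ⟨σ, hσ⟩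
    rw [h.ehrhartSeries_eq hG, this, countSeries_empty, Finset.sum_eq_zero fun _ _ => rfl]
  choose! carrier hc using fun (x : Fin d → ℝ) (hx : x ∈ support Δ) => h.exists_carrier hx
  have hfib : HasFiniteFibers (latticeDegree Δ) {m | latticePoint m ∈ support Δ} := by
    intro n
    refine (h.finite.biUnion fun σ hσ => (h.countSeries_mul_mem hG hσ).1 n).subset ?_
    rintro m ⟨⟨σ, hσ, hm⟩, hn⟩
    exact Set.mem_biUnion hσ ⟨hm, hn⟩
  refine ⟨fun σ => countSeries (latticeDegree Δ)
    ({m | latticePoint m ∈ support Δ} ∩ {m | carrier (latticePoint m) = σ}), ?_, fun τ => ?_⟩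
  · rw [h.ehrhartSeries_eq hG]
    exact countSeries_eq_sum hfib Finset.univ (fun m => carrier (latticePoint m))
      fun _ _ => Finset.mem_univ _
  · have hsub : {m : Fin d → ℤ | latticePoint m ∈ τ.1} ⊆ {m | latticePoint m ∈ support Δ} :=
      fun m hm => ⟨τ.1, τ.2, hm⟩
    rw [h.ehrhartSeries_faces_eq hG τ.2, countSeries_eq_sum (hfib.mono hsub)
      (Finset.univ.filter (· ≤ τ))
      (fun m => carrier (latticePoint m)) fun m hm =>
        Finset.mem_filter.2 ⟨Finset.mem_univ _, (hc _ (hsub hm) τ).1 hm⟩]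
    refine Finset.sum_congr rfl fun σ hσ => ?_
    congr 1
    ext m
    constructor
    · rintro ⟨hm, he⟩
      exact ⟨hsub hm, he⟩
    · rintro ⟨hm, he⟩
      have he' : carrier (latticePoint m) = σ := he
      exact ⟨(hc _ hm τ).2 (he'.symm ▸ (Finset.mem_filter.1 hσ).2), he⟩

theorem IsFan.localHStar_eq (h : IsFan Δ) [Fintype Δ] (σ : Δ) :
    localHStar σ.1 = ∑ τ : Δ, hStar (FanEhrhart.faces τ.1) *
      signedGDual (fun σ : Δ => coneDim σ.1) τ σ := by
  have hfin : (FanEhrhart.faces σ.1).Finite :=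
    h.finite.subset fun τ hτ => h.face_mem σ.1 σ.2 τ hτ
  rw [localHStar, finsum_mem_eq_finite_toFinset_sum _ hfin]
  refine Finset.sum_bij_ne_zero
    (fun τ hτ _ => ⟨τ, h.face_mem σ.1 σ.2 τ (hfin.mem_toFinset.1 hτ)⟩)
    (fun _ _ _ => Finset.mem_univ _) (fun _ _ _ _ _ _ he => congrArg Subtype.val he) ?_ ?_
  · intro τ _ hτ
    have hle : τ ≤ σ := by
      by_contra hn
      rw [isIncidence_signedGDual _ τ σ hn, mul_zero] at hτ
      exact hτ rfl
    refine ⟨τ.1, hfin.mem_toFinset.2 (h.isFace_of_le τ.2 σ.2 hle), ?_, rfl⟩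
    rw [h.toricGDual_link τ σ hle, mul_assoc]
    exact hτ
  · intro τ hτ _
    have hτ := hfin.mem_toFinset.1 hτ
    rw [h.toricGDual_link ⟨τ, h.face_mem σ.1 σ.2 τ hτ⟩ σ (IsFace.le hτ), mul_assoc]
    rfl

/-- The local formula. Both sides equal
`∑ hStar τ * (1 - t) ^ (d - dim τ) * (-1) ^ (dim σ - dim τ)`, the sum over all pairs `τ ≤ σ`: the
Ehrhart series by Möbius inversion, and the sum of the local contributions by Stanley's inversion
formula. -/
theorem IsFan.isHStar_sum_local (h : IsFan Δ) (hp : IsPure d Δ) (hG : IsGorenstein Δ) :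
    IsHStar Δ (∑ᶠ σ ∈ Δ, localHStar σ * toricH (link Δ σ)) := by
  classical
  have hfin := h.finite.to_subtype
  have := Fintype.ofFinite Δ
  have hE := h.isEulerian
  obtain ⟨e, he, heτ⟩ := h.exists_partition hG
  have hsum : ∑ᶠ σ ∈ Δ, localHStar σ * toricH (link Δ σ) =
      ∑ σ : Δ, localHStar σ.1 * toricH (link Δ σ.1) := by
    rw [← finsum_eq_sum_of_fintype, finsum_set_coe_eq_finsum_mem
      (f := fun σ => localHStar σ * toricH (link Δ σ))]
  rw [IsHStar, hsum]
  rcases Δ.eq_empty_or_nonempty with hemp | hne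
  · have : IsEmpty Δ := Set.isEmpty_coe_sort.2 hemp
    rw [he]
    simp
  obtain ⟨hdim, hmax⟩ := fanDim_eq_of_isPure h.finite hp hne
  obtain ⟨H, hH1, hH2⟩ := hE.exists_reversal_of_sum (d := d) fun σ => (hmax σ.1 σ.2).1
  have hHeq : ∀ σ : Δ, toricH (link Δ σ.1) = H σ := fun σ =>
    h.toricH_link_eq (fun σ hσ => (hmax σ hσ).1) σ (hmax σ.1 σ.2).2 (hH1 σ)
  have hR : ∑ σ : Δ, localHStar σ.1 * toricH (link Δ σ.1) =
      ∑ σ : Δ, ∑ τ : Δ with τ ≤ σ, hStar (FanEhrhart.faces τ.1) *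
        ((-1) ^ (coneDim σ.1 - coneDim τ.1) * (1 - X) ^ (d - coneDim τ.1)) := by
    simp only [hHeq, h.localHStar_eq, Finset.sum_mul, mul_assoc]
    rw [Finset.sum_comm]
    have h1 : ∀ τ : Δ, ∑ σ, hStar (FanEhrhart.faces τ.1) *
        (signedGDual (fun σ : Δ => coneDim σ.1) τ σ * H σ) = ∑ σ : Δ with τ ≤ σ,
          hStar (FanEhrhart.faces τ.1) *
            ((-1) ^ (coneDim σ.1 - coneDim τ.1) * (1 - X) ^ (d - coneDim τ.1)) := by
      intro τ
      rw [← Finset.mul_sum, ← Finset.mul_sum]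
      congr 1
      have h2 := congrFun hH2 τ
      simp only [Matrix.mulVec, dotProduct] at h2
      rw [h2, Finset.sum_filter]
      refine Finset.sum_congr rfl fun σ _ => ?_
      rw [kernel]
      split_ifs with hle
      · have h3 : coneDim τ.1 ≤ coneDim σ.1 := hE.strictMono.monotone hle
        have h4 := (hmax σ.1 σ.2).1
        rw [show d - coneDim τ.1 = (coneDim σ.1 - coneDim τ.1) + (d - coneDim σ.1) by omega,
          pow_add, ← mul_assoc, ← mul_pow]
        congr 2
        ring
      · rw [zero_mul]
    rw [Finset.sum_congr rfl fun τ _ => h1 τ]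
    simp only [Finset.sum_filter]
    exact Finset.sum_comm
  have hcone : ∀ τ : Δ, ehrhartSeries (FanEhrhart.faces τ.1) *
      (1 - PowerSeries.X) ^ coneDim τ.1 = (hStar (FanEhrhart.faces τ.1) : PowerSeries ℤ) := by
    intro τ
    have := h.isHStar_faces hG τ.2
    rwa [IsHStar, fanDim_faces] at this
  rw [hdim, he, hR, Finset.sum_mul]
  have hcoe : ∀ p : ℤ[X], (p : PowerSeries ℤ) = Polynomial.coeToPowerSeries.ringHom p :=
    fun _ => rfl
  rw [hcoe, map_sum]
  refine Finset.sum_congr rfl fun σ _ => ?_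
  rw [hE.mobius_inversion e (fun τ => ehrhartSeries (FanEhrhart.faces τ.1)) heτ σ, map_sum,
    Finset.sum_mul]
  refine Finset.sum_congr rfl fun τ _ => ?_
  rw [map_mul, ← hcoe (hStar _), ← hcone τ, map_mul, map_pow, map_pow, map_neg, map_one, map_sub,
    map_one, ← hcoe X, Polynomial.coe_X]
  have h5 := (hmax τ.1 τ.2).1
  rw [show (1 - PowerSeries.X : PowerSeries ℤ) ^ d =
    (1 - PowerSeries.X) ^ coneDim τ.1 * (1 - PowerSeries.X) ^ (d - coneDim τ.1) by
      rw [← pow_add, Nat.add_sub_cancel' h5]]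
  ring

end GorensteinFans

end

end FanEhrhart

theorem mainTheorem11 (d : ℕ) (Δ : Set (PointedCone ℝ (Fin d → ℝ)))
    (hΔ : FanEhrhart.IsQuasiConvex Δ) (hG : FanEhrhart.IsGorenstein Δ) :
    FanEhrhart.IsHStar Δ (FanEhrhart.hStar Δ) ∧
    (∀ σ ∈ Δ, FanEhrhart.IsHStar (FanEhrhart.faces σ) (FanEhrhart.hStar (FanEhrhart.faces σ))) ∧
    FanEhrhart.hStar Δ =
      ∑ᶠ σ ∈ Δ, FanEhrhart.localHStar σ * FanEhrhart.toricH (FanEhrhart.link Δ σ) := by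
  have hloc := hΔ.isFan.isHStar_sum_local hΔ.isPure hG
  have hstar : FanEhrhart.IsHStar Δ (FanEhrhart.hStar Δ) := FanEhrhart.thePoly_spec ⟨_, hloc⟩
  exact ⟨hstar, fun σ hσ => hΔ.isFan.isHStar_faces hG hσ,
    Polynomial.coe_injective ℤ (hstar.symm.trans hloc)⟩
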